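/- Manifolds are smooth, finite-dimensional, Hausdorff and second countable. Let $G$ be a (Hausdorff) foliation groupoid, i.e. a Lie groupoid with range and source submersions $r,s:G\to M$, $M=G^{(0)}$, whose anchor ($ds$ restricted to $\ker dr$ along $M$) is injective; write $G^m=r^{-1}(m)$. Let $\mathcal F$ be the foliation of $M$ whose tangent bundle is the image of the anchor, and $\mathcal D$ the line bundle of (complex) leafwise densities on $M$. For each $g$, $ds$ identifies $T_g G^{r(g)}$ with $T_{s(g)}\mathcal F$. The convolution algebra is $\mathcal B=C_c^\infty(G;s^*\mathcal D)$ with product $(b_1b_2)(g)=\int_{g'g''=g}b_1(g')\,b_2(g'')$. Let $P$ be a smooth right $G$-manifold with submersion $\pi:P\to M$, fibres $Z_m=\pi^{-1}(m)$ and fibrewise density bundle $\mathcal D_Z$, on which $G$ acts freely, properly and cocompactly. Let $E$ be a $G$-invariant $\mathbb Z/2$-graded complex vector bundle on $P$, with supertrace $\operatorname{tr}_s$ on $\operatorname{End}(E)$, and let $\mathcal E=C_c^\infty(P;E)$, a left $\mathcal B$-module via $(b\xi)(p)=\int_{G^{\pi(p)}}b(g)\,\xi(pg)$, where $E_{pg}$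 is identified with $E_p$ by the action. Let $\operatorname{End}^\infty_{\mathcal B}(\mathcal E)$ be the set of linear operators $K$ on $\mathcal E$ which commute with $\mathcal B$ and have the form $$(K\xi)(p)=\int_{Z_{\pi(p)}}K(p'|p)\,\xi(p')$$ for a smooth kernel $K(p'|p)\in(\mathcal D_Z)_{p'}\otimes\operatorname{Hom}(E_{p'},E_p)$ on $P\times_M P$ whose support is compact modulo the diagonal action of $G$, i.e. is contained in the $G$-saturation of a compact subset of $P\times_MP$. It is graded by the $\mathbb Z/2$-grading of $\mathcal E$. Let $\Phi\in C_c^\infty(P;\pi^*\mathcal D)$ satisfy $\int_{G^{\pi(p)}}\Phi(pg)=1$ for all $p\in P$. Let $\rho$ be a ($\mathbb C$-)linear functional on $C_c^\infty(M;\mathcal D)$ (no continuity is assumed) such that $b\mapsto\rho(b|_M)$ is a trace on $\mathcal B$. Then $\operatorname{End}^\infty_{\mathcal B}(\mathcal E)$ is an algebra under composition, the formula $$(\tau K)(m)=\int_{Z_m}\Phi(p)\,\operatorname{tr}_sK(p|p)$$ defines a linear map $\tau:\operatorname{End}^\infty_{\mathcal B}(\mathcal E)\to C_c^\infty(M;\mathcal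 D)$, and $\rho\circ\tau$ is a supertrace: for homogeneous $K_1,K_2\in\operatorname{End}^\infty_{\mathcal B}(\mathcal E)$, $$\rho(\tau(K_1K_2))=(-1)^{|K_1||K_2|}\,\rho(\tau(K_2K_1)).$$ -/

import Mathlib

open Set MeasureTheory
open Bundle Manifold
open scoped ContDiff Topology

noncomputable section

/-- The Euclidean space `ℝⁿ`, the model space of `n`-manifolds. -/
abbrev Eu (n : ℕ) : Type := EuclideanSpace ℝ (Fin n)

/-! ### Densities and integration along the fibres of a submersion -/

section Densities

variable {V A : Type*} [AddCommGroup V] [Module ℝ V] [AddCommGroup A] [Module ℂ A]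

/-- An `A`-valued density on a `k`-dimensional subspace `W` of `V`: a function `θ` of `k`-tuples of
vectors of `W` with `θ (B v) = |det B| θ v` for every real `k × k` matrix `B`. As a function on all
`k`-tuples of vectors of `V` it is extended by zero. -/
def IsDensity {k : ℕ} (W : Submodule ℝ V) (θ : (Fin k → V) → A) : Prop :=
  (∀ v, (∃ i, v i ∉ W) → θ v = 0) ∧
  ∀ v, (∀ i, v i ∈ W) → ∀ B : Matrix (Fin k) (Fin k) ℝ,
    θ (fun i => ∑ j, B i j • v j) = ((|B.det| : ℝ) : ℂ) • θ v

theorem IsDensity.zero {k : ℕ} (W : Submodule ℝ V) :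
    IsDensity W (0 : (Fin k → V) → A) :=
  ⟨fun _ _ => rfl, fun _ _ _ => by simp⟩

theorem IsDensity.add {k : ℕ} {W : Submodule ℝ V} {θ θ' : (Fin k → V) → A}
    (h : IsDensity W θ) (h' : IsDensity W θ') : IsDensity W (θ + θ') :=
  ⟨fun v hv => by simp [h.1 v hv, h'.1 v hv],
    fun v hv B => by simp [h.2 v hv B, h'.2 v hv B]⟩

theorem IsDensity.smul {k : ℕ} {W : Submodule ℝ V} {θ : (Fin k → V) → A} (c : ℂ)
    (h : IsDensity W θ) : IsDensity W (c • θ) :=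
  ⟨fun v hv => by simp [h.1 v hv],
    fun v hv B => by
      rw [Pi.smul_apply, Pi.smul_apply, h.2 v hv B, smul_comm]⟩

end Densities

section Fibres

variable {a b : ℕ} {N M : Type*}
  [TopologicalSpace N] [ChartedSpace (Eu a) N] [TopologicalSpace M] [ChartedSpace (Eu b) M]

/-- The differential of `f : N → M` at `y`. A tangent vector of an `n`-manifold is, by the
definition of `TangentSpace`, an element of `ℝⁿ` (its coordinates in the preferred chart). -/
def tder (f : N → M) (y : N) : Eu a →L[ℝ] Eu b := mfderiv (𝓡 a) (𝓡 b) f y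

/-- The tangent space at `y` of the fibre of `f` through `y`, i.e. the kernel of the differential. -/
def vertical (f : N → M) (y : N) : Submodule ℝ (Eu a) :=
  LinearMap.ker (tder (a := a) (b := b) f y : Eu a →ₗ[ℝ] Eu b)

/-- `X` is a smooth frame, over the set `U`, of the family of subspaces `W y` of the tangent spaces
of `N`. -/
def IsSmoothFrameOn [IsManifold (𝓡 a) ∞ N] {k : ℕ} (W : N → Submodule ℝ (Eu a)) (U : Set N)
    (X : N → Fin k → Eu a) : Prop :=
  (∀ i, ContMDiffOn (𝓡 a) (𝓡 a).tangent ∞ (fun y => (⟨y, X y i⟩ : TangentBundle (𝓡 a) N)) U) ∧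
  ∀ y ∈ U, LinearIndependent ℝ (X y) ∧ ∀ i, X y i ∈ W y

/-- A smooth local parametrization, by an open subset of `ℝᵏ`, of an open subset of the
fibre `f ⁻¹ {m}`. -/
structure FiberChart (k : ℕ) (a : ℕ) {N M : Type*} [TopologicalSpace N] [ChartedSpace (Eu a) N]
    (f : N → M) (m : M) where
  toFun : Eu k → N
  source : Set (Eu k)
  isOpen_source : IsOpen source
  contMDiffOn : ContMDiffOn (𝓡 k) (𝓡 a) ∞ toFun source
  injective_der : ∀ x ∈ source, Function.Injective (tder (a := k) (b := a) toFun x)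
  injOn : InjOn toFun source
  maps : ∀ x ∈ source, f (toFun x) = m
  open_map : ∀ O ⊆ source, IsOpen O → ∃ O' : Set N, IsOpen O' ∧ toFun '' O = O' ∩ f ⁻¹' {m}

/-- `HasFiberIntegral k f m θ I` says that the family of densities `θ y` on the `k`-dimensional
tangent spaces of the fibre `f ⁻¹ {m}` has compact support in that fibre, and that `I` is its
integral over the fibre: cut `θ` by a partition of unity on its support whose members have compact
supports in parametrized pieces of the fibre, pull the pieces back to `ℝᵏ`, and integrate
them against Lebesgue measure. -/
def HasFiberIntegral (k : ℕ) (f : N → M) (m : M) (θ : N → (Fin k → Eu a) → ℂ) (I : ℂ) : Prop :=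
  ∃ (l : ℕ) (φ : Fin l → FiberChart k a f m) (χ : Fin l → N → ℝ),
    (∀ i, Continuous (χ i)) ∧
    (∀ i, ∃ C ⊆ (φ i).source, IsCompact C ∧
      ∀ y, f y = m → χ i y ≠ 0 → y ∈ (φ i).toFun '' C) ∧
    (∀ y, f y = m → ∀ v, (∀ j, v j ∈ vertical (b := b) f y) → θ y v ≠ 0 → ∑ i, χ i y = 1) ∧
    (∀ i, IntegrableOn (fun x => (χ i ((φ i).toFun x) : ℂ) *
      θ ((φ i).toFun x) (fun j => tder (φ i).toFun x (EuclideanSpace.single j 1)))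
      (φ i).source) ∧
    I = ∑ i, ∫ x in (φ i).source, (χ i ((φ i).toFun x) : ℂ) *
      θ ((φ i).toFun x) (fun j => tder (φ i).toFun x (EuclideanSpace.single j 1))

end Fibres

/-! ### Foliation groupoids and their convolution algebra -/

/-- A Lie groupoid with manifold of arrows `G` (of dimension `n + k`) and manifold of units `M` (of
dimension `n`). The product `mul g h` is meaningful when `src g = rng h`; its other values are
irrelevant. A function on the submanifold of composable pairs is smooth iff it is
`ContMDiffOn` that subset of `G × G`. -/
structure LieGroupoid (n k : ℕ) (M G : Type*) [TopologicalSpace M] [ChartedSpace (Eu n) M]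
    [TopologicalSpace G] [ChartedSpace (Eu (n + k)) G] where
  src : G → M
  rng : G → M
  unit : M → G
  inv : G → G
  mul : G → G → G
  submersion_src : IsSubmersion (𝓡 (n + k)) (𝓡 n) ∞ src
  submersion_rng : IsSubmersion (𝓡 (n + k)) (𝓡 n) ∞ rng
  contMDiff_unit : ContMDiff (𝓡 n) (𝓡 (n + k)) ∞ unit
  contMDiff_inv : ContMDiff (𝓡 (n + k)) (𝓡 (n + k)) ∞ inv
  contMDiffOn_mul : ContMDiffOn ((𝓡 (n + k)).prod (𝓡 (n + k))) (𝓡 (n + k)) ∞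
    (fun x : G × G => mul x.1 x.2) {x | src x.1 = rng x.2}
  src_unit : ∀ m, src (unit m) = m
  rng_unit : ∀ m, rng (unit m) = m
  src_inv : ∀ g, src (inv g) = rng g
  rng_inv : ∀ g, rng (inv g) = src g
  src_mul : ∀ g h, src g = rng h → src (mul g h) = src h
  rng_mul : ∀ g h, src g = rng h → rng (mul g h) = rng g
  mul_assoc : ∀ g h j, src g = rng h → src h = rng j → mul (mul g h) j = mul g (mul h j)
  unit_mul : ∀ g, mul (unit (rng g)) g = g
  mul_unit : ∀ g, mul g (unit (src g)) = g
  mul_inv : ∀ g, mul g (inv g) = unit (rng g)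
  inv_mul : ∀ g, mul (inv g) g = unit (src g)

namespace LieGroupoid

variable {n k : ℕ} {M G : Type*} [TopologicalSpace M] [ChartedSpace (Eu n) M]
  [IsManifold (𝓡 n) ∞ M]
  [TopologicalSpace G] [ChartedSpace (Eu (n + k)) G] (𝒢 : LieGroupoid n k M G)

/-- A foliation groupoid: the anchor, i.e. the restriction of `ds` to `ker dr` at the units, is
injective. -/
def IsFoliationGroupoid : Prop :=
  ∀ m, ∀ X ∈ vertical (a := n + k) (b := n) 𝒢.rng (𝒢.unit m),
    tder (a := n + k) (b := n) 𝒢.src (𝒢.unit m) X = 0 → X = 0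

/-- The tangent space `T_m ℱ` of the foliation `ℱ` of `M`: the image of the anchor at `m`. -/
def leafTangent (m : M) : Submodule ℝ (Eu n) :=
  (vertical (a := n + k) (b := n) 𝒢.rng (𝒢.unit m)).map
    (tder (a := n + k) (b := n) 𝒢.src (𝒢.unit m) : Eu (n + k) →ₗ[ℝ] Eu n)

/-- The space `C_c^∞(N; f^*𝒟)` of smooth compactly supported (complex) sections of the pull-back by
`f : N → M` of the line bundle `𝒟` of leafwise densities on `M`. Smoothness is tested on the local
smooth frames of `T ℱ`. -/
def densitySections {a : ℕ} {N : Type*} [TopologicalSpace N] [ChartedSpace (Eu a) N]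
    (f : N → M) : Submodule ℂ (N → (Fin k → Eu n) → ℂ) where
  carrier := {σ | (∀ y, IsDensity (𝒢.leafTangent (f y)) (σ y)) ∧
    (∀ (U : Set M) (X : M → Fin k → Eu n), IsOpen U → IsSmoothFrameOn 𝒢.leafTangent U X →
      ContMDiffOn (𝓡 a) 𝓘(ℝ, ℂ) ∞ (fun y => σ y (X (f y))) (f ⁻¹' U)) ∧
    HasCompactSupport σ}
  add_mem' := fun hσ hσ' => ⟨fun y => (hσ.1 y).add (hσ'.1 y),
    fun U X hU hX => (hσ.2.1 U X hU hX).add (hσ'.2.1 U X hU hX), hσ.2.2.add hσ'.2.2⟩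
  zero_mem' := ⟨fun _ => IsDensity.zero _, fun _ _ _ _ => contMDiffOn_const,
    HasCompactSupport.zero⟩
  smul_mem' := fun c _ hσ => ⟨fun y => (hσ.1 y).smul c,
    fun U X hU hX => (c • ContinuousLinearMap.id ℝ ℂ).contMDiff.comp_contMDiffOn
      (hσ.2.1 U X hU hX), hσ.2.2.smul_left (f := fun _ => c)⟩

/-- The space `C_c^∞(M; 𝒟)`. -/
abbrev LeafDensities : Type _ := 𝒢.densitySections (a := n) (id : M → M)

/-- The convolution algebra `ℬ = C_c^∞(G; s^*𝒟)`, as a vector space. -/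
abbrev ConvAlg : Type _ := 𝒢.densitySections (a := n + k) 𝒢.src

/-- `c` is the convolution product of `b₁` and `b₂`:
`c g = ∫_{g' g'' = g} b₁ g' b₂ g''`. The integral is over `g' ∈ G^{r(g)}`, with `g'' = g'⁻¹ g`;
the leafwise density `b₁ g'` at `s(g')` is a density on `T_{g'} G^{r(g)}` by means
of `ds`. -/
def IsConv (b₁ b₂ c : 𝒢.ConvAlg) : Prop :=
  ∀ (g : G) (w : Fin k → Eu n),
    HasFiberIntegral (a := n + k) (b := n) k 𝒢.rng (𝒢.rng g)
      (fun g' v => b₁.1 g' (fun i => tder (a := n + k) (b := n) 𝒢.src g' (v i)) *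
        b₂.1 (𝒢.mul (𝒢.inv g') g) w) (c.1 g w)

/-- The linear functional `η` vanishes on the commutators of `ℬ`. -/
def IsTrace (η : 𝒢.ConvAlg →ₗ[ℂ] ℂ) : Prop :=
  ∀ b₁ b₂ c c' : 𝒢.ConvAlg, 𝒢.IsConv b₁ b₂ c → 𝒢.IsConv b₂ b₁ c' → η c = η c'

/-- The restriction `b ↦ b|_M` to the units, `ℬ → C_c^∞(M; 𝒟)`. -/
def restrictUnits [T2Space M] : 𝒢.ConvAlg →ₗ[ℂ] 𝒢.LeafDensities where
  toFun b := ⟨fun m => b.1 (𝒢.unit m), by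
    obtain ⟨b, h1, h2, h3⟩ := b
    refine ⟨fun m => ?_, fun U X hU hX => ?_, ?_⟩
    · have := h1 (𝒢.unit m)
      rwa [𝒢.src_unit] at this
    · have := (h2 U X hU hX).comp (s := U) (f := 𝒢.unit) 𝒢.contMDiff_unit.contMDiffOn
        (fun m hm => by simpa [𝒢.src_unit] using hm)
      refine this.congr fun m _ => ?_
      simp [𝒢.src_unit]
    · refine HasCompactSupport.intro (K := 𝒢.src '' tsupport b)
        (h3.isCompact.image 𝒢.submersion_src.contMDiff.continuous) fun m hm => ?_
      by_contra h
      exact hm ⟨𝒢.unit m, subset_tsupport _ h, 𝒢.src_unit m⟩⟩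
  map_add' _ _ := rfl
  map_smul' _ _ := rfl

end LieGroupoid

/-! ### Smooth `G`-manifolds -/

/-- A smooth (right) `G`-manifold `P` of dimension `n + d`, with submersion `π = proj : P → M`. The
point `act p g = p g` is meaningful when `proj p = rng g`; the other values are irrelevant. -/
structure GManifold {n k : ℕ} {M G : Type*} [TopologicalSpace M] [ChartedSpace (Eu n) M]
    [TopologicalSpace G] [ChartedSpace (Eu (n + k)) G] (𝒢 : LieGroupoid n k M G)
    (d : ℕ) (P : Type*) [TopologicalSpace P] [ChartedSpace (Eu (n + d)) P] where
  proj : P → M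
  act : P → G → P
  submersion_proj : IsSubmersion (𝓡 (n + d)) (𝓡 n) ∞ proj
  contMDiffOn_act : ContMDiffOn ((𝓡 (n + d)).prod (𝓡 (n + k))) (𝓡 (n + d)) ∞
    (fun x : P × G => act x.1 x.2) {x | proj x.1 = 𝒢.rng x.2}
  proj_act : ∀ p g, proj p = 𝒢.rng g → proj (act p g) = 𝒢.src g
  act_mul : ∀ p g h, proj p = 𝒢.rng g → 𝒢.src g = 𝒢.rng h →
    act (act p g) h = act p (𝒢.mul g h)
  act_unit : ∀ p, act p (𝒢.unit (proj p)) = p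

namespace GManifold

variable {n k d : ℕ} {M G P : Type*} [TopologicalSpace M] [ChartedSpace (Eu n) M]
  [IsManifold (𝓡 n) ∞ M]
  [TopologicalSpace G] [ChartedSpace (Eu (n + k)) G] {𝒢 : LieGroupoid n k M G}
  [TopologicalSpace P] [ChartedSpace (Eu (n + d)) P] (𝒬 : GManifold 𝒢 d P)

/-- The action is free. -/
def IsFree : Prop :=
  ∀ p g, 𝒬.proj p = 𝒢.rng g → 𝒬.act p g = p → g = 𝒢.unit (𝒬.proj p)

/-- The action is proper: the map `(p, g) ↦ (p, p g)` from `P ×_r G` to `P × P` is proper. -/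
def IsProper : Prop :=
  IsProperMap (fun x : {x : P × G // 𝒬.proj x.1 = 𝒢.rng x.2} =>
    ((x.1.1, 𝒬.act x.1.1 x.1.2) : P × P))

/-- The action is cocompact: the quotient space `P/G` is compact. -/
def IsCocompact : Prop :=
  CompactSpace (Quot (fun p p' : P => ∃ g, 𝒬.proj p' = 𝒢.rng g ∧ p = 𝒬.act p' g))

/-- The space `C_c^∞(P; π^*𝒟)`. -/
abbrev PullbackDensities : Type _ := 𝒢.densitySections (a := n + d) 𝒬.proj

/-- The cutoff condition `∫_{G^{π(p)}} Φ(p g) = 1` for all `p ∈ P`. -/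
def IsCutoff (Φ : 𝒬.PullbackDensities) : Prop :=
  ∀ p, HasFiberIntegral (a := n + k) (b := n) k 𝒢.rng (𝒬.proj p)
    (fun g v => Φ.1 (𝒬.act p g) (fun i => tder (a := n + k) (b := n) 𝒢.src g (v i))) 1

end GManifold

/-! ### Equivariant graded vector bundles, their sections, and smoothing operators -/

section Sections

variable {a : ℕ} {P : Type*} [TopologicalSpace P] [ChartedSpace (Eu a) P]
  (F : Type*) [NormedAddCommGroup F] [NormedSpace ℂ F]
  (E : P → Type*) [∀ p, AddCommGroup (E p)] [∀ p, Module ℂ (E p)]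
  [TopologicalSpace (TotalSpace F E)] [∀ p, TopologicalSpace (E p)]
  [FiberBundle F E] [VectorBundle ℂ F E] [VectorBundle ℝ F E]

/-- The space `C_c^∞(P; E)` of smooth compactly supported sections of a complex vector
bundle. -/
def CcSections : Submodule ℂ (∀ p, E p) where
  carrier := {ξ | ContMDiff (𝓡 a) ((𝓡 a).prod 𝓘(ℝ, F)) ∞
      (fun p => (⟨p, ξ p⟩ : TotalSpace F E)) ∧ IsCompact (closure {p | ξ p ≠ 0})}
  add_mem' := fun {ξ ζ} hξ hζ => ⟨hξ.1.add_section hζ.1, by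
    refine (hξ.2.union hζ.2).of_isClosed_subset isClosed_closure ?_
    rw [← closure_union]
    refine closure_mono fun p hp => ?_
    by_contra h
    have h1 : ξ p = 0 := by_contra fun h' => h (Or.inl h')
    have h2 : ζ p = 0 := by_contra fun h' => h (Or.inr h')
    exact hp (by simp [h1, h2])⟩
  zero_mem' := ⟨Bundle.contMDiff_zeroSection ℝ E, by simp⟩
  smul_mem' := fun c ξ hξ => ⟨fun p => by
    have h := hξ.1 p
    rw [Bundle.contMDiffAt_section] at h ⊢
    have hc : ContMDiffAt (𝓡 a) 𝓘(ℝ, F) ∞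
        (fun x => c • (trivializationAt F E p ⟨x, ξ x⟩).2) p :=
      (c • ContinuousLinearMap.id ℝ F).contMDiff.contMDiffAt.comp p h
    refine hc.congr_of_eventuallyEq ?_
    filter_upwards [(trivializationAt F E p).open_baseSet.mem_nhds
      (FiberBundle.mem_baseSet_trivializationAt' p)] with x hx
    exact ((trivializationAt F E p).linear ℂ hx).map_smul c (ξ x), by
    refine hξ.2.of_isClosed_subset isClosed_closure (closure_mono fun p hp h => ?_)
    exact hp (by simp [h])⟩

end Sections

/-- The structure of a `G`-invariant `ℤ/2`-graded vector bundle on a smooth complex vector bundle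
`E` on `P` (with typical fibre `F`): isomorphisms `lift p g : E_p ≃ E_{pg}` for `π(p) = r(g)`,
smooth in `p`, `g` and the vector, and compatible with products (for a free and proper action this
is the same as an identification of `E` with the pull-back of a vector bundle on `P/G`), and
a smooth invariant involution, whose `±1`-eigenbundles are the even and odd parts of `E`. -/
structure EquivariantGrading {n k d : ℕ} {M G P : Type*}
    [TopologicalSpace M] [ChartedSpace (Eu n) M]
    [TopologicalSpace G] [ChartedSpace (Eu (n + k)) G] {𝒢 : LieGroupoid n k M G}
    [TopologicalSpace P] [ChartedSpace (Eu (n + d)) P] (𝒬 : GManifold 𝒢 d P)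
    (F : Type*) [NormedAddCommGroup F] [NormedSpace ℂ F]
    (E : P → Type*) [∀ p, AddCommGroup (E p)] [∀ p, Module ℂ (E p)]
    [TopologicalSpace (TotalSpace F E)] [∀ p, TopologicalSpace (E p)] [FiberBundle F E] where
  lift : ∀ p g, E p ≃ₗ[ℂ] E (𝒬.act p g)
  grading : ∀ p, E p →ₗ[ℂ] E p
  contMDiffOn_lift :
    ContMDiffOn (((𝓡 (n + d)).prod 𝓘(ℝ, F)).prod (𝓡 (n + k))) ((𝓡 (n + d)).prod 𝓘(ℝ, F)) ∞
      (fun x : TotalSpace F E × G =>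
        (⟨𝒬.act x.1.proj x.2, lift x.1.proj x.2 x.1.snd⟩ : TotalSpace F E))
      {x | 𝒬.proj x.1.proj = 𝒢.rng x.2}
  lift_unit : ∀ p (e : E p),
    (⟨_, lift p (𝒢.unit (𝒬.proj p)) e⟩ : TotalSpace F E) = ⟨p, e⟩
  lift_mul : ∀ p g h (e : E p), 𝒬.proj p = 𝒢.rng g → 𝒢.src g = 𝒢.rng h →
    (⟨_, lift (𝒬.act p g) h (lift p g e)⟩ : TotalSpace F E) = ⟨_, lift p (𝒢.mul g h) e⟩
  contMDiff_grading : ContMDiff ((𝓡 (n + d)).prod 𝓘(ℝ, F)) ((𝓡 (n + d)).prod 𝓘(ℝ, F)) ∞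
    (fun x : TotalSpace F E => (⟨x.proj, grading x.proj x.snd⟩ : TotalSpace F E))
  grading_sq : ∀ p (e : E p), grading p (grading p e) = e
  grading_lift : ∀ p g (e : E p), 𝒬.proj p = 𝒢.rng g →
    grading (𝒬.act p g) (lift p g e) = lift p g (grading p e)

namespace EquivariantGrading

variable {n k d : ℕ} {M G P : Type*} [TopologicalSpace M] [ChartedSpace (Eu n) M]
  [IsManifold (𝓡 n) ∞ M]
  [TopologicalSpace G] [ChartedSpace (Eu (n + k)) G] {𝒢 : LieGroupoid n k M G}
  [TopologicalSpace P] [ChartedSpace (Eu (n + d)) P] [IsManifold (𝓡 (n + d)) ∞ P] {𝒬 : GManifold 𝒢 d P}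
  {F : Type*} [NormedAddCommGroup F] [NormedSpace ℂ F]
  {E : P → Type*} [∀ p, AddCommGroup (E p)] [∀ p, Module ℂ (E p)]
  [TopologicalSpace (TotalSpace F E)] [∀ p, TopologicalSpace (E p)]
  [FiberBundle F E] [VectorBundle ℂ F E] [VectorBundle ℝ F E]
  [ContMDiffVectorBundle ∞ F E (𝓡 (n + d))]
  (𝓔 : EquivariantGrading 𝒬 F E)

/-- The module `ℰ = C_c^∞(P; E)`, as a vector space. -/
abbrev Sec (_ : EquivariantGrading 𝒬 F E) : Type _ := CcSections (a := n + d) F E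

/-- `ζ` is the product `b ξ` of `b ∈ ℬ` and `ξ ∈ ℰ`: `ζ(p) = ∫_{G^{π(p)}} b(g) ξ(p g)`, where
`E_{p g}` is identified with `E_p`. The `E_p`-valued integral is computed
componentwise, i.e. after every linear functional on `E_p`. -/
def IsSMul (b : 𝒢.ConvAlg) (ξ ζ : 𝓔.Sec) : Prop :=
  ∀ (p : P) (ℓ : E p →ₗ[ℂ] ℂ),
    HasFiberIntegral (a := n + k) (b := n) k 𝒢.rng (𝒬.proj p)
      (fun g v => b.1 g (fun i => tder (a := n + k) (b := n) 𝒢.src g (v i)) *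
        ℓ ((𝓔.lift p g).symm (ξ.1 (𝒬.act p g)))) (ℓ (ζ.1 p))

/-- `K ∈ End_ℬ(ℰ)`: the operator `K` commutes with the action of `ℬ`. -/
def IsModuleEnd (K : Module.End ℂ 𝓔.Sec) : Prop :=
  ∀ (b : 𝒢.ConvAlg) (ξ ζ : 𝓔.Sec), 𝓔.IsSMul b ξ ζ → 𝓔.IsSMul b (K ξ) (K ζ)

/-- A kernel on `P ×_M P`: for `p', p` in the same fibre of `π`, the value `κ p' p` is
a `Hom(E_{p'}, E_p)`-valued density on the vertical tangent space at `p'`. The values at pairs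
`(p', p)` outside `P ×_M P` are irrelevant. -/
abbrev Kernel (_ : EquivariantGrading 𝒬 F E) : Type _ :=
  ∀ p' p : P, (Fin d → Eu (n + d)) → (E p' →ₗ[ℂ] E p)

/-- The kernel `κ` is a smooth section of `(q')^* 𝒟_Z ⊗ Hom((q')^* E, q^* E)` on `P ×_M P`, whose
support is compact modulo the diagonal action of `G`: it is contained in the set of
translates of a compact set `C`. -/
def IsSmoothKernel (κ : 𝓔.Kernel) : Prop :=
  (∀ p' p, 𝒬.proj p' = 𝒬.proj p →
    IsDensity (vertical (a := n + d) (b := n) 𝒬.proj p') (κ p' p)) ∧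
  (∀ (e' e : Trivialization F (Bundle.TotalSpace.proj : TotalSpace F E → P))
      [MemTrivializationAtlas e'] [MemTrivializationAtlas e]
      (U : Set P) (Y : P → Fin d → Eu (n + d)), IsOpen U →
      IsSmoothFrameOn (vertical (a := n + d) (b := n) 𝒬.proj) U Y → ∀ u : F,
    ContMDiffOn ((𝓡 (n + d)).prod (𝓡 (n + d))) 𝓘(ℝ, F) ∞
      (fun x : P × P => (e ⟨x.2, κ x.1 x.2 (Y x.1) (e'.symm x.1 u)⟩).2)
      {x | 𝒬.proj x.1 = 𝒬.proj x.2 ∧ x.1 ∈ U ∧ x.1 ∈ e'.baseSet ∧ x.2 ∈ e.baseSet}) ∧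
  ∃ C : Set (P × P), IsCompact C ∧ (∀ c ∈ C, 𝒬.proj c.1 = 𝒬.proj c.2) ∧
    ∀ p' p, 𝒬.proj p' = 𝒬.proj p → κ p' p ≠ 0 →
      ∃ c ∈ C, ∃ g, 𝒬.proj c.1 = 𝒢.rng g ∧ p' = 𝒬.act c.1 g ∧ p = 𝒬.act c.2 g

/-- `κ` is the Schwartz kernel of `K`: `(K ξ)(p) = ∫_{Z_{π(p)}} κ(p'|p) ξ(p')`. -/
def HasKernel (K : Module.End ℂ 𝓔.Sec) (κ : 𝓔.Kernel) : Prop :=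
  ∀ (ξ : 𝓔.Sec) (p : P) (ℓ : E p →ₗ[ℂ] ℂ),
    HasFiberIntegral (a := n + d) (b := n) d 𝒬.proj (𝒬.proj p)
      (fun p' v => ℓ (κ p' p v (ξ.1 p'))) (ℓ ((K ξ).1 p))

/-- The set `End^∞_ℬ(ℰ)` of the operators in `End_ℬ(ℰ)` with a smooth Schwartz kernel (of support
compact modulo `G`). -/
def smoothingEnd : Set (Module.End ℂ 𝓔.Sec) :=
  {K | 𝓔.IsModuleEnd K ∧ ∃ κ, 𝓔.IsSmoothKernel κ ∧ 𝓔.HasKernel K κ}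

/-- The grading operator on `ℰ`. -/
def gradingOp : Module.End ℂ 𝓔.Sec where
  toFun ξ := ⟨fun p => 𝓔.grading p (ξ.1 p), 𝓔.contMDiff_grading.comp ξ.2.1, by
    refine ξ.2.2.of_isClosed_subset isClosed_closure (closure_mono fun p hp h => ?_)
    exact hp (by simp [h])⟩
  map_add' ξ ζ := by ext p; simp
  map_smul' c ξ := by ext p; simp

/-- `K` is homogeneous of parity `i`: it commutes (`i` even) or anticommutes (`i` odd) with the
grading operator. -/
def HasParity (K : Module.End ℂ 𝓔.Sec) (i : ℕ) : Prop :=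
  K * 𝓔.gradingOp = (-1 : ℂ) ^ i • (𝓔.gradingOp * K)

/-- The supertrace on `End(E_p)`. -/
def trs (p : P) (L : E p →ₗ[ℂ] E p) : ℂ :=
  LinearMap.trace ℂ (E p) (𝓔.grading p ∘ₗ L)

/-- `β` is the leafwise density `τ K`, for an operator `K` with Schwartz kernel `κ`:
`β(m) = ∫_{Z_m} Φ(p) tr_s κ(p|p)`. -/
def IsTau (Φ : 𝒬.PullbackDensities) (κ : 𝓔.Kernel) (β : 𝒢.LeafDensities) : Prop :=
  ∀ (m : M) (w : Fin k → Eu n),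
    HasFiberIntegral (a := n + d) (b := n) d 𝒬.proj m
      (fun p v => Φ.1 p w * 𝓔.trs p (κ p p v)) (β.1 m w)

/-- The linear functional `T` on an algebra `A` of operators on `ℰ` is a supertrace: it vanishes on
the supercommutators of the homogeneous elements of `A`. -/
def IsSupertrace (A : NonUnitalSubalgebra ℂ (Module.End ℂ 𝓔.Sec)) (T : A →ₗ[ℂ] ℂ) : Prop :=
  ∀ (K L : A) (i j : ℕ), 𝓔.HasParity K.1 i → 𝓔.HasParity L.1 j →
    T (K * L) = (-1 : ℂ) ^ (i * j) * T (L * K)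

end EquivariantGrading

end

/-! Positive smooth volumes turn densities into functions. A partition of unity gives a positive
smooth volume `vol` of tuples of tangent vectors. It is used on vertical tuples along the fibres Z_m
and on leafwise tuples in M. Its pull-back `fiberVol` by ds is a positive density on the fibres G^m,
because ds is injective on vertical vectors. Relative to these volumes, Φ becomes a function φ in
C_c^∞(P) with ∫ φ(pg) dg = 1, and an operator K becomes a family T(q,p) : E_q → E_p. Every fibre
integral becomes an integral against a locally finite measure carried by the fibre
(`hasFiberIntegral_iff`). Fubini, change of variables and smooth dependence on parameters
(`contMDiffOn_integral_fibMeas`) are then available.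

Three facts carry the proof.

(1) A trace is invariant under inversion (`LieGroupoid.trace_inv`). For c in C_c^∞(G), let χ in
C_c^∞(G) equal 1 on the inverse of supp c. At the unit m the products c*χ and χ*c take the values ∫
c(g) dg and ∫ c(g⁻¹) dg over G^m, so ρ agrees on these two densities. This uses two honest elements
of the algebra and no limit, so continuity of ρ plays no role.

(2) Kernels are invariant (`IsKer.invariant`). Commuting with all elements of the convolution
algebra forces K to commute with each single translation. Uniqueness of kernels then makes T
invariant up to the Jacobian J_g of the translation with respect to `vol`. Hence H(q,p) =
tr_s(T₁(q,p)T₂(p,q)) satisfies J_g(q)J_g(p)H(qg,pg) = H(q,p), and it is properly supported because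
the action is proper.

(3) The two orders of multiplication are exchanged by g ↦ g⁻¹ (`IsInvariantPair.trace_push_avg`).
The density τ(K₁K₂) has coefficient ∫∫ φ(p)H(q,p) dq dp = ∫ u(q) dq with u(q) = ∫ φ(p)H(q,p) dp. Put
c(g) = ∫ u(q)φ(qg) dq. The cutoff condition gives ∫ u over Z_m = ∫ c over G^m. By the invariance of
H, c(g⁻¹) = ∫∫ φ(q)H(q,p)φ(pg) dp dq, whose integral over G^m is ∫∫ φ(q)H(q,p) dp dq. By (1), ρ does
not see the difference. Cyclicity of the trace and the parity of K₁ identify this last integral with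
the coefficient of ±τ(K₂K₁). -/

noncomputable section
set_option linter.unusedSectionVars false

/-! ### Local product coordinates for a submersion -/

section Boxes

variable {n k : ℕ} {N M : Type*}
  [TopologicalSpace N] [ChartedSpace (Eu (n + k)) N] [TopologicalSpace M] [ChartedSpace (Eu n) M]

/-- Local product coordinates for `f : N → M`: an open subset `src` of `N` is identified with an
open subset `dom` of `M × ℝᵏ` in such a way that `f` becomes the first projection. -/
structure FBox (n k : ℕ) {N M : Type*} [TopologicalSpace N] [ChartedSpace (Eu (n + k)) N]
    [TopologicalSpace M] [ChartedSpace (Eu n) M] (f : N → M) where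
  src : Set N
  dom : Set (M × Eu k)
  pt : M × Eu k → N
  co : N → Eu k
  isOpen_src : IsOpen src
  isOpen_dom : IsOpen dom
  contMDiffOn_pt : ContMDiffOn ((𝓡 n).prod (𝓡 k)) (𝓡 (n + k)) ∞ pt dom
  contMDiffOn_co : ContMDiffOn (𝓡 (n + k)) (𝓡 k) ∞ co src
  pt_mem : ∀ x ∈ dom, pt x ∈ src
  mem_dom : ∀ y ∈ src, (f y, co y) ∈ dom
  pt_co : ∀ y ∈ src, pt (f y, co y) = y
  f_pt : ∀ x ∈ dom, f (pt x) = x.1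
  co_pt : ∀ x ∈ dom, co (pt x) = x.2

variable {f : N → M}

/-- A submersion is, in suitable charts, the projection of a product onto its first factor. The
complement of that factor has dimension k by counting dimensions, so it can be replaced by ℝᵏ.
Composing back with the chart of `M` leaves `M` itself as the first factor. -/
theorem exists_box (hf : IsSubmersion (𝓡 (n + k)) (𝓡 n) ∞ f) (y : N) :
    ∃ B : FBox n k f, y ∈ B.src := by
  obtain ⟨F, _, _, hF⟩ := hf
  have h := hF y
  set c := h.domChart
  set c' := h.codChart
  have hfd : FiniteDimensional ℝ F :=
    FiniteDimensional.of_surjective ((LinearMap.snd ℝ (Eu n) F) ∘ₗ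
      (h.equiv.toLinearEquiv : Eu (n + k) →ₗ[ℝ] Eu n × F))
      (Prod.snd_surjective.comp h.equiv.surjective)
  have hrank : Module.finrank ℝ F = Module.finrank ℝ (Eu k) := by
    have := h.equiv.toLinearEquiv.finrank_eq
    rw [Module.finrank_prod] at this
    simp only [finrank_euclideanSpace, Fintype.card_fin] at this ⊢
    omega
  let L : Eu (n + k) ≃L[ℝ] Eu n × Eu k := h.equiv.trans
    ((ContinuousLinearEquiv.refl ℝ (Eu n)).prodCongr (ContinuousLinearEquiv.ofFinrankEq hrank))
  have hL : ∀ z, (L z).1 = (h.equiv z).1 := fun z => rfl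
  -- The normal form of a submersion at a point of the chart domain. Replacing the abstract
  -- complement by ℝᵏ does not touch the first component.
  have hwr : ∀ y ∈ c.source, (L (c y)).1 = c' (f y) := by
    intro y hy
    have h0 : c y ∈ (c.extend (𝓡 (n + k))).target := by
      rw [OpenPartialHomeomorph.extend_target]
      exact ⟨c.map_source hy, mem_range_self (f := 𝓡 (n + k)) _⟩
    have h1 := h.writtenInCharts h0
    simp only [Function.comp, OpenPartialHomeomorph.extend_coe, OpenPartialHomeomorph.extend_coe_symm,
      modelWithCornersSelf_coe, modelWithCornersSelf_coe_symm, id] at h1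
    rw [hL, ← h1]
    change c' (f (c.symm (c y))) = _
    rw [c.left_inv hy]
  have hmaps : ∀ y ∈ c.source, f y ∈ c'.source := h.mapsto_domChart_source_codChart_source
  have hc : ContMDiffOn (𝓡 (n+k)) (𝓡 (n+k)) ∞ c c.source :=
    contMDiffOn_of_mem_maximalAtlas h.domChart_mem_maximalAtlas
  have hcs : ContMDiffOn (𝓡 (n+k)) (𝓡 (n+k)) ∞ c.symm c.target :=
    contMDiffOn_symm_of_mem_maximalAtlas h.domChart_mem_maximalAtlas
  have hc' : ContMDiffOn (𝓡 n) (𝓡 n) ∞ c' c'.source :=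
    contMDiffOn_of_mem_maximalAtlas h.codChart_mem_maximalAtlas
  let q : M × Eu k → Eu (n + k) := fun x => L.symm (c' x.1, x.2)
  have hq : ContMDiffOn ((𝓡 n).prod (𝓡 k)) (𝓡 (n + k)) ∞ q (c'.source ×ˢ univ) := by
    have h1 : ContMDiffOn ((𝓡 n).prod (𝓡 k)) 𝓘(ℝ, Eu n × Eu k) ∞
        (fun x : M × Eu k => (c' x.1, x.2)) (c'.source ×ˢ univ) :=
      (hc'.comp contMDiffOn_fst (fun x hx => hx.1)).prodMk_space contMDiffOn_snd
    exact L.symm.contDiff.contMDiff.comp_contMDiffOn h1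
  have hopen : IsOpen ((c'.source ×ˢ univ) ∩ q ⁻¹' c.target) :=
    hq.continuousOn.isOpen_inter_preimage (c'.open_source.prod isOpen_univ) c.open_target
  have key : ∀ x ∈ (c'.source ×ˢ (univ : Set (Eu k))) ∩ q ⁻¹' c.target,
      f (c.symm (q x)) = x.1 ∧ (L (c (c.symm (q x)))).2 = x.2 := by
    intro x hx
    have h1 := hwr _ (c.map_target hx.2)
    rw [c.right_inv hx.2] at h1 ⊢
    simp only [q, ContinuousLinearEquiv.apply_symm_apply] at h1 ⊢
    exact ⟨(c'.injOn (hmaps _ (c.map_target hx.2)) hx.1.1 h1.symm), trivial⟩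
  have hinv : ∀ y ∈ c.source, q (f y, (L (c y)).2) = c y := by
    intro y hy
    simp only [q]
    rw [← hwr y hy]
    simp
  refine ⟨{
    src := c.source
    dom := (c'.source ×ˢ univ) ∩ q ⁻¹' c.target
    pt := fun x => c.symm (q x)
    co := fun y => (L (c y)).2
    isOpen_src := c.open_source
    isOpen_dom := hopen
    contMDiffOn_pt := hcs.comp (hq.mono inter_subset_left) (fun x hx => hx.2)
    contMDiffOn_co := ((contDiff_snd.comp L.contDiff).contMDiff).comp_contMDiffOn hc
    pt_mem := fun x hx => c.map_target hx.2
    mem_dom := fun y hy => ⟨⟨hmaps y hy, mem_univ _⟩, by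
      rw [mem_preimage, hinv y hy]; exact c.map_source hy⟩
    pt_co := fun y hy => by rw [hinv y hy, c.left_inv hy]
    f_pt := fun x hx => (key x hx).1
    co_pt := fun x hx => (key x hx).2 }, h.mem_domChart_source⟩

end Boxes

/-! ### Partial derivatives -/

section PartialDerivatives

variable {a k : ℕ} {N : Type*} [TopologicalSpace N] [ChartedSpace (Eu a) N] [IsManifold (𝓡 a) ∞ N]
  {EQ HQ Q : Type*} [NormedAddCommGroup EQ] [NormedSpace ℝ EQ] [TopologicalSpace HQ]
  {I : ModelWithCorners ℝ EQ HQ} [TopologicalSpace Q] [ChartedSpace HQ Q] [IsManifold I ∞ Q]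

/-- The derivative in the second variable of a smooth function on an open subset of `Q × ℝᵏ`, applied
to a constant vector, depends smoothly on the point. -/
theorem contMDiffOn_tder_snd {φ : Q × Eu k → N} {O : Set (Q × Eu k)} (hO : IsOpen O)
    (hφ : ContMDiffOn (I.prod (𝓡 k)) (𝓡 a) ∞ φ O) (w : Eu k) :
    ContMDiffOn (I.prod (𝓡 k)) (𝓡 a).tangent ∞
      (fun x => (⟨φ x, tder (a := k) (b := a) (fun z => φ (x.1, z)) x.2 w⟩ : TangentBundle (𝓡 a) N)) O := by
  intro x hx
  have hx' : ContMDiffAt (I.prod (𝓡 k)) (𝓡 a) ∞ φ x := (hφ x hx).contMDiffAt (hO.mem_nhds hx)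
  apply ContMDiffAt.contMDiffWithinAt
  let ϕ : ∀ y : Q × Eu k, TangentSpace (𝓡 k) y.2 →L[ℝ] TangentSpace (𝓡 a) (φ y) :=
    fun y => mfderiv (𝓡 k) (𝓡 a) (fun z => φ (y.1, z)) y.2
  have h1 : ContMDiffAt (I.prod (𝓡 k)) 𝓘(ℝ, Eu k →L[ℝ] Eu a) ∞ (fun y =>
      ContinuousLinearMap.inCoordinates (Eu k) (TangentSpace (𝓡 k) (M := Eu k)) (Eu a)
        (TangentSpace (𝓡 a) (M := N)) x.2 y.2 (φ x) (φ y) (ϕ y)) x := by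
    refine ContMDiffAt.mfderiv (I := 𝓡 k) (I' := 𝓡 a) (m := ∞) (n := ∞) (x₀ := x)
      (fun (x : Q × Eu k) z => φ (x.1, z)) Prod.snd ?_ contMDiffAt_snd (by simp)
    have : ContMDiffAt ((I.prod (𝓡 k)).prod (𝓡 k)) (I.prod (𝓡 k)) ∞
      (fun y : (Q × Eu k) × Eu k => (y.1.1, y.2)) (x, x.2) :=
      (contMDiffAt_fst.comp _ contMDiffAt_fst).prodMk contMDiffAt_snd
    exact ContMDiffAt.comp (I' := I.prod (𝓡 k)) (g := φ) (x, x.2) hx' this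
  let v : ∀ y : Q × Eu k, TangentSpace (𝓡 k) y.2 := fun _ => w
  have hv : ContMDiffAt (I.prod (𝓡 k)) (𝓡 k).tangent ∞
      (fun y : Q × Eu k => (⟨y.2, v y⟩ : TangentBundle (𝓡 k) (Eu k))) x := by
    rw [contMDiffAt_totalSpace]
    refine ⟨contMDiffAt_snd, ?_⟩
    have : (fun y : Q × Eu k => (trivializationAt (Eu k) (TangentSpace (𝓡 k)) x.2
        (⟨y.2, w⟩ : TangentBundle (𝓡 k) (Eu k))).2) = fun _ => w := by
      funext y
      simp [trivializationAt_model_space_apply]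
    exact this ▸ contMDiffAt_const
  exact ContMDiffAt.clm_apply_of_inCoordinates (ϕ := ϕ) (v := v) (b₁ := Prod.snd) (b₂ := φ) h1 hv hx'

end PartialDerivatives

/-! ### Vertical vectors, fibre charts and vertical frames from local product coordinates. -/

section Boxes

variable {n k : ℕ} {N M : Type*}
  [TopologicalSpace N] [ChartedSpace (Eu (n + k)) N] [IsManifold (𝓡 (n + k)) ∞ N]
  [TopologicalSpace M] [ChartedSpace (Eu n) M] [IsManifold (𝓡 n) ∞ M]
  {f : N → M}

namespace FBox

variable (B : FBox n k f)

/-- The part in the fibre over `m` of the domain of local product coordinates. -/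
def fdom (m : M) : Set (Eu k) := {z | (m, z) ∈ B.dom}

theorem isOpen_fdom (m : M) : IsOpen (B.fdom m) :=
  B.isOpen_dom.preimage (by fun_prop : Continuous fun z : Eu k => (m, z))

theorem contMDiffOn_slice (m : M) :
    ContMDiffOn (𝓡 k) (𝓡 (n + k)) ∞ (fun z => B.pt (m, z)) (B.fdom m) :=
  B.contMDiffOn_pt.comp (contMDiffOn_const.prodMk contMDiffOn_id) (fun _ hz => hz)

theorem mdifferentiableAt_slice {m : M} {z : Eu k} (h : (m, z) ∈ B.dom) :
    MDifferentiableAt (𝓡 k) (𝓡 (n + k)) (fun z => B.pt (m, z)) z :=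
  ((B.contMDiffOn_slice m).contMDiffAt ((B.isOpen_fdom m).mem_nhds h)).mdifferentiableAt (by simp)

theorem mdifferentiableAt_co {y : N} (h : y ∈ B.src) :
    MDifferentiableAt (𝓡 (n + k)) (𝓡 k) B.co y :=
  (B.contMDiffOn_co.contMDiffAt (B.isOpen_src.mem_nhds h)).mdifferentiableAt (by simp)

/-- The differential of the parametrization of a piece of a fibre. -/
def slice (x : M × Eu k) : Eu k →L[ℝ] Eu (n + k) :=
  tder (a := k) (b := n + k) (fun z => B.pt (x.1, z)) x.2

/-- Chain rule for `co (pt (m, z)) = z`. It makes the slice an immersion. -/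
theorem tder_co_slice {x : M × Eu k} (h : x ∈ B.dom) (w : Eu k) :
    tder (a := n + k) (b := k) B.co (B.pt x) (B.slice x w) = w := by
  have h1 := mfderiv_comp (I := 𝓡 k) (I' := 𝓡 (n + k)) (I'' := 𝓡 k) x.2
    (g := B.co) (f := fun z => B.pt (x.1, z)) (B.mdifferentiableAt_co (B.pt_mem x h))
    (B.mdifferentiableAt_slice h)
  have h2 : mfderiv (𝓡 k) (𝓡 k) (B.co ∘ fun z => B.pt (x.1, z)) x.2 =
      ContinuousLinearMap.id ℝ (Eu k) := by
    rw [Filter.EventuallyEq.mfderiv_eq (f := id), mfderiv_id]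
    · rfl
    · filter_upwards [(B.isOpen_fdom x.1).mem_nhds h] with z hz
      exact B.co_pt _ hz
  rw [h2] at h1
  exact (congrArg (fun T : Eu k →L[ℝ] Eu k => T w) h1).symm

theorem slice_injective {x : M × Eu k} (h : x ∈ B.dom) : Function.Injective (B.slice x) :=
  fun v w hvw => by rw [← B.tder_co_slice h v, hvw, B.tder_co_slice h w]

theorem slice_mem_vertical (hf : IsSubmersion (𝓡 (n + k)) (𝓡 n) ∞ f) {x : M × Eu k}
    (h : x ∈ B.dom) (w : Eu k) :
    B.slice x w ∈ vertical (a := n + k) (b := n) f (B.pt x) := by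
  have h1 := mfderiv_comp (I := 𝓡 k) (I' := 𝓡 (n + k)) (I'' := 𝓡 n) x.2
    (g := f) (f := fun z => B.pt (x.1, z)) ((hf.contMDiff _).mdifferentiableAt (by simp))
    (B.mdifferentiableAt_slice h)
  have h2 : mfderiv (𝓡 k) (𝓡 n) (f ∘ fun z => B.pt (x.1, z)) x.2 = 0 := by
    rw [Filter.EventuallyEq.mfderiv_eq (f := fun _ => x.1), mfderiv_const]
    · rfl
    · filter_upwards [(B.isOpen_fdom x.1).mem_nhds h] with z hz
      exact B.f_pt _ hz
  rw [h2] at h1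
  exact (congrArg (fun T : Eu k →L[ℝ] Eu n => T w) h1).symm

/-- Differentiate `pt (f y, co y) = y` along a vertical vector: the component in `M` contributes
nothing, so only the derivative along the slice remains. -/
theorem slice_tder_co (hf : IsSubmersion (𝓡 (n + k)) (𝓡 n) ∞ f) {y : N} (hy : y ∈ B.src)
    {v : Eu (n + k)} (hv : v ∈ vertical (a := n + k) (b := n) f y) :
    B.slice (f y, B.co y) (tder (a := n + k) (b := k) B.co y v) = v := by
  have hd := B.mem_dom y hy
  have hpt : MDifferentiableAt ((𝓡 n).prod (𝓡 k)) (𝓡 (n + k)) B.pt (f y, B.co y) :=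
    (B.contMDiffOn_pt.contMDiffAt (B.isOpen_dom.mem_nhds hd)).mdifferentiableAt (by simp)
  have hfd : MDifferentiableAt (𝓡 (n + k)) (𝓡 n) f y :=
    (hf.contMDiff y).mdifferentiableAt (by simp)
  have hpair := hfd.prodMk (B.mdifferentiableAt_co hy)
  have h1 := mfderiv_comp (I := 𝓡 (n + k)) (I' := (𝓡 n).prod (𝓡 k)) (I'' := 𝓡 (n + k)) y
    (g := B.pt) (f := fun y => (f y, B.co y)) hpt hpair
  have h2 : mfderiv (𝓡 (n + k)) (𝓡 (n + k)) (B.pt ∘ fun y => (f y, B.co y)) y =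
      ContinuousLinearMap.id ℝ (Eu (n + k)) := by
    rw [Filter.EventuallyEq.mfderiv_eq (f := id), mfderiv_id]
    · rfl
    · filter_upwards [B.isOpen_src.mem_nhds hy] with z hz
      exact B.pt_co _ hz
  rw [h2] at h1
  have h3 := congrArg (fun T : Eu (n + k) →L[ℝ] Eu (n + k) => T v) h1
  -- Verticality of `v` says exactly that the first component vanishes.
  have h4 : mfderiv (𝓡 (n + k)) ((𝓡 n).prod (𝓡 k)) (fun y => (f y, B.co y)) y v =
      ((0 : Eu n), tder (a := n + k) (b := k) B.co y v) := by
    rw [mfderiv_prodMk hfd (B.mdifferentiableAt_co hy)]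
    exact Prod.ext hv rfl
  have h5 := mfderiv_comp (I := 𝓡 k) (I' := (𝓡 n).prod (𝓡 k)) (I'' := 𝓡 (n + k)) (B.co y)
    (g := B.pt) (f := fun z => (f y, z)) hpt (mdifferentiableAt_const.prodMk mdifferentiableAt_id)
  have h6 : mfderiv (𝓡 k) ((𝓡 n).prod (𝓡 k)) (fun z : Eu k => (f y, z)) (B.co y) =
      (ContinuousLinearMap.inr ℝ (Eu n) (Eu k)) := by
    have h := mfderiv_prodMk (I := 𝓡 k) (I' := 𝓡 n) (I'' := 𝓡 k) (x := B.co y)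
      (f := fun _ : Eu k => f y) (g := id) mdifferentiableAt_const mdifferentiableAt_id
    rw [mfderiv_const, mfderiv_id] at h
    exact h
  have h7 : B.slice (f y, B.co y) = mfderiv (𝓡 k) (𝓡 (n + k)) (B.pt ∘ fun z => (f y, z)) (B.co y) :=
    rfl
  rw [h7, h5]
  have h8 : v = mfderiv ((𝓡 n).prod (𝓡 k)) (𝓡 (n + k)) B.pt (f y, B.co y)
      (mfderiv (𝓡 (n + k)) ((𝓡 n).prod (𝓡 k)) (fun y => (f y, B.co y)) y v) := h3
  rw [h4] at h8
  refine Eq.trans ?_ h8.symm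
  change mfderiv ((𝓡 n).prod (𝓡 k)) (𝓡 (n + k)) B.pt (f y, B.co y)
    (mfderiv (𝓡 k) ((𝓡 n).prod (𝓡 k)) (fun z : Eu k => (f y, z)) (B.co y) _) = _
  rw [h6]
  rfl

/-- The parametrization, by local product coordinates, of a piece of the fibre over `m`. -/
def chart (m : M) : FiberChart k (n + k) f m where
  toFun z := B.pt (m, z)
  source := B.fdom m
  isOpen_source := B.isOpen_fdom m
  contMDiffOn := B.contMDiffOn_slice m
  injective_der := fun _ hz => B.slice_injective hz
  injOn := fun z hz z' hz' h => by
    exact (B.co_pt _ hz).symm.trans ((congrArg B.co h).trans (B.co_pt _ hz'))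
  maps := fun z hz => B.f_pt _ hz
  open_map := fun O hO hO' => by
    refine ⟨B.src ∩ B.co ⁻¹' O, B.contMDiffOn_co.continuousOn.isOpen_inter_preimage B.isOpen_src hO',
      ?_⟩
    ext y
    constructor
    · rintro ⟨z, hz, rfl⟩
      refine ⟨⟨B.pt_mem _ (hO hz), ?_⟩, B.f_pt _ (hO hz)⟩
      rw [mem_preimage, B.co_pt _ (hO hz)]
      exact hz
    · rintro ⟨⟨h1, h2⟩, rfl⟩
      exact ⟨_, h2, B.pt_co y h1⟩

end FBox

/-- The vertical tangent vectors are the velocities of the parametrization of the fibre. -/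
theorem FiberChart.tder_mem_vertical (hf : ContMDiff (𝓡 (n + k)) (𝓡 n) ∞ f) {m : M}
    (φ : FiberChart k (n + k) f m) {x : Eu k} (hx : x ∈ φ.source) (w : Eu k) :
    tder φ.toFun x w ∈ vertical (a := n + k) (b := n) f (φ.toFun x) := by
  have h1 := mfderiv_comp (I := 𝓡 k) (I' := 𝓡 (n + k)) (I'' := 𝓡 n) x
    (g := f) (f := φ.toFun) ((hf _).mdifferentiableAt (by simp))
    ((φ.contMDiffOn.contMDiffAt (φ.isOpen_source.mem_nhds hx)).mdifferentiableAt (by simp))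
  have h2 : mfderiv (𝓡 k) (𝓡 n) (f ∘ φ.toFun) x = 0 := by
    rw [Filter.EventuallyEq.mfderiv_eq (f := fun _ => m), mfderiv_const]
    · rfl
    · filter_upwards [φ.isOpen_source.mem_nhds hx] with z hz
      exact φ.maps _ hz
  rw [h2] at h1
  exact (congrArg (fun T : Eu k →L[ℝ] Eu n => T w) h1).symm

theorem finrank_vertical (hf : IsSubmersion (𝓡 (n + k)) (𝓡 n) ∞ f) (y : N) :
    Module.finrank ℝ (vertical (a := n + k) (b := n) f y) = k := by
  obtain ⟨B, hB⟩ := exists_box hf y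
  have hd := B.mem_dom y hB
  have h1 : vertical (a := n + k) (b := n) f y = LinearMap.range (B.slice (f y, B.co y) : Eu k →ₗ[ℝ] Eu (n + k)) := by
    apply le_antisymm
    · intro v hv
      exact ⟨_, B.slice_tder_co hf hB hv⟩
    · rintro _ ⟨w, rfl⟩
      have := B.slice_mem_vertical hf hd w
      rwa [B.pt_co y hB] at this
  rw [h1, LinearMap.finrank_range_of_inj (B.slice_injective hd)]
  simp

/-- The vertical bundle of a submersion has smooth local frames. -/
theorem exists_vertical_frame (hf : IsSubmersion (𝓡 (n + k)) (𝓡 n) ∞ f) (y : N) :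
    ∃ (U : Set N) (Y : N → Fin k → Eu (n + k)), IsOpen U ∧ y ∈ U ∧
      IsSmoothFrameOn (vertical (a := n + k) (b := n) f) U Y := by
  obtain ⟨B, hB⟩ := exists_box hf y
  refine ⟨B.src, fun y i => B.slice (f y, B.co y) (EuclideanSpace.single i 1), B.isOpen_src, hB,
    fun i => ?_, fun y hy => ⟨?_, fun i => ?_⟩⟩
  · have h1 := contMDiffOn_tder_snd B.isOpen_dom B.contMDiffOn_pt (EuclideanSpace.single i 1)
    have h2 : ContMDiffOn (𝓡 (n + k)) ((𝓡 n).prod (𝓡 k)) ∞ (fun y => (f y, B.co y)) B.src :=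
      hf.contMDiff.contMDiffOn.prodMk B.contMDiffOn_co
    refine (h1.comp h2 fun y hy => B.mem_dom y hy).congr fun y hy => ?_
    have := B.pt_co y hy
    simp only [Function.comp]
    exact congrArg (fun q => (⟨q, B.slice (f y, B.co y) (EuclideanSpace.single i 1)⟩ :
      TangentBundle (𝓡 (n + k)) N)) this.symm
  · have := (EuclideanSpace.basisFun (Fin k) ℝ).toBasis.linearIndependent.map'
      (B.slice (f y, B.co y) : Eu k →ₗ[ℝ] Eu (n + k))
      (LinearMap.ker_eq_bot.2 (B.slice_injective (B.mem_dom y hy)))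
    simpa [Function.comp_def] using this
  · have := B.slice_mem_vertical hf (B.mem_dom y hy) (EuclideanSpace.single i 1)
    rwa [B.pt_co y hy] at this

end Boxes

/-! ### A smooth positive `k`-dimensional volume on a manifold -/

section Volume

theorem det_gram_pos {k : ℕ} {V : Type*} [NormedAddCommGroup V] [InnerProductSpace ℝ V]
    {w : Fin k → V} (hw : LinearIndependent ℝ w) : 0 < (Matrix.gram ℝ w).det :=
  (Matrix.posDef_gram_of_linearIndependent hw).det_pos

/-- The determinant of the Gram matrix is thereby multiplied by (det B)², so its square root
transforms by |det B|, as a density must. -/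
theorem gram_combination {k : ℕ} {V : Type*} [NormedAddCommGroup V] [InnerProductSpace ℝ V]
    (w : Fin k → V) (B : Matrix (Fin k) (Fin k) ℝ) :
    Matrix.gram ℝ (fun i => ∑ j, B i j • w j) = B * Matrix.gram ℝ w * B.transpose := by
  ext i j
  simp only [Matrix.gram_apply, Matrix.mul_apply, Matrix.transpose_apply, sum_inner, inner_sum,
    inner_smul_left, inner_smul_right, Finset.sum_mul]
  refine Finset.sum_congr rfl fun x _ => ?_
  rw [Finset.mul_sum]
  refine Finset.sum_congr rfl fun y _ => ?_
  simp
  ring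

theorem contDiff_det_gram {k a : ℕ} :
    ContDiff ℝ ∞ (fun w : Fin k → Eu a => (Matrix.gram ℝ w).det) := by
  simp only [Matrix.det_apply, Matrix.gram_apply]
  refine ContDiff.sum fun σ _ => ContDiff.const_smul _ (contDiff_prod fun i _ => ?_)
  exact (contDiff_apply ℝ (Eu a) (σ i)).inner ℝ (contDiff_apply ℝ (Eu a) i)

variable {a k : ℕ} {N : Type*} [TopologicalSpace N] [ChartedSpace (Eu a) N]

/-- The Euclidean `k`-volume in the coordinates of the preferred chart at `x`. -/
def chartVol (x y : N) (v : Fin k → Eu a) : ℝ :=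
  √(Matrix.gram ℝ (fun i => tder (a := a) (b := a) (extChartAt (𝓡 a) x) y (v i))).det

theorem chartVol_combination (x y : N) (v : Fin k → Eu a) (B : Matrix (Fin k) (Fin k) ℝ) :
    chartVol x y (fun i => ∑ j, B i j • v j) = |B.det| * chartVol x y v := by
  unfold chartVol
  simp only [map_sum, map_smul]
  rw [gram_combination, Matrix.det_mul, Matrix.det_mul, Matrix.det_transpose,
    show B.det * (Matrix.gram ℝ fun i => (tder (extChartAt (𝓡 a) x) y) (v i)).det * B.det =
      B.det ^ 2 * (Matrix.gram ℝ fun i => (tder (extChartAt (𝓡 a) x) y) (v i)).det by ring,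
    Real.sqrt_mul (sq_nonneg _), Real.sqrt_sq_eq_abs]

variable [IsManifold (𝓡 a) ∞ N]

theorem chartVol_pos {x y : N} (hy : y ∈ (chartAt (Eu a) x).source) {v : Fin k → Eu a}
    (hv : LinearIndependent ℝ v) : 0 < chartVol x y v := by
  refine Real.sqrt_pos.2 (det_gram_pos ?_)
  have hinj : Function.Injective (tder (a := a) (b := a) (extChartAt (𝓡 a) x) y) :=
    (isInvertible_mfderiv_extChartAt (I := 𝓡 a) (by simpa using hy)).bijective.injective
  exact hv.map' (tder (a := a) (b := a) (extChartAt (𝓡 a) x) y : Eu a →ₗ[ℝ] Eu a)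
    (LinearMap.ker_eq_bot.2 hinj)

section Smooth

variable {EQ HQ Q : Type*} [NormedAddCommGroup EQ] [NormedSpace ℝ EQ] [TopologicalSpace HQ]
  {I : ModelWithCorners ℝ EQ HQ} [TopologicalSpace Q] [ChartedSpace HQ Q]

/-- The Gram determinant is polynomial in the tuple. Linear independence keeps it away from 0, where
the square root would not be smooth. -/
theorem contMDiffWithinAt_chartVol {S : Set Q} {q₀ : Q} {y : Q → N} {V : Q → Fin k → Eu a}
    (hy : ContMDiffWithinAt I (𝓡 a) ∞ y S q₀)
    (hV : ∀ j, ContMDiffWithinAt I (𝓡 a).tangent ∞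
      (fun q => (⟨y q, V q j⟩ : TangentBundle (𝓡 a) N)) S q₀)
    (hlin : LinearIndependent ℝ (V q₀)) {x : N} (hx : y q₀ ∈ (chartAt (Eu a) x).source) :
    ContMDiffWithinAt I 𝓘(ℝ, ℝ) ∞ (fun q => chartVol x (y q) (V q)) S q₀ := by
  let e := trivializationAt (Eu a) (TangentSpace (𝓡 a) : N → Type _) x
  have h1 : ContMDiffWithinAt I 𝓘(ℝ, Fin k → Eu a) ∞
      (fun q j => (e (⟨y q, V q j⟩ : TangentBundle (𝓡 a) N)).2) S q₀ := by
    rw [contMDiffWithinAt_pi_space]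
    intro j
    exact ((e.contMDiffWithinAt_iff (f := fun q => (⟨y q, V q j⟩ : TangentBundle (𝓡 a) N))
      (by rw [Trivialization.mem_source]; exact hx)).1 (hV j)).2
  have h2 : ∀ y' ∈ (chartAt (Eu a) x).source, ∀ v : Eu a,
      (e (⟨y', v⟩ : TangentBundle (𝓡 a) N)).2 = tder (a := a) (b := a) (extChartAt (𝓡 a) x) y' v := by
    intro y' hy' v
    have := TangentBundle.continuousLinearMapAt_trivializationAt (I := 𝓡 a) hy'
    have h3 := congrArg (fun T : Eu a →L[ℝ] Eu a => T v) this
    refine Eq.trans ?_ h3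
    have h4 : y' ∈ e.baseSet := hy'
    exact (e.continuousLinearMapAt_apply_of_mem ℝ h4 v).symm
  have hev : ∀ᶠ q in 𝓝[insert q₀ S] q₀, y q ∈ (chartAt (Eu a) x).source :=
    hy.insert.continuousWithinAt.eventually_mem ((chartAt (Eu a) x).open_source.mem_nhds hx)
  have hpos : chartVol x (y q₀) (V q₀) ≠ 0 := (chartVol_pos hx hlin).ne'
  have h5 : (fun q => chartVol x (y q) (V q)) =ᶠ[𝓝[insert q₀ S] q₀]
      fun q => √(Matrix.gram ℝ fun j => (e (⟨y q, V q j⟩ : TangentBundle (𝓡 a) N)).2).det := by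
    filter_upwards [hev] with q hq
    simp only [chartVol, h2 _ hq]
  have h6 := h5.self_of_nhdsWithin (mem_insert _ _)
  refine ContMDiffWithinAt.congr_of_eventuallyEq ?_ (h5.filter_mono (nhdsWithin_mono _ (subset_insert _ _))) h6
  have h7 : ContDiffAt ℝ ∞ (fun w : Fin k → Eu a => √(Matrix.gram ℝ w).det)
      (fun j => (e (⟨y q₀, V q₀ j⟩ : TangentBundle (𝓡 a) N)).2) := by
    refine contDiff_det_gram.contDiffAt.sqrt fun h0 => hpos ?_
    exact h6.trans (by simp only [h0, Real.sqrt_zero])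
  exact ContMDiffAt.comp_contMDiffWithinAt (I' := 𝓘(ℝ, Fin k → Eu a))
    (g := fun w : Fin k → Eu a => √(Matrix.gram ℝ w).det) q₀ h7.contMDiffAt h1

end Smooth

theorem locallyCompactSpace_of_euclidean (a : ℕ) (N : Type*) [TopologicalSpace N]
    [ChartedSpace (Eu a) N] : LocallyCompactSpace N :=
  ChartedSpace.locallyCompactSpace (Eu a) N

variable [T2Space N] [SecondCountableTopology N]

variable (a N) in
theorem exists_chartPartition : ∃ p : SmoothPartitionOfUnity N (𝓡 a) N univ,
    p.IsSubordinate (fun x => (chartAt (Eu a) x).source) := by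
  have := locallyCompactSpace_of_euclidean a N
  exact SmoothPartitionOfUnity.exists_isSubordinate_chartAt_source (𝓡 a) N

variable (a N) in
/-- A smooth partition of unity subordinate to the preferred charts. -/
def chartPartition : SmoothPartitionOfUnity N (𝓡 a) N univ := (exists_chartPartition a N).choose

theorem chartPartition_subordinate (x : N) :
    tsupport (chartPartition a N x) ⊆ (chartAt (Eu a) x).source :=
  (exists_chartPartition a N).choose_spec x

/-- A smooth positive `k`-dimensional volume of `k`-tuples of tangent vectors. -/
def vol (y : N) (v : Fin k → Eu a) : ℝ := ∑ᶠ x : N, chartPartition a N x y * chartVol x y v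

/-- Local finiteness of the partition. The second clause keeps only those indices whose support
contains `y₀`. Subordination then puts `y₀` in the corresponding chart domain, where `chartVol` is
smooth. -/
theorem vol_eq_sum (y₀ : N) : ∃ s : Finset N, (∀ᶠ y in 𝓝 y₀, ∀ v : Fin k → Eu a,
      vol y v = ∑ x ∈ s, chartPartition a N x y * chartVol x y v) ∧
    ∀ x ∈ s, ∃ᶠ y in 𝓝 y₀, chartPartition a N x y ≠ 0 := by
  obtain ⟨U, hU, hfin⟩ := (chartPartition a N).locallyFinite y₀
  classical
  have hs : ∀ᶠ y in 𝓝 y₀, ∀ x ∈ hfin.toFinset,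
      ¬ (∃ᶠ y in 𝓝 y₀, chartPartition a N x y ≠ 0) → chartPartition a N x y = 0 := by
    rw [Filter.eventually_all_finset]
    intro x _
    by_cases h : ∃ᶠ y in 𝓝 y₀, chartPartition a N x y ≠ 0
    · simp [h]
    · rw [Filter.not_frequently] at h
      filter_upwards [h] with y hy _
      simpa using hy
  refine ⟨hfin.toFinset.filter fun x => ∃ᶠ y in 𝓝 y₀, chartPartition a N x y ≠ 0, ?_, ?_⟩
  · filter_upwards [hU, hs] with y hy hy' v
    refine finsum_eq_sum_of_support_subset _ fun x hx => ?_
    have hx0 : chartPartition a N x y ≠ 0 := fun h => hx (by simp [h])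
    have hx1 : x ∈ hfin.toFinset := by
      rw [Set.Finite.mem_toFinset]
      exact ⟨y, hx0, hy⟩
    simp only [Finset.coe_filter, mem_ofPred_eq]
    refine ⟨hx1, by_contra fun h => hx0 (hy' x hx1 h)⟩
  · intro x hx
    exact (Finset.mem_filter.1 hx).2

theorem vol_combination (y : N) (v : Fin k → Eu a) (B : Matrix (Fin k) (Fin k) ℝ) :
    vol y (fun i => ∑ j, B i j • v j) = |B.det| * vol y v := by
  obtain ⟨s, hs, -⟩ := vol_eq_sum (a := a) (k := k) y
  rw [hs.self_of_nhds, hs.self_of_nhds, Finset.mul_sum]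
  refine Finset.sum_congr rfl fun x _ => ?_
  rw [chartVol_combination]
  ring

theorem vol_pos (y : N) {v : Fin k → Eu a} (hv : LinearIndependent ℝ v) : 0 < vol y v := by
  obtain ⟨s, hs, -⟩ := vol_eq_sum (a := a) (k := k) y
  have h0 : ∀ x : N, 0 ≤ chartPartition a N x y * chartVol x y v := fun x =>
    mul_nonneg ((chartPartition a N).nonneg x y) (Real.sqrt_nonneg _)
  obtain ⟨x, hx⟩ := (chartPartition a N).exists_pos_of_mem (mem_univ y)
  have hxs : y ∈ (chartAt (Eu a) x).source :=
    chartPartition_subordinate x (subset_tsupport _ hx.ne')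
  have hpos : 0 < chartPartition a N x y * chartVol x y v := mul_pos hx (chartVol_pos hxs hv)
  refine finsum_pos h0 ⟨x, hpos⟩ ?_
  refine ((chartPartition a N).locallyFinite.point_finite y).subset fun i hi => ?_
  exact fun h => hi (by simp [h])

section Smooth

variable {EQ HQ Q : Type*} [NormedAddCommGroup EQ] [NormedSpace ℝ EQ] [TopologicalSpace HQ]
  {I : ModelWithCorners ℝ EQ HQ} [TopologicalSpace Q] [ChartedSpace HQ Q]

theorem contMDiffWithinAt_vol {S : Set Q} {q₀ : Q} {y : Q → N} {V : Q → Fin k → Eu a}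
    (hy : ContMDiffWithinAt I (𝓡 a) ∞ y S q₀)
    (hV : ∀ j, ContMDiffWithinAt I (𝓡 a).tangent ∞
      (fun q => (⟨y q, V q j⟩ : TangentBundle (𝓡 a) N)) S q₀)
    (hlin : LinearIndependent ℝ (V q₀)) :
    ContMDiffWithinAt I 𝓘(ℝ, ℝ) ∞ (fun q => vol (y q) (V q)) S q₀ := by
  obtain ⟨s, hs, hs'⟩ := vol_eq_sum (a := a) (k := k) (y q₀)
  have hev := hy.continuousWithinAt.eventually hs
  refine ContMDiffWithinAt.congr_of_eventuallyEq (f := fun q => ∑ x ∈ s,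
    chartPartition a N x (y q) * chartVol x (y q) (V q)) ?_ ?_ (hs.self_of_nhds _)
  · refine ContMDiffWithinAt.sum fun x hx => ?_
    have hx' : y q₀ ∈ tsupport (chartPartition a N x) := mem_closure_iff_frequently.2 (hs' x hx)
    have h1 : ContMDiffWithinAt I 𝓘(ℝ, ℝ) ∞ (fun q => chartPartition a N x (y q)) S q₀ :=
      ContMDiffAt.comp_contMDiffWithinAt (I' := 𝓡 a) q₀ (chartPartition a N x).contMDiff.contMDiffAt hy
    exact h1.mul (contMDiffWithinAt_chartVol hy hV hlin (chartPartition_subordinate x hx'))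
  · filter_upwards [hev] with q hq
    exact hq _

end Smooth

end Volume

/-! ### Positive smooth densities along the fibres of a submersion -/

section VertDensity

variable {n k : ℕ} {N M : Type*}
  [TopologicalSpace N] [ChartedSpace (Eu (n + k)) N] [IsManifold (𝓡 (n + k)) ∞ N]
  [TopologicalSpace M] [ChartedSpace (Eu n) M] [IsManifold (𝓡 n) ∞ M]

/-- `lam` restricts to a positive smooth density on the fibres of `f`. -/
structure VertDensity (f : N → M) (lam : N → (Fin k → Eu (n + k)) → ℝ) : Prop where
  density : ∀ y v, (∀ i, v i ∈ vertical (a := n + k) (b := n) f y) →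
    ∀ B : Matrix (Fin k) (Fin k) ℝ, lam y (fun i => ∑ j, B i j • v j) = |B.det| * lam y v
  pos : ∀ y v, (∀ i, v i ∈ vertical (a := n + k) (b := n) f y) → LinearIndependent ℝ v →
    0 < lam y v
  smooth : ∀ B : FBox n k f, ContMDiffOn ((𝓡 n).prod (𝓡 k)) 𝓘(ℝ, ℝ) ∞
    (fun x => lam (B.pt x) (fun i => B.slice x (EuclideanSpace.single i 1))) B.dom

theorem FBox.contMDiffOn_slice_single {f : N → M} (B : FBox n k f) (i : Fin k) :
    ContMDiffOn ((𝓡 n).prod (𝓡 k)) (𝓡 (n + k)).tangent ∞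
      (fun x => (⟨B.pt x, B.slice x (EuclideanSpace.single i 1)⟩ : TangentBundle (𝓡 (n + k)) N))
      B.dom :=
  contMDiffOn_tder_snd B.isOpen_dom B.contMDiffOn_pt (EuclideanSpace.single i 1)

theorem linearIndependent_map_single {V : Type*} [AddCommGroup V] [Module ℝ V]
    (T : Eu k →ₗ[ℝ] V) (hT : Function.Injective T) :
    LinearIndependent ℝ (fun i : Fin k => T (EuclideanSpace.single i 1)) := by
  have := (EuclideanSpace.basisFun (Fin k) ℝ).toBasis.linearIndependent.map' T
    (LinearMap.ker_eq_bot.2 hT)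
  simpa [Function.comp_def] using this

theorem vertDensity_vol [T2Space N] [SecondCountableTopology N] (f : N → M) :
    VertDensity (k := k) f (vol (a := n + k) (N := N)) where
  density y v _ B := vol_combination y v B
  pos y _ _ hv := vol_pos y hv
  smooth B := fun x hx => contMDiffWithinAt_vol (B.contMDiffOn_pt x hx)
    (fun j => B.contMDiffOn_slice_single j x hx)
    (linearIndependent_map_single (B.slice x : Eu k →ₗ[ℝ] Eu (n + k)) (B.slice_injective hx))

end VertDensity

/-! ### The measure on a fibre defined by a positive density -/

section FiberMeasure

theorem det_of_single {k : ℕ} (T : Eu k →L[ℝ] Eu k) :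
    (Matrix.of fun j i : Fin k => (T (EuclideanSpace.single j 1)) i).det = T.det := by
  have h : (Matrix.of fun j i : Fin k => (T (EuclideanSpace.single j 1)) i) =
      (LinearMap.toMatrix (EuclideanSpace.basisFun (Fin k) ℝ).toBasis
        (EuclideanSpace.basisFun (Fin k) ℝ).toBasis (T : Eu k →ₗ[ℝ] Eu k)).transpose := by
    ext i j
    simp [LinearMap.toMatrix_apply]
  rw [h, Matrix.det_transpose, LinearMap.det_toMatrix]

theorem sum_smul_single {k : ℕ} (w : Eu k) :
    w = ∑ i, w i • (EuclideanSpace.single i 1 : Eu k) := by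
  have := (EuclideanSpace.basisFun (Fin k) ℝ).sum_repr w
  simpa using this.symm

variable {n k : ℕ} {N M : Type*}
  [TopologicalSpace N] [ChartedSpace (Eu (n + k)) N] [IsManifold (𝓡 (n + k)) ∞ N]
  [TopologicalSpace M] [ChartedSpace (Eu n) M] [IsManifold (𝓡 n) ∞ M]
  {f : N → M} {lam : N → (Fin k → Eu (n + k)) → ℝ} {m : M}

/-- The coefficient of a density in a parametrization of a piece of a fibre. -/
def FiberChart.dens (lam : N → (Fin k → Eu (n + k)) → ℝ) (φ : FiberChart k (n + k) f m) (x : Eu k) :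
    ℝ :=
  lam (φ.toFun x) (fun j => tder φ.toFun x (EuclideanSpace.single j 1))

theorem FBox.image_chart (B : FBox n k f) (m : M) :
    (B.chart m).toFun '' (B.chart m).source = B.src ∩ f ⁻¹' {m} := by
  ext y
  constructor
  · rintro ⟨z, hz, rfl⟩
    exact ⟨B.pt_mem _ hz, B.f_pt _ hz⟩
  · rintro ⟨h1, rfl⟩
    exact ⟨B.co y, B.mem_dom y h1, B.pt_co y h1⟩

theorem FBox.contMDiffOn_dens (B : FBox n k f) (hlam : VertDensity f lam) :
    ContMDiffOn (𝓡 k) 𝓘(ℝ, ℝ) ∞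
      (fun z => lam (B.pt (m, z)) (fun i => B.slice (m, z) (EuclideanSpace.single i 1)))
      (B.fdom m) := by
  have h1 : ContMDiffOn (𝓡 k) ((𝓡 n).prod (𝓡 k)) ∞ (fun z : Eu k => (m, z)) (B.fdom m) :=
    contMDiffOn_const.prodMk contMDiffOn_id
  exact ContMDiffOn.comp (g := fun x : M × Eu k =>
    lam (B.pt x) (fun i => B.slice x (EuclideanSpace.single i 1))) (hlam.smooth B) h1 (fun _ hz => hz)

theorem FBox.continuousOn_dens (B : FBox n k f) (hlam : VertDensity f lam) :
    ContinuousOn ((B.chart m).dens lam) (B.fdom m) :=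
  (B.contMDiffOn_dens hlam).continuousOn

namespace FiberChart

variable (φ : FiberChart k (n + k) f m) (B : FBox n k f)

theorem contMDiffAt {x : Eu k} (hx : x ∈ φ.source) :
    ContMDiffAt (𝓡 k) (𝓡 (n + k)) ∞ φ.toFun x :=
  φ.contMDiffOn.contMDiffAt (φ.isOpen_source.mem_nhds hx)

theorem isOpen_preimage_src : IsOpen (φ.source ∩ φ.toFun ⁻¹' B.src) :=
  φ.contMDiffOn.continuousOn.isOpen_inter_preimage φ.isOpen_source B.isOpen_src

/-- The coordinate change between a parametrization of a piece of a fibre and local product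
coordinates. -/
def trans (x : Eu k) : Eu k := B.co (φ.toFun x)

theorem contDiffOn_trans : ContDiffOn ℝ ∞ (φ.trans B) (φ.source ∩ φ.toFun ⁻¹' B.src) := by
  rw [← contMDiffOn_iff_contDiffOn]
  exact B.contMDiffOn_co.comp (φ.contMDiffOn.mono inter_subset_left) (fun x hx => hx.2)

theorem hasFDerivAt_trans {x : Eu k} (hx : x ∈ φ.source) (hx' : φ.toFun x ∈ B.src) :
    HasFDerivAt (φ.trans B) (fderiv ℝ (φ.trans B) x) x :=
  (((φ.contDiffOn_trans B).contDiffAt ((φ.isOpen_preimage_src B).mem_nhds ⟨hx, hx'⟩)).differentiableAt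
    (by simp)).hasFDerivAt

theorem fderiv_trans {x : Eu k} (hx : x ∈ φ.source) (hx' : φ.toFun x ∈ B.src) (w : Eu k) :
    fderiv ℝ (φ.trans B) x w =
      tder (a := n + k) (b := k) B.co (φ.toFun x) (tder φ.toFun x w) := by
  have h1 := mfderiv_comp (I := 𝓡 k) (I' := 𝓡 (n + k)) (I'' := 𝓡 k) x
    (g := B.co) (f := φ.toFun) (B.mdifferentiableAt_co hx')
    ((φ.contMDiffAt hx).mdifferentiableAt (by simp))
  rw [← mfderiv_eq_fderiv]
  exact congrArg (fun T : Eu k →L[ℝ] Eu k => T w) h1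

theorem pt_trans {x : Eu k} (hx : x ∈ φ.source) (hx' : φ.toFun x ∈ B.src) :
    B.pt (m, φ.trans B x) = φ.toFun x := by
  have := B.pt_co _ hx'
  rwa [φ.maps x hx] at this

theorem trans_mem {x : Eu k} (hx : x ∈ φ.source) (hx' : φ.toFun x ∈ B.src) :
    (m, φ.trans B x) ∈ B.dom := by
  have := B.mem_dom _ hx'
  rwa [φ.maps x hx] at this

theorem tder_eq_slice (hf : IsSubmersion (𝓡 (n + k)) (𝓡 n) ∞ f) {x : Eu k} (hx : x ∈ φ.source)
    (hx' : φ.toFun x ∈ B.src) (w : Eu k) :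
    tder φ.toFun x w = B.slice (m, φ.trans B x) (fderiv ℝ (φ.trans B) x w) := by
  have := B.slice_tder_co hf hx' (φ.tder_mem_vertical hf.contMDiff hx w)
  rw [φ.maps x hx] at this
  rw [φ.fderiv_trans B hx hx']
  exact this.symm

/-- The transformation rule of densities under a change of parametrization: the velocity vectors of
`φ` are those of the box chart combined by the Jacobian matrix of the coordinate change. -/
theorem dens_eq (hf : IsSubmersion (𝓡 (n + k)) (𝓡 n) ∞ f) (hlam : VertDensity f lam) {x : Eu k}
    (hx : x ∈ φ.source) (hx' : φ.toFun x ∈ B.src) :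
    φ.dens lam x = |(fderiv ℝ (φ.trans B) x).det| * (B.chart m).dens lam (φ.trans B x) := by
  have hd := φ.trans_mem B hx hx'
  have h1 := hlam.density (B.pt (m, φ.trans B x))
    (fun i => B.slice (m, φ.trans B x) (EuclideanSpace.single i 1))
    (fun i => B.slice_mem_vertical hf hd _)
    (Matrix.of fun j i : Fin k => (fderiv ℝ (φ.trans B) x (EuclideanSpace.single j 1)) i)
  rw [det_of_single] at h1
  refine Eq.trans ?_ h1
  rw [φ.pt_trans B hx hx']
  unfold dens
  congr 1
  funext j
  rw [φ.tder_eq_slice B hf hx hx']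
  conv_lhs => rw [sum_smul_single (fderiv ℝ (φ.trans B) x (EuclideanSpace.single j 1))]
  rw [map_sum]
  simp

theorem dens_pos (hf : IsSubmersion (𝓡 (n + k)) (𝓡 n) ∞ f) (hlam : VertDensity f lam) {x : Eu k}
    (hx : x ∈ φ.source) : 0 < φ.dens lam x := by
  have h1 : LinearIndependent ℝ (fun j : Fin k => tder φ.toFun x (EuclideanSpace.single j 1)) :=
    linearIndependent_map_single ((tder (a := k) (b := n + k) φ.toFun x).toLinearMap)
      (φ.injective_der x hx)
  exact hlam.pos (φ.toFun x) (fun j => tder φ.toFun x (EuclideanSpace.single j 1))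
    (fun i => φ.tder_mem_vertical hf.contMDiff hx _) h1

/-- Smoothness of `lam` is known only in product coordinates. The transformation rule carries
continuity over to an arbitrary parametrization. -/
theorem continuousOn_dens (hf : IsSubmersion (𝓡 (n + k)) (𝓡 n) ∞ f) (hlam : VertDensity f lam) :
    ContinuousOn (φ.dens lam) φ.source := by
  intro x hx
  obtain ⟨B, hB⟩ := exists_box hf (φ.toFun x)
  have hO := φ.isOpen_preimage_src B
  have h1 : ContinuousOn (fun x => |(fderiv ℝ (φ.trans B) x).det| *
      (B.chart m).dens lam (φ.trans B x)) (φ.source ∩ φ.toFun ⁻¹' B.src) := by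
    refine ContinuousOn.mul ?_ ?_
    · exact (ContinuousLinearMap.continuous_det.comp_continuousOn
        ((φ.contDiffOn_trans B).continuousOn_fderiv_of_isOpen hO (by simp))).abs
    · exact (B.continuousOn_dens hlam).comp (φ.contDiffOn_trans B).continuousOn
        (fun x hx => φ.trans_mem B hx.1 hx.2)
  refine ContinuousAt.continuousWithinAt ?_
  refine (h1.continuousAt (hO.mem_nhds ⟨hx, hB⟩)).congr ?_
  filter_upwards [hO.mem_nhds ⟨hx, hB⟩] with z hz
  exact (φ.dens_eq B hf hlam hz.1 hz.2).symm

variable [MeasurableSpace N] [BorelSpace N]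

theorem aemeasurable_toFun : AEMeasurable φ.toFun (volume.restrict φ.source) :=
  φ.contMDiffOn.continuousOn.aemeasurable φ.isOpen_source.measurableSet

theorem measurableSet_inter_preimage {A : Set N} (hA : MeasurableSet A) :
    MeasurableSet (φ.source ∩ φ.toFun ⁻¹' A) := by
  have h1 : Measurable (φ.source.domRestrict φ.toFun) :=
    (continuousOn_iff_continuous_domRestrict.1 φ.contMDiffOn.continuousOn).measurable
  have h2 := MeasurableSet.subtype_image φ.isOpen_source.measurableSet (h1 hA)
  convert h2 using 1
  ext x
  simp [and_comm]

theorem measurableSet_image [T1Space M] (hf : Continuous f) :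
    MeasurableSet (φ.toFun '' φ.source) := by
  obtain ⟨O, hO, h⟩ := φ.open_map φ.source subset_rfl φ.isOpen_source
  rw [h]
  exact hO.measurableSet.inter (isClosed_singleton.preimage hf).measurableSet

/-- The measure on a piece of a fibre defined by a density. -/
def meas (lam : N → (Fin k → Eu (n + k)) → ℝ) : Measure N :=
  Measure.map φ.toFun ((volume.restrict φ.source).withDensity fun x => ENNReal.ofReal (φ.dens lam x))

theorem aemeasurable_dens (hf : IsSubmersion (𝓡 (n + k)) (𝓡 n) ∞ f) (hlam : VertDensity f lam) :
    AEMeasurable (fun x => ENNReal.ofReal (φ.dens lam x)) (volume.restrict φ.source) :=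
  ((φ.continuousOn_dens hf hlam).aemeasurable φ.isOpen_source.measurableSet).ennreal_ofReal

theorem meas_apply {A : Set N} (hA : MeasurableSet A) :
    φ.meas lam A = ∫⁻ x in φ.source ∩ φ.toFun ⁻¹' A, ENNReal.ofReal (φ.dens lam x) := by
  rw [meas, Measure.map_apply_of_aemeasurable
    (φ.aemeasurable_toFun.mono_ac (withDensity_absolutelyContinuous _ _)) hA,
    withDensity_apply' _ _, Measure.restrict_restrict' φ.isOpen_source.measurableSet, inter_comm]

/-- The Jacobian in the change of variables formula cancels the one in `dens_eq`, so the measure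
does not depend on the parametrization. The intersection with the image of `φ` accounts for the part
of the box that `φ` does not reach. -/
theorem meas_eq_meas_chart [T1Space M] (hf : IsSubmersion (𝓡 (n + k)) (𝓡 n) ∞ f)
    (hlam : VertDensity f lam) {A : Set N} (hA : MeasurableSet A) (hAB : A ⊆ B.src) :
    φ.meas lam A = (B.chart m).meas lam (A ∩ φ.toFun '' φ.source) := by
  rw [φ.meas_apply hA,
    (B.chart m).meas_apply (hA.inter (φ.measurableSet_image hf.contMDiff.continuous))]
  have himg : (B.chart m).source ∩ (B.chart m).toFun ⁻¹' (A ∩ φ.toFun '' φ.source) =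
      φ.trans B '' (φ.source ∩ φ.toFun ⁻¹' A) := by
    ext z
    constructor
    · rintro ⟨hz, hzA, x, hx, hxz⟩
      have hxz' : φ.toFun x = B.pt (m, z) := hxz
      refine ⟨x, ⟨hx, ?_⟩, ?_⟩
      · rw [mem_preimage, hxz]
        exact hzA
      · rw [trans, hxz']
        exact B.co_pt _ hz
    · rintro ⟨x, ⟨hx, hxA⟩, rfl⟩
      have h2 : (B.chart m).toFun (φ.trans B x) = φ.toFun x := φ.pt_trans B hx (hAB hxA)
      refine ⟨φ.trans_mem B hx (hAB hxA), ?_⟩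
      rw [mem_preimage, h2]
      exact ⟨hxA, x, hx, rfl⟩
  rw [himg, lintegral_image_eq_lintegral_abs_det_fderiv_mul volume
    (φ.measurableSet_inter_preimage hA)
    (fun x hx => (φ.hasFDerivAt_trans B hx.1 (hAB hx.2)).hasFDerivWithinAt)]
  · refine setLIntegral_congr_fun (φ.measurableSet_inter_preimage hA) fun x hx => ?_
    rw [φ.dens_eq B hf hlam hx.1 (hAB hx.2), ENNReal.ofReal_mul (abs_nonneg _)]
  · intro x hx x' hx' h
    refine φ.injOn hx.1 hx'.1 ?_
    rw [← φ.pt_trans B hx.1 (hAB hx.2), ← φ.pt_trans B hx'.1 (hAB hx'.2), h]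

end FiberChart

variable [SecondCountableTopology N]

/-- Second countability gives a countable cover by boxes. Cutting it into disjoint Borel pieces lets
the local measures be summed without counting any overlap twice. -/
theorem exists_countable_boxes (hf : IsSubmersion (𝓡 (n + k)) (𝓡 n) ∞ f) :
    ∃ (s : Set N) (B : s → FBox n k f) (A : s → Set N), s.Countable ∧
      (∀ i, A i ⊆ (B i).src) ∧ (⋃ i, A i = univ) ∧ Pairwise (Function.onFun Disjoint A) ∧
      ∀ i, @MeasurableSet N (borel N) (A i) := by
  choose B hB using fun y => exists_box hf y
  obtain ⟨s, hs, hcov⟩ := TopologicalSpace.countable_cover_nhds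
    (fun y => (B y).isOpen_src.mem_nhds (hB y))
  have := hs.toEncodable
  let _ : MeasurableSpace N := borel N
  have : BorelSpace N := ⟨rfl⟩
  -- From each box remove the boxes that precede it in the enumeration.
  refine ⟨s, fun i => B i, fun i => (B i).src \ ⋃ j : {j : s // Encodable.encode j < Encodable.encode i},
    (B j.1).src, hs, fun i => sdiff_subset, ?_, ?_, fun i => ?_⟩
  · refine eq_univ_of_forall fun y => ?_
    have hy : ∃ l : ℕ, ∃ i : s, Encodable.encode i = l ∧ y ∈ (B i).src := by
      have : y ∈ ⋃ x ∈ s, (B x).src := hcov ▸ mem_univ y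
      simp only [mem_iUnion] at this
      obtain ⟨x, hx, hy⟩ := this
      exact ⟨_, ⟨x, hx⟩, rfl, hy⟩
    classical
    obtain ⟨i, hi, hyi⟩ := Nat.find_spec hy
    refine mem_iUnion.2 ⟨i, hyi, fun h => ?_⟩
    obtain ⟨⟨j, hj⟩, hyj⟩ := mem_iUnion.1 h
    exact Nat.find_min hy (hi ▸ hj) ⟨j, rfl, hyj⟩
  · have key : ∀ i j : s, Encodable.encode i < Encodable.encode j → ∀ y,
        y ∈ (B i).src → y ∉ ⋃ j' : {j' : s // Encodable.encode j' < Encodable.encode j},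
          (B j'.1).src → False := fun i j hij y hy hy' => hy' (mem_iUnion.2 ⟨⟨i, hij⟩, hy⟩)
    intro i j hij
    refine Set.disjoint_left.2 fun y hyi hyj => ?_
    rcases lt_trichotomy (Encodable.encode i) (Encodable.encode j) with h | h | h
    · exact key i j h y hyi.1 hyj.2
    · exact hij (Encodable.encode_injective h)
    · exact key j i h y hyj.1 hyi.2
  · exact (B i).isOpen_src.measurableSet.diff
      (MeasurableSet.iUnion fun j => (B j.1).isOpen_src.measurableSet)

variable [MeasurableSpace N] [BorelSpace N]

/-- The measure on `N`, supported by the fibre over `m`, which is defined by a positive density. -/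
def fibMeas (hf : IsSubmersion (𝓡 (n + k)) (𝓡 n) ∞ f) (lam : N → (Fin k → Eu (n + k)) → ℝ) (m : M) :
    Measure N :=
  Measure.sum fun i => (((exists_countable_boxes hf).choose_spec.choose i).chart m).meas lam |>.restrict
    ((exists_countable_boxes hf).choose_spec.choose_spec.choose i)

variable [T1Space M] (hf : IsSubmersion (𝓡 (n + k)) (𝓡 n) ∞ f)

theorem measurableSet_fiber (hf : IsSubmersion (𝓡 (n + k)) (𝓡 n) ∞ f) (m : M) :
    MeasurableSet (f ⁻¹' {m}) :=
  (isClosed_singleton.preimage hf.contMDiff.continuous).measurableSet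

/-- The measure glued from countably many boxes is independent of the choices: on the image of any
parametrization it is the measure which that parametrization defines. Each piece agrees by
`meas_eq_meas_chart`, and the pieces partition `N`. -/
theorem fibMeas_restrict (hlam : VertDensity f lam) (φ : FiberChart k (n + k) f m) :
    (fibMeas hf lam m).restrict (φ.toFun '' φ.source) = φ.meas lam := by
  obtain ⟨hs, h1, h2, h3, h4⟩ := (exists_countable_boxes hf).choose_spec.choose_spec.choose_spec
  set s := (exists_countable_boxes hf).choose
  set B := (exists_countable_boxes hf).choose_spec.choose
  set A := (exists_countable_boxes hf).choose_spec.choose_spec.choose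
  have hcount : Countable s := hs.to_subtype
  have h4' : ∀ i, MeasurableSet (A i) := fun i => by
    rw [BorelSpace.measurable_eq (α := N)]; exact h4 i
  have himg := φ.measurableSet_image hf.contMDiff.continuous
  ext C hC
  rw [Measure.restrict_apply hC, fibMeas, Measure.sum_apply _ (hC.inter himg)]
  have h5 : ∀ i, ((((B i).chart m).meas lam).restrict (A i)) (C ∩ φ.toFun '' φ.source) =
      φ.meas lam (C ∩ A i) := by
    intro i
    rw [φ.meas_eq_meas_chart (B i) hf hlam (hC.inter (h4' i)) (inter_subset_right.trans (h1 i)),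
      Measure.restrict_apply (hC.inter himg), inter_right_comm]
  calc _ = ∑' i, φ.meas lam (C ∩ A i) := tsum_congr h5
    _ = φ.meas lam (⋃ i, C ∩ A i) := by
      rw [measure_iUnion (fun i j hij => (h3 hij).mono inter_subset_right inter_subset_right)
        (fun i => hC.inter (h4' i))]
    _ = φ.meas lam C := by rw [← inter_iUnion, h2, inter_univ]

theorem fibMeas_compl_fiber : fibMeas hf lam m (f ⁻¹' {m})ᶜ = 0 := by
  have hm := (measurableSet_fiber hf m).compl
  rw [fibMeas, Measure.sum_apply _ hm, ENNReal.tsum_eq_zero]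
  intro i
  refine le_antisymm ((Measure.restrict_apply_le _ _).trans ?_) bot_le
  rw [FiberChart.meas_apply _ hm]
  have : ∀ φ : FiberChart k (n + k) f m, φ.source ∩ φ.toFun ⁻¹' (f ⁻¹' {m})ᶜ = ∅ := by
    intro φ
    ext x
    simp only [mem_inter_iff, mem_preimage, mem_compl_iff, mem_singleton_iff, mem_empty_iff_false,
      iff_false, not_and, not_not]
    exact fun hx => φ.maps x hx
  rw [this]
  simp

theorem ae_fibMeas : ∀ᵐ y ∂fibMeas hf lam m, f y = m := by
  have := fibMeas_compl_fiber (lam := lam) (m := m) hf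
  exact mem_ae_iff.2 this

theorem fibMeas_restrict_fiber : (fibMeas hf lam m).restrict (f ⁻¹' {m}) = fibMeas hf lam m :=
  Measure.restrict_eq_self_of_ae_mem (ae_fibMeas hf)

/-- Near a point of the fibre, a small closed ball in slice coordinates is compact and the density
is continuous on it. Near any other point the measure vanishes, since the complement of the fibre is
open and null. -/
theorem isLocallyFinite_fibMeas (hlam : VertDensity f lam) :
    IsLocallyFiniteMeasure (fibMeas hf lam m) := by
  refine ⟨fun y => ?_⟩
  by_cases hy : f y = m
  · obtain ⟨B, hB⟩ := exists_box hf y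
    have hd := B.mem_dom y hB
    rw [hy] at hd
    have hd' : B.fdom m ∈ 𝓝 (B.co y) := (B.isOpen_fdom m).mem_nhds hd
    obtain ⟨r, hr, hr'⟩ := Metric.nhds_basis_closedBall.mem_iff.1 hd'
    let W := B.src ∩ B.co ⁻¹' Metric.ball (B.co y) r
    have hW : IsOpen W :=
      B.contMDiffOn_co.continuousOn.isOpen_inter_preimage B.isOpen_src Metric.isOpen_ball
    refine ⟨W, hW.mem_nhds ⟨hB, Metric.mem_ball_self hr⟩, ?_⟩
    have h1 : fibMeas hf lam m W = (B.chart m).meas lam W := by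
      rw [← fibMeas_restrict hf hlam (B.chart m), FBox.image_chart,
        Measure.restrict_apply hW.measurableSet, ← inter_assoc, inter_eq_left.2 inter_subset_left]
      conv_lhs => rw [← fibMeas_restrict_fiber hf]
      rw [Measure.restrict_apply hW.measurableSet]
    rw [h1, FiberChart.meas_apply _ hW.measurableSet]
    have hsub : (B.chart m).source ∩ (B.chart m).toFun ⁻¹' W ⊆ Metric.closedBall (B.co y) r := by
      rintro z ⟨hz, -, hz'⟩
      have h2 : B.co (B.pt (m, z)) = z := B.co_pt _ hz
      have h3 : B.co (B.pt (m, z)) ∈ Metric.ball (B.co y) r := hz'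
      rw [h2] at h3
      exact Metric.ball_subset_closedBall h3
    refine (lintegral_mono_set hsub).trans_lt ?_
    have hint : IntegrableOn ((B.chart m).dens lam) (Metric.closedBall (B.co y) r) :=
      (((B.chart m).continuousOn_dens hf hlam).mono hr').integrableOn_compact
        (isCompact_closedBall _ _)
    exact (lintegral_ofReal_le_lintegral_enorm _).trans_lt hint.2
  · refine ⟨(f ⁻¹' {m})ᶜ, (isClosed_singleton.preimage hf.contMDiff.continuous).isOpen_compl.mem_nhds hy,
      ?_⟩
    rw [fibMeas_compl_fiber]
    simp

end FiberMeasure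

/-! ### Integration along the fibres as integration against the fibre measures -/

section FiberIntegral

variable {n k : ℕ} {N M : Type*}
  [TopologicalSpace N] [ChartedSpace (Eu (n + k)) N] [IsManifold (𝓡 (n + k)) ∞ N]
  [TopologicalSpace M] [ChartedSpace (Eu n) M] [IsManifold (𝓡 n) ∞ M]
  [SecondCountableTopology N] [MeasurableSpace N] [BorelSpace N] [T1Space M]
  {f : N → M} {lam : N → (Fin k → Eu (n + k)) → ℝ} {m : M}
  (hf : IsSubmersion (𝓡 (n + k)) (𝓡 n) ∞ f) (hlam : VertDensity f lam)
  {V : Type*} [NormedAddCommGroup V] [NormedSpace ℝ V]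

include hf hlam

/-- The measure lives on the fibre, so continuity there is enough. Integrands such as kernels or
composites with the action are controlled only on fibres. -/
theorem aestronglyMeasurable_fibMeas {g : N → V} (hg : ContinuousOn g (f ⁻¹' {m})) :
    AEStronglyMeasurable g (fibMeas hf lam m) := by
  rw [← fibMeas_restrict_fiber hf]
  exact hg.aestronglyMeasurable (measurableSet_fiber hf m)

theorem aestronglyMeasurable_meas {g : N → V} (hg : ContinuousOn g (f ⁻¹' {m}))
    (φ : FiberChart k (n + k) f m) : AEStronglyMeasurable g (φ.meas lam) := by
  rw [← fibMeas_restrict hf hlam φ]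
  exact (aestronglyMeasurable_fibMeas hf hlam hg).restrict

theorem integrableOn_image_fibMeas {g : N → V} (hg : ContinuousOn g (f ⁻¹' {m}))
    (φ : FiberChart k (n + k) f m) :
    IntegrableOn g (φ.toFun '' φ.source) (fibMeas hf lam m) ↔
      IntegrableOn (fun x => φ.dens lam x • g (φ.toFun x)) φ.source := by
  have h1 := aestronglyMeasurable_meas hf hlam hg φ
  rw [IntegrableOn, fibMeas_restrict hf hlam, FiberChart.meas, integrable_map_measure h1
    (φ.aemeasurable_toFun.mono_ac (withDensity_absolutelyContinuous _ _)),
    integrable_withDensity_iff_integrable_smul₀' (φ.aemeasurable_dens hf hlam) (by simp)]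
  refine integrableOn_congr_fun (fun x hx => ?_) φ.isOpen_source.measurableSet
  simp [ENNReal.toReal_ofReal (φ.dens_pos hf hlam hx).le]

theorem setIntegral_image_fibMeas {g : N → V} (hg : ContinuousOn g (f ⁻¹' {m}))
    (φ : FiberChart k (n + k) f m) :
    ∫ y in φ.toFun '' φ.source, g y ∂fibMeas hf lam m =
      ∫ x in φ.source, φ.dens lam x • g (φ.toFun x) := by
  have h1 := aestronglyMeasurable_meas hf hlam hg φ
  rw [fibMeas_restrict hf hlam, FiberChart.meas, integral_map
    (φ.aemeasurable_toFun.mono_ac (withDensity_absolutelyContinuous _ _)) h1,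
    integral_withDensity_eq_integral_toReal_smul₀ (φ.aemeasurable_dens hf hlam) (by simp)]
  refine setIntegral_congr_fun φ.isOpen_source.measurableSet (fun x hx => ?_)
  simp [ENNReal.toReal_ofReal (φ.dens_pos hf hlam hx).le]

theorem integrable_fibMeas {g : N → V} (hg : ContinuousOn g (f ⁻¹' {m})) {C : Set N}
    (hC : IsCompact C) (hgC : ∀ y, f y = m → g y ≠ 0 → y ∈ C) [T2Space N] :
    Integrable g (fibMeas hf lam m) := by
  have := isLocallyFinite_fibMeas (m := m) hf hlam
  have hcl : IsClosed (f ⁻¹' {m}) := isClosed_singleton.preimage hf.contMDiff.continuous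
  have hK : IsCompact (C ∩ f ⁻¹' {m}) := hC.inter_right hcl
  have h1 : IntegrableOn g (C ∩ f ⁻¹' {m}) (fibMeas hf lam m) :=
    (hg.mono inter_subset_right).integrableOn_compact hK
  rw [← integrable_indicator_iff hK.isClosed.measurableSet] at h1
  refine h1.congr ?_
  filter_upwards [ae_fibMeas (lam := lam) (m := m) hf] with y hy
  by_cases hyC : y ∈ C
  · rw [indicator_of_mem (show y ∈ C ∩ f ⁻¹' {m} from ⟨hyC, hy⟩)]
  · rw [indicator_of_notMem (fun h => hyC h.1)]
    by_contra h
    exact hyC (hgC y hy (Ne.symm h))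

/-- The density is strictly positive in a parametrization, so Lebesgue null sets and null sets of
the fibre measure coincide there. A continuous function vanishing almost everywhere on an open
subset of ℝᵏ vanishes identically. -/
theorem eq_zero_of_ae_fibMeas {g : N → V} (hg : ContinuousOn g (f ⁻¹' {m}))
    (h0 : ∀ᵐ y ∂fibMeas hf lam m, g y = 0) {y : N} (hy : f y = m) : g y = 0 := by
  obtain ⟨B, hB⟩ := exists_box hf y
  set φ := B.chart m
  have h1 : ∀ᵐ y ∂φ.meas lam, g y = 0 := by
    rw [← fibMeas_restrict hf hlam φ]
    exact ae_restrict_of_ae h0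
  have h2 := ae_of_ae_map (φ.aemeasurable_toFun.mono_ac (withDensity_absolutelyContinuous _ _)) h1
  have h3 : volume.restrict φ.source ≪ (volume.restrict φ.source).withDensity
      fun x => ENNReal.ofReal (φ.dens lam x) := by
    refine withDensity_absolutelyContinuous' (φ.aemeasurable_dens hf hlam) ?_
    refine (ae_restrict_iff' φ.isOpen_source.measurableSet).2 (Filter.Eventually.of_forall fun x hx => ?_)
    simp [φ.dens_pos hf hlam hx]
  have h4 := h3.ae_le h2
  have h5 : ContinuousOn (fun x => g (φ.toFun x)) φ.source :=
    hg.comp φ.contMDiffOn.continuousOn (fun x hx => φ.maps x hx)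
  have h6 : EqOn (fun x => g (φ.toFun x)) (fun _ => 0) φ.source :=
    Measure.eqOn_open_of_ae_eq h4 φ.isOpen_source h5 continuousOn_const
  have h7 : B.co y ∈ φ.source := by
    have := B.mem_dom y hB
    rwa [hy] at this
  have h8 := h6 h7
  have h9 : φ.toFun (B.co y) = y := by
    have := B.pt_co y hB
    rwa [hy] at this
  simpa only [h9] using h8

theorem setIntegral_eq_integral_fibMeas {g : N → V} {A : Set N}
    (hgA : ∀ y, f y = m → g y ≠ 0 → y ∈ A) (hA : MeasurableSet A) :
    ∫ y in A, g y ∂fibMeas hf lam m = ∫ y, g y ∂fibMeas hf lam m := by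
  rw [← integral_indicator hA]
  refine integral_congr_ae ?_
  filter_upwards [ae_fibMeas (lam := lam) (m := m) hf] with y hy
  by_cases h : y ∈ A
  · rw [indicator_of_mem h]
  · rw [indicator_of_notMem h]
    by_contra h'
    exact h (hgA y hy (Ne.symm h'))

/-- The integral of a density along a fibre is the integral of its coefficient with respect to the
fibre measure. -/
theorem hasFiberIntegral_iff [T2Space N] {θ : N → (Fin k → Eu (n + k)) → ℂ} {g : N → ℂ}
    (hθ : ∀ y, f y = m → ∀ v, (∀ i, v i ∈ vertical (a := n + k) (b := n) f y) →
      θ y v = g y * (lam y v : ℂ))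
    (hg : ContinuousOn g (f ⁻¹' {m})) {C : Set N}
    (hC : IsCompact C) (hgC : ∀ y, f y = m → g y ≠ 0 → y ∈ C) {I : ℂ} :
    HasFiberIntegral (a := n + k) (b := n) k f m θ I ↔ I = ∫ y, g y ∂fibMeas hf lam m := by
  -- Velocities of a parametrization are vertical, so the pulled-back density is the coefficient
  -- times the coordinate density of `lam`.
  have hterm : ∀ (φ : FiberChart k (n + k) f m) (χ : N → ℝ), ∀ x ∈ φ.source,
      (χ (φ.toFun x) : ℂ) * θ (φ.toFun x) (fun j => tder φ.toFun x (EuclideanSpace.single j 1)) =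
        φ.dens lam x • ((χ (φ.toFun x) : ℂ) * g (φ.toFun x)) := by
    intro φ χ x hx
    rw [hθ _ (φ.maps x hx) _ (fun i => φ.tder_mem_vertical hf.contMDiff hx _), Complex.real_smul,
      FiberChart.dens]
    ring
  have hcont : ∀ χ : N → ℝ, Continuous χ →
      ContinuousOn (fun y => (χ y : ℂ) * g y) (f ⁻¹' {m}) := fun χ hχ =>
    (Complex.continuous_ofReal.comp hχ).continuousOn.mul hg
  have hsupp : ∀ χ : N → ℝ, ∀ y, f y = m → (χ y : ℂ) * g y ≠ 0 → y ∈ C := fun χ y hy h =>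
    hgC y hy (right_ne_zero_of_mul h)
  have hint : ∀ χ : N → ℝ, Continuous χ →
      Integrable (fun y => (χ y : ℂ) * g y) (fibMeas hf lam m) := fun χ hχ =>
    integrable_fibMeas hf hlam (hcont χ hχ) hC (hsupp χ)
  have hpiece : ∀ (φ : FiberChart k (n + k) f m) (χ : N → ℝ), Continuous χ →
      (∃ C ⊆ φ.source, IsCompact C ∧ ∀ y, f y = m → χ y ≠ 0 → y ∈ φ.toFun '' C) →
      ∫ x in φ.source, (χ (φ.toFun x) : ℂ) *
        θ (φ.toFun x) (fun j => tder φ.toFun x (EuclideanSpace.single j 1)) =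
      ∫ y, (χ y : ℂ) * g y ∂fibMeas hf lam m := by
    rintro φ χ hχ ⟨C', hC', -, hχC⟩
    rw [setIntegral_congr_fun φ.isOpen_source.measurableSet (hterm φ χ),
      ← setIntegral_image_fibMeas hf hlam (hcont χ hχ) φ]
    refine setIntegral_eq_integral_fibMeas hf hlam (fun y hy h => ?_)
      (φ.measurableSet_image hf.contMDiff.continuous)
    refine image_mono hC' (hχC y hy fun h' => h ?_)
    simp [h']
  constructor
  · rintro ⟨l, φ, χ, h1, h2, h3, h4, h5⟩
    rw [h5, Finset.sum_congr rfl fun i _ => hpiece (φ i) (χ i) (h1 i) (h2 i),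
      ← integral_finsetSum _ fun i _ => hint (χ i) (h1 i)]
    refine integral_congr_ae ?_
    filter_upwards [ae_fibMeas (lam := lam) (m := m) hf] with y hy
    rw [← Finset.sum_mul]
    by_cases hgy : g y = 0
    · simp [hgy]
    -- The partition is normalized only where the density is nonzero on some vertical tuple. Where
    -- `g` does not vanish, an independent tuple coming from a box is such a tuple.
    · obtain ⟨B, hB⟩ := exists_box hf y
      have hd := B.mem_dom y hB
      have hv : ∀ i, B.slice (f y, B.co y) (EuclideanSpace.single i 1) ∈
          vertical (a := n + k) (b := n) f y := fun i => by
        have := B.slice_mem_vertical hf hd (EuclideanSpace.single i 1)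
        rwa [B.pt_co y hB] at this
      have hpos := hlam.pos y _ hv
        (linearIndependent_map_single (B.slice (f y, B.co y) : Eu k →ₗ[ℝ] Eu (n + k))
          (B.slice_injective hd))
      have := h3 y hy _ hv (by
        rw [hθ y hy _ hv]
        exact mul_ne_zero hgy (by exact_mod_cast hpos.ne'))
      rw [← Complex.ofReal_sum, this]
      simp
  -- Existence: finitely many boxes cover the compact set containing the support in the fibre, and a
  -- partition of unity subordinate to them realizes the integral.
  · intro hI
    have hloc := locallyCompactSpace_of_euclidean (n + k) N
    have hcl : IsClosed (f ⁻¹' {m}) := isClosed_singleton.preimage hf.contMDiff.continuous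
    choose B hB using fun y => exists_box hf y
    obtain ⟨t, ht⟩ := hC.elim_finite_subcover (fun y => (B y).src) (fun y => (B y).isOpen_src)
      (fun y _ => mem_iUnion.2 ⟨y, hB y⟩)
    let e := t.equivFin
    obtain ⟨χ, hχ1, hχ2, -, hχ4⟩ := exists_continuous_sum_one_of_isOpen_isCompact
      (s := fun i : Fin t.card => (B (e.symm i)).src) (fun i => (B _).isOpen_src) hC (by
        intro y hy
        obtain ⟨x, hx⟩ := mem_iUnion.1 (ht hy)
        obtain ⟨hxt, hxy⟩ := mem_iUnion.1 hx
        refine mem_iUnion.2 ⟨e ⟨x, hxt⟩, ?_⟩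
        simpa using hxy)
    have hcomp : ∀ i, ∃ C ⊆ ((B (e.symm i)).chart m).source, IsCompact C ∧
        ∀ y, f y = m → χ i y ≠ 0 → y ∈ ((B (e.symm i)).chart m).toFun '' C := by
      intro i
      set b := B (e.symm i)
      have hK : IsCompact (tsupport (χ i) ∩ f ⁻¹' {m}) := (hχ4 i).isCompact.inter_right hcl
      refine ⟨b.co '' (tsupport (χ i) ∩ f ⁻¹' {m}), ?_, hK.image_of_continuousOn
        (b.contMDiffOn_co.continuousOn.mono (inter_subset_left.trans (hχ1 i))), ?_⟩
      · rintro _ ⟨y, ⟨hy, hy'⟩, rfl⟩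
        have := b.mem_dom y (hχ1 i hy)
        rwa [show f y = m from hy'] at this
      · intro y hy h
        have hys := subset_tsupport _ h
        refine ⟨b.co y, ⟨y, ⟨hys, hy⟩, rfl⟩, ?_⟩
        have := b.pt_co y (hχ1 i hys)
        rwa [hy] at this
    refine ⟨t.card, fun i => (B (e.symm i)).chart m, fun i => χ i, fun i => (χ i).continuous,
      hcomp, ?_, ?_, ?_⟩
    · intro y hy v hv hne
      rw [hθ y hy v hv] at hne
      have := hχ2 (hgC y hy (left_ne_zero_of_mul hne))
      simpa using this
    · intro i
      rw [integrableOn_congr_fun (hterm ((B (e.symm i)).chart m) (χ i))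
        (FBox.isOpen_fdom _ _).measurableSet]
      exact (integrableOn_image_fibMeas hf hlam (hcont _ (χ i).continuous) _).1
        (hint _ (χ i).continuous).integrableOn
    · rw [hI, Finset.sum_congr rfl fun i _ => hpiece ((B (e.symm i)).chart m) (χ i)
        (χ i).continuous (hcomp i), ← integral_finsetSum _ fun i _ => hint (χ i) (χ i).continuous]
      refine integral_congr_ae ?_
      filter_upwards [ae_fibMeas (lam := lam) (m := m) hf] with y hy
      rw [← Finset.sum_mul]
      by_cases hgy : g y = 0
      · simp [hgy]
      · have := hχ2 (hgC y hy hgy)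
        rw [← Complex.ofReal_sum]
        simp only [Finset.sum_apply, Pi.one_apply] at this
        rw [this]
        simp

end FiberIntegral

/-! ### Smooth dependence of fibre integrals on parameters -/

section Parameters

/-- The integral of G(p, ·) is the value at 0 of the convolution of the constant 1 with z ↦ G(p,
-z). Smoothness of convolutions with a compactly supported parametrized factor then applies. -/
theorem contDiffOn_integral_of_compact {k : ℕ} {X V : Type*} [NormedAddCommGroup X]
    [NormedSpace ℝ X] [NormedAddCommGroup V] [NormedSpace ℝ V] [CompleteSpace V]
    {s : Set X} (hs : IsOpen s)
    {K : Set (Eu k)} (hK : IsCompact K) {G : X → Eu k → V} (hG : ∀ p z, p ∈ s → z ∉ K → G p z = 0)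
    (hsm : ContDiffOn ℝ ∞ (Function.uncurry G) (s ×ˢ univ)) :
    ContDiffOn ℝ ∞ (fun p => ∫ z, G p z) s := by
  have h1 := contDiffOn_convolution_right_with_param (n := ⊤) (μ := (volume : Measure (Eu k)))
    (f := fun _ : Eu k => (1 : ℝ)) (L := ContinuousLinearMap.lsmul ℝ ℝ)
    (g := fun p z => G p (-z)) hs hK.neg
    (fun p z hp hz => hG p (-z) hp (fun h => hz (by simpa using h)))
    (locallyIntegrable_const 1) (by
      refine hsm.comp (f := fun x : X × Eu k => (x.1, -x.2)) ?_ (fun x hx => ⟨hx.1, mem_univ _⟩)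
      exact (contDiff_fst.prodMk contDiff_snd.neg).contDiffOn)
  have h2 := h1.comp (f := fun p : X => (p, (0 : Eu k))) (s := s)
    (contDiff_id.prodMk contDiff_const).contDiffOn (fun p hp => ⟨hp, mem_univ _⟩)
  refine h2.congr fun p hp => ?_
  simp [convolution, Function.comp]

variable {EQ HQ Q : Type*} [NormedAddCommGroup EQ] [NormedSpace ℝ EQ] [TopologicalSpace HQ]
  {I : ModelWithCorners ℝ EQ HQ} [I.Boundaryless] [TopologicalSpace Q] [ChartedSpace HQ Q]
  [IsManifold I ∞ Q] {V : Type*} [NormedAddCommGroup V] [NormedSpace ℝ V] [CompleteSpace V]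

theorem contMDiffAt_integral_of_compact {k : ℕ} {W : Set Q} (hW : IsOpen W) {x₀ : Q} (hx₀ : x₀ ∈ W)
    {K : Set (Eu k)} (hK : IsCompact K) {g : Q × Eu k → V} (hg : ∀ x z, x ∈ W → z ∉ K → g (x, z) = 0)
    (hsm : ContMDiffOn (I.prod (𝓡 k)) 𝓘(ℝ, V) ∞ g (W ×ˢ univ)) :
    ContMDiffAt I 𝓘(ℝ, V) ∞ (fun x => ∫ z, g (x, z)) x₀ := by
  set e := extChartAt I x₀
  have hs : IsOpen (e.target ∩ e.symm ⁻¹' W) :=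
    (continuousOn_extChartAt_symm x₀).isOpen_inter_preimage (isOpen_extChartAt_target x₀) hW
  have h1 : ContDiffOn ℝ ∞ (Function.uncurry fun p z => g (e.symm p, z))
      ((e.target ∩ e.symm ⁻¹' W) ×ˢ univ) := by
    rw [← contMDiffOn_iff_contDiffOn]
    have h2 : ContMDiffOn 𝓘(ℝ, EQ × Eu k) (I.prod (𝓡 k)) ∞
        (fun x : EQ × Eu k => (e.symm x.1, x.2)) ((e.target ∩ e.symm ⁻¹' W) ×ˢ univ) := by
      refine ContMDiffOn.prodMk ?_ contDiff_snd.contMDiff.contMDiffOn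
      exact (contMDiffOn_extChartAt_symm x₀).comp (contDiff_fst.contMDiff.contMDiffOn)
        (fun x hx => hx.1.1)
    exact hsm.comp h2 (fun x hx => ⟨hx.1.2, mem_univ _⟩)
  have h3 := contDiffOn_integral_of_compact (G := fun p z => g (e.symm p, z)) hs hK
    (fun p z hp hz => hg _ z hp.2 hz) h1
  have hx : e x₀ ∈ e.target ∩ e.symm ⁻¹' W := by
    refine ⟨mem_extChartAt_target x₀, ?_⟩
    rw [mem_preimage, extChartAt_to_inv]
    exact hx₀
  have h4 := ((h3.contDiffAt (hs.mem_nhds hx)).contMDiffAt).comp x₀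
    (contMDiffAt_extChartAt (I := I) (n := ∞) (x := x₀))
  refine h4.congr_of_eventuallyEq ?_
  filter_upwards [extChartAt_source_mem_nhds (I := I) x₀] with x hx
  simp only [Function.comp]
  rw [(extChartAt I x₀).left_inv hx]

variable {n k : ℕ} {N M : Type*}
  [TopologicalSpace N] [ChartedSpace (Eu (n + k)) N] [IsManifold (𝓡 (n + k)) ∞ N]
  [TopologicalSpace M] [ChartedSpace (Eu n) M] [IsManifold (𝓡 n) ∞ M]
  [SecondCountableTopology N] [T2Space N] [MeasurableSpace N] [BorelSpace N] [T2Space M]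
  {f : N → M} {lam : N → (Fin k → Eu (n + k)) → ℝ}
  (hf : IsSubmersion (𝓡 (n + k)) (𝓡 n) ∞ f) (hlam : VertDensity f lam)

include hf in
/-- A smooth partition of unity on a compact set, with supports in local product coordinates. -/
theorem exists_box_partition {C : Set N} (hC : IsCompact C) :
    ∃ (t : Finset N) (B : t → FBox n k f) (χ : t → N → ℝ),
      (∀ i, ContMDiff (𝓡 (n + k)) 𝓘(ℝ, ℝ) ∞ (χ i)) ∧ (∀ i, IsCompact (tsupport (χ i))) ∧
      (∀ i, tsupport (χ i) ⊆ (B i).src) ∧ ∀ y ∈ C, ∑ i, χ i y = 1 := by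
  have hloc := locallyCompactSpace_of_euclidean (n + k) N
  choose B hB using fun y => exists_box hf y
  have hO : ∀ y, ∃ O : Set N, IsOpen O ∧ y ∈ O ∧ closure O ⊆ (B y).src ∧ IsCompact (closure O) := by
    intro y
    obtain ⟨O, h1, h2, h3, h4⟩ := exists_open_between_and_isCompact_closure isCompact_singleton
      (B y).isOpen_src (singleton_subset_iff.2 (hB y))
    exact ⟨O, h1, h2 rfl, h3, h4⟩
  choose O hO1 hO2 hO3 hO4 using hO
  obtain ⟨t, ht⟩ := hC.elim_finite_subcover O hO1 (fun y _ => mem_iUnion.2 ⟨y, hO2 y⟩)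
  obtain ⟨p, hp⟩ := SmoothPartitionOfUnity.exists_isSubordinate (𝓡 (n + k)) hC.isClosed
    (fun i : t => O i) (fun i => hO1 i) (by
      intro y hy
      obtain ⟨x, hx⟩ := mem_iUnion.1 (ht hy)
      obtain ⟨hxt, hxy⟩ := mem_iUnion.1 hx
      exact mem_iUnion.2 ⟨⟨x, hxt⟩, hxy⟩)
  refine ⟨t, fun i => B i, fun i => p i, fun i => (p i).contMDiff, fun i => ?_, fun i => ?_,
    fun y hy => ?_⟩
  · exact (hO4 i).of_isClosed_subset (isClosed_tsupport _) ((hp i).trans subset_closure)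
  · exact ((hp i).trans subset_closure).trans (hO3 i)
  · rw [← p.sum_eq_one hy, finsum_eq_sum_of_fintype]

include hlam in
-- A partition of unity reduces to integrands supported in a single box. There the moving fibre
-- becomes a fixed copy of ℝᵏ, and the integral becomes one over ℝᵏ with smooth, uniformly compactly
-- supported dependence on the parameter.
theorem contMDiffAt_integral_fibMeas {W : Set Q} (hW : IsOpen W) {x₀ : Q} (hx₀ : x₀ ∈ W)
    {w : Q → M} (hw : ContMDiffOn I (𝓡 n) ∞ w W) {h : N × Q → V}
    (hh : ContMDiffOn ((𝓡 (n + k)).prod I) 𝓘(ℝ, V) ∞ h {y | y.2 ∈ W ∧ f y.1 = w y.2})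
    {C : Set N} (hC : IsCompact C) (hhC : ∀ x ∈ W, ∀ y, f y = w x → h (y, x) ≠ 0 → y ∈ C) :
    ContMDiffAt I 𝓘(ℝ, V) ∞ (fun x => ∫ y, h (y, x) ∂fibMeas hf lam (w x)) x₀ := by
  obtain ⟨t, B, χ, hχ1, hχ2, hχ3, hχ4⟩ := exists_box_partition hf hC
  classical
  have hcont : ∀ x ∈ W, ContinuousOn (fun y => h (y, x)) (f ⁻¹' {w x}) := fun x hx =>
    hh.continuousOn.comp (by fun_prop) (fun y hy => ⟨hx, hy⟩)
  have hcont' : ∀ i, ∀ x ∈ W, ContinuousOn (fun y => χ i y • h (y, x)) (f ⁻¹' {w x}) :=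
    fun i x hx => (hχ1 i).continuous.continuousOn.smul (hcont x hx)
  -- The integrand in box coordinates, extended by zero to all of ℝᵏ. The cutoff `χ i` makes this
  -- extension smooth.
  let g : t → Q × Eu k → V := fun i x => if (w x.1, x.2) ∈ (B i).dom then
    lam ((B i).pt (w x.1, x.2)) (fun j => (B i).slice (w x.1, x.2) (EuclideanSpace.single j 1)) •
      χ i ((B i).pt (w x.1, x.2)) • h ((B i).pt (w x.1, x.2), x.1) else 0
  have hint : ∀ x ∈ W, ∫ y, h (y, x) ∂fibMeas hf lam (w x) = ∑ i, ∫ z, g i (x, z) := by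
    intro x hx
    have h1 : ∫ y, h (y, x) ∂fibMeas hf lam (w x) =
        ∫ y, ∑ i, χ i y • h (y, x) ∂fibMeas hf lam (w x) := by
      refine integral_congr_ae ?_
      filter_upwards [ae_fibMeas (lam := lam) (m := w x) hf] with y hy
      rw [← Finset.sum_smul]
      by_cases h0 : h (y, x) = 0
      · simp [h0]
      · rw [hχ4 y (hhC x hx y hy h0), one_smul]
    rw [h1, integral_finsetSum _ fun i _ => integrable_fibMeas hf hlam (hcont' i x hx) hC
      (fun y hy h0 => hhC x hx y hy (right_ne_zero_of_smul h0))]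
    refine Finset.sum_congr rfl fun i _ => ?_
    have h2 := setIntegral_image_fibMeas hf hlam (hcont' i x hx) ((B i).chart (w x))
    rw [setIntegral_eq_integral_fibMeas hf hlam (fun y hy h0 => ?_)
      (FiberChart.measurableSet_image _ hf.contMDiff.continuous)] at h2
    · rw [h2, ← integral_indicator ((B i).chart (w x)).isOpen_source.measurableSet]
      refine integral_congr_ae (Filter.Eventually.of_forall fun z => ?_)
      rfl
    · rw [FBox.image_chart]
      exact ⟨hχ3 i (subset_tsupport _ (left_ne_zero_of_smul h0)), hy⟩
  have hmain : ContMDiffAt I 𝓘(ℝ, V) ∞ (fun x => ∑ i, ∫ z, g i (x, z)) x₀ := by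
    refine ContMDiffAt.sum fun i _ => ?_
    have hcf : ContinuousOn (fun y => (f y, (B i).co y)) (tsupport (χ i)) :=
      hf.contMDiff.continuous.continuousOn.prodMk
        ((B i).contMDiffOn_co.continuousOn.mono (hχ3 i))
    have hD : IsCompact ((fun y => (f y, (B i).co y)) '' tsupport (χ i)) :=
      (hχ2 i).image_of_continuousOn hcf
    have hK : IsCompact ((B i).co '' tsupport (χ i)) :=
      (hχ2 i).image_of_continuousOn ((B i).contMDiffOn_co.continuousOn.mono (hχ3 i))
    have hzero : ∀ x : Q × Eu k, (w x.1, x.2) ∉ (fun y => (f y, (B i).co y)) '' tsupport (χ i) →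
        g i x = 0 := by
      intro x hx
      by_cases hd : (w x.1, x.2) ∈ (B i).dom
      · have : χ i ((B i).pt (w x.1, x.2)) = 0 := by
          by_contra h0
          refine hx ⟨_, subset_tsupport _ h0, ?_⟩
          exact Prod.ext ((B i).f_pt _ hd) ((B i).co_pt _ hd)
        simp [g, this]
      · simp [g, hd]
    refine contMDiffAt_integral_of_compact hW hx₀ hK (fun x z hx hz => ?_) ?_
    · refine hzero _ ?_
      rintro ⟨y, hy, hyz⟩
      exact hz ⟨y, hy, (Prod.ext_iff.1 hyz).2⟩
    · rintro ⟨x, z⟩ ⟨hx, -⟩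
      have hwx : ContMDiffAt (I.prod (𝓡 k)) ((𝓡 n).prod (𝓡 k)) ∞
          (fun x : Q × Eu k => (w x.1, x.2)) (x, z) :=
        (((hw x hx).contMDiffAt (hW.mem_nhds hx)).comp (x, z) contMDiffAt_fst).prodMk contMDiffAt_snd
      apply ContMDiffAt.contMDiffWithinAt
      by_cases hd : (w x, z) ∈ (B i).dom
      · have hO : ∀ᶠ x' : Q × Eu k in 𝓝 (x, z), x'.1 ∈ W ∧ (w x'.1, x'.2) ∈ (B i).dom :=
          (continuousAt_fst.eventually (hW.mem_nhds hx)).and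
            (hwx.continuousAt.eventually ((B i).isOpen_dom.mem_nhds hd))
        have h1 : ContMDiffAt (I.prod (𝓡 k)) 𝓘(ℝ, ℝ) ∞ (fun x : Q × Eu k =>
            lam ((B i).pt (w x.1, x.2))
              (fun j => (B i).slice (w x.1, x.2) (EuclideanSpace.single j 1))) (x, z) :=
          ContMDiffAt.comp (g := fun x : M × Eu k =>
            lam ((B i).pt x) (fun i_1 => (B i).slice x (EuclideanSpace.single i_1 1))) (x, z)
            ((hlam.smooth (B i)).contMDiffAt ((B i).isOpen_dom.mem_nhds hd)) hwx
        have h2 : ContMDiffAt (I.prod (𝓡 k)) (𝓡 (n + k)) ∞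
            (fun x : Q × Eu k => (B i).pt (w x.1, x.2)) (x, z) :=
          ((B i).contMDiffOn_pt.contMDiffAt ((B i).isOpen_dom.mem_nhds hd)).comp (x, z) hwx
        have h3 : ContMDiffAt (I.prod (𝓡 k)) 𝓘(ℝ, ℝ) ∞
            (fun x : Q × Eu k => χ i ((B i).pt (w x.1, x.2))) (x, z) :=
          ContMDiffAt.comp (x, z) (hχ1 i).contMDiffAt h2
        have h4 : ContMDiffAt (I.prod (𝓡 k)) 𝓘(ℝ, V) ∞
            (fun x : Q × Eu k => h ((B i).pt (w x.1, x.2), x.1)) (x, z) := by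
          have h5 := ContMDiffWithinAt.comp
            (s := {x' : Q × Eu k | x'.1 ∈ W ∧ (w x'.1, x'.2) ∈ (B i).dom}) (x, z)
            (g := h) (f := fun x : Q × Eu k => ((B i).pt (w x.1, x.2), x.1))
            (hh ((B i).pt (w x, z), x) ⟨hx, (B i).f_pt _ hd⟩)
            (h2.prodMk contMDiffAt_fst).contMDiffWithinAt
            (fun x' hx' => ⟨hx'.1, (B i).f_pt _ hx'.2⟩)
          exact h5.contMDiffAt hO
        refine (h1.smul (h3.smul h4)).congr_of_eventuallyEq ?_
        filter_upwards [hO] with x' hx'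
        simp only [g, if_pos hx'.2]
        rfl
      -- Outside the domain of the box the point avoids the image of the support of `χ i`. That
      -- image is compact, hence closed, so the extension vanishes in a whole neighbourhood.
      · refine contMDiffAt_const (c := (0 : V)) |>.congr_of_eventuallyEq ?_
        have hnot : (w x, z) ∉ (fun y => (f y, (B i).co y)) '' tsupport (χ i) := by
          rintro ⟨y, hy, hyz⟩
          exact hd (hyz ▸ (B i).mem_dom y (hχ3 i hy))
        filter_upwards [hwx.continuousAt.eventually (hD.isClosed.isOpen_compl.mem_nhds hnot)]
          with x' hx'
        exact hzero _ hx'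
  refine hmain.congr_of_eventuallyEq ?_
  filter_upwards [hW.mem_nhds hx₀] with x hx
  exact hint x hx

variable (I) in
/-- Near each of its points, `S` is the image of a smooth retraction of a neighbourhood. -/
def IsSmoothRetract (S : Set Q) : Prop :=
  ∀ x₀ ∈ S, ∃ (W : Set Q) (R : Q → Q), IsOpen W ∧ x₀ ∈ W ∧ ContMDiffOn I I ∞ R W ∧ MapsTo R W S ∧
    ∀ x ∈ S ∩ W, R x = x

theorem isSmoothRetract_univ : IsSmoothRetract I (univ : Set Q) := fun _ _ =>
  ⟨univ, id, isOpen_univ, mem_univ _, contMDiffOn_id, mapsTo_univ _ _, fun _ _ => rfl⟩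

include hf in
-- Keep x, and slide y along its product coordinates into the fibre over q(x).
theorem isSmoothRetract_fiberProduct {q : Q → M} (hq : ContMDiff I (𝓡 n) ∞ q) :
    IsSmoothRetract (I.prod (𝓡 (n + k))) {x : Q × N | q x.1 = f x.2} := by
  rintro ⟨x₀, y₀⟩ h0
  obtain ⟨B, hB⟩ := exists_box hf y₀
  have h1 : ContMDiffOn (I.prod (𝓡 (n + k))) ((𝓡 n).prod (𝓡 k)) ∞
      (fun x : Q × N => (q x.1, B.co x.2)) (univ ×ˢ B.src) :=
    (hq.comp contMDiff_fst).contMDiffOn.prodMk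
      (B.contMDiffOn_co.comp contMDiffOn_snd (fun x hx => hx.2))
  refine ⟨(univ ×ˢ B.src) ∩ (fun x : Q × N => (q x.1, B.co x.2)) ⁻¹' B.dom,
    fun x => (x.1, B.pt (q x.1, B.co x.2)),
    h1.continuousOn.isOpen_inter_preimage (isOpen_univ.prod B.isOpen_src) B.isOpen_dom,
    ⟨⟨mem_univ _, hB⟩, ?_⟩, contMDiffOn_fst.prodMk
      (B.contMDiffOn_pt.comp (h1.mono inter_subset_left) (fun x hx => hx.2)), ?_, ?_⟩
  · have h2 : q x₀ = f y₀ := h0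
    simp only [mem_preimage, h2]
    exact B.mem_dom _ hB
  · rintro x ⟨-, hx⟩
    exact (B.f_pt _ hx).symm
  · rintro x ⟨hx, hx'⟩
    have h2 : q x.1 = f x.2 := hx
    refine Prod.ext rfl ?_
    simp only [h2]
    exact B.pt_co _ hx'.1.2

include hlam in
/-- The integral over a fibre depends smoothly on the fibre and on parameters. -/
theorem contMDiffOn_integral_fibMeas {S : Set Q} (hS : IsSmoothRetract I S)
    {w : Q → M} (hw : ContMDiffOn I (𝓡 n) ∞ w S) {h : N × Q → V}
    (hh : ContMDiffOn ((𝓡 (n + k)).prod I) 𝓘(ℝ, V) ∞ h {y | y.2 ∈ S ∧ f y.1 = w y.2})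
    (hhC : ∀ x₀ ∈ S, ∃ O ∈ 𝓝 x₀, ∃ C : Set N, IsCompact C ∧
      ∀ x ∈ O ∩ S, ∀ y, f y = w x → h (y, x) ≠ 0 → y ∈ C) :
    ContMDiffOn I 𝓘(ℝ, V) ∞ (fun x => ∫ y, h (y, x) ∂fibMeas hf lam (w x)) S := by
  intro x₀ hx₀
  obtain ⟨W, R, hW, hxW, hR, hRS, hRid⟩ := hS x₀ hx₀
  obtain ⟨O, hO, C, hC, hOC⟩ := hhC x₀ hx₀
  have hR0 : R x₀ = x₀ := hRid x₀ ⟨hx₀, hxW⟩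
  have hO' : ∀ᶠ x in 𝓝 x₀, R x ∈ O := by
    have := (hR.continuousOn.continuousAt (hW.mem_nhds hxW))
    rw [ContinuousAt, hR0] at this
    exact this.eventually hO
  obtain ⟨W', hW'1, hW'2, hW'3⟩ := eventually_nhds_iff.1 (hO'.and (hW.mem_nhds hxW))
  have hRW' : ContMDiffOn I I ∞ R W' := hR.mono fun x hx => (hW'1 x hx).2
  -- Precomposing with the retraction replaces the parameter set `S`, typically a submanifold, by an
  -- open set, without changing anything on `S`.
  have h1 : ContMDiffAt I 𝓘(ℝ, V) ∞ (fun x => ∫ y, h (y, R x) ∂fibMeas hf lam (w (R x))) x₀ := by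
    refine contMDiffAt_integral_fibMeas (h := fun y => h (y.1, R y.2)) hf hlam hW'2 hW'3
      (hw.comp hRW' (fun x hx => hRS (hW'1 x hx).2)) ?_ hC (fun x hx y hy h0 =>
        hOC (R x) ⟨(hW'1 x hx).1, hRS (hW'1 x hx).2⟩ y hy h0)
    refine hh.comp (f := fun y : N × Q => (y.1, R y.2)) (contMDiffOn_fst.prodMk
      (hRW'.comp contMDiffOn_snd (fun y hy => hy.1))) (fun y hy => ⟨hRS (hW'1 _ hy.1).2, hy.2⟩)
  refine h1.contMDiffWithinAt.congr_of_eventuallyEq ?_ (by rw [hR0])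
  filter_upwards [self_mem_nhdsWithin, nhdsWithin_le_nhds (hW.mem_nhds hxW)] with x hx hx'
  rw [hRid x ⟨hx, hx'⟩]

end Parameters

/-! ### Scalar descriptions of densities -/

section DensityRatio

variable {V A : Type*} [AddCommGroup V] [Module ℝ V] [AddCommGroup A] [Module ℂ A]

theorem exists_combination {k : ℕ} {W : Submodule ℝ V} (hW : Module.finrank ℝ W = k)
    {e : Fin k → V} (he : LinearIndependent ℝ e) (heW : ∀ i, e i ∈ W) {v : Fin k → V}
    (hv : ∀ i, v i ∈ W) : ∃ B : Matrix (Fin k) (Fin k) ℝ, ∀ i, v i = ∑ j, B i j • e j := by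
  -- The case k = 0 is separate because `finrank` 0 does not imply finite dimension.
  rcases Nat.eq_zero_or_pos k with rfl | hk
  · exact ⟨0, fun i => i.elim0⟩
  have hfin : FiniteDimensional ℝ W := Module.finite_of_finrank_pos (hW ▸ hk)
  have he' : LinearIndependent ℝ (fun i => (⟨e i, heW i⟩ : W)) :=
    LinearIndependent.of_comp W.subtype he
  have : Nonempty (Fin k) := ⟨⟨0, hk⟩⟩
  let b := basisOfLinearIndependentOfCardEqFinrank he' (by simp [hW])
  refine ⟨fun i j => b.repr ⟨v i, hv i⟩ j, fun i => ?_⟩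
  have h := congrArg W.subtype (b.sum_repr ⟨v i, hv i⟩)
  simp only [map_sum, map_smul] at h
  simpa [b] using h.symm

/-- Densities on a k-dimensional space form a line: both sides scale by the same |det B| when
passing from `e` to `v`. The cross-multiplied form also covers dependent tuples `v`. -/
theorem IsDensity.smul_eq_smul {k : ℕ} {W : Submodule ℝ V} (hW : Module.finrank ℝ W = k)
    {θ : (Fin k → V) → A} (hθ : IsDensity W θ) {μ : (Fin k → V) → ℝ}
    (hμ : ∀ v, (∀ i, v i ∈ W) → ∀ B : Matrix (Fin k) (Fin k) ℝ,
      μ (fun i => ∑ j, B i j • v j) = |B.det| * μ v)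
    {e : Fin k → V} (he : LinearIndependent ℝ e) (heW : ∀ i, e i ∈ W) {v : Fin k → V}
    (hv : ∀ i, v i ∈ W) : (μ e : ℂ) • θ v = (μ v : ℂ) • θ e := by
  obtain ⟨B, hB⟩ := exists_combination hW he heW hv
  obtain rfl : v = fun i => ∑ j, B i j • e j := funext hB
  rw [hθ.2 e heW, hμ e heW, smul_smul, Complex.ofReal_mul, mul_comm]

theorem exists_independent_tuple {k : ℕ} {W : Submodule ℝ V} (hW : Module.finrank ℝ W = k) :
    ∃ e : Fin k → V, LinearIndependent ℝ e ∧ ∀ i, e i ∈ W := by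
  rcases Nat.eq_zero_or_pos k with rfl | hk
  · exact ⟨fun i => i.elim0, linearIndependent_empty_type, fun i => i.elim0⟩
  have hfin : FiniteDimensional ℝ W := Module.finite_of_finrank_pos (hW ▸ hk)
  let b := Module.finBasisOfFinrankEq ℝ W hW
  exact ⟨fun i => b i, b.linearIndependent.map' W.subtype (by simp), fun i => (b i).2⟩

end DensityRatio

theorem tangentBundle_mk_congr {a : ℕ} {N : Type*} [TopologicalSpace N] [ChartedSpace (Eu a) N]
    [IsManifold (𝓡 a) ∞ N] {x y : N} (h : x = y) (v : Eu a) :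
    (⟨x, v⟩ : TangentBundle (𝓡 a) N) = ⟨y, v⟩ := by
  subst h; rfl

/-- `u` is smooth with compact support. -/
def IsCc {a : ℕ} {N : Type*} [TopologicalSpace N] [ChartedSpace (Eu a) N] (u : N → ℂ) : Prop :=
  ContMDiff (𝓡 a) 𝓘(ℝ, ℂ) ∞ u ∧ HasCompactSupport u

theorem finrank_eq_of_range {k : ℕ} {V : Type*} [AddCommGroup V] [Module ℝ V] {W : Submodule ℝ V}
    {T : Eu k →ₗ[ℝ] V} (hT : Function.Injective T) (h : LinearMap.range T = W) :
    Module.finrank ℝ W = k := by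
  rw [← h, LinearMap.finrank_range_of_inj hT, finrank_euclideanSpace_fin]

theorem contMDiffOn_cmul {EQ HQ Q : Type*} [NormedAddCommGroup EQ] [NormedSpace ℝ EQ]
    [TopologicalSpace HQ] {I : ModelWithCorners ℝ EQ HQ} [TopologicalSpace Q] [ChartedSpace HQ Q]
    {u v : Q → ℂ} {S : Set Q} (hu : ContMDiffOn I 𝓘(ℝ, ℂ) ∞ u S)
    (hv : ContMDiffOn I 𝓘(ℝ, ℂ) ∞ v S) : ContMDiffOn I 𝓘(ℝ, ℂ) ∞ (fun x => u x * v x) S :=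
  (contDiff_mul (𝕜 := ℝ) (𝔸 := ℂ) (n := ∞)).contMDiff.comp_contMDiffOn (hu.prodMk_space hv)

/-! ### The range fibres of a foliation groupoid, and scalar coefficients of leafwise densities. -/

namespace LieGroupoid

variable {n k : ℕ} {M G : Type*} [TopologicalSpace M] [ChartedSpace (Eu n) M]
  [IsManifold (𝓡 n) ∞ M] [T2Space M] [SecondCountableTopology M]
  [TopologicalSpace G] [ChartedSpace (Eu (n + k)) G] [IsManifold (𝓡 (n + k)) ∞ G]
  [T2Space G] [SecondCountableTopology G] (𝒢 : LieGroupoid n k M G)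

/-- The left translation by `g` identifies the tangent spaces of `G^{s(g)}` at the unit and of
`G^{r(g)}` at `g`, compatibly with the source maps. -/
theorem exists_translation (h𝒢 : 𝒢.IsFoliationGroupoid) (g : G) :
    ∃ T S : Eu k →L[ℝ] Eu (n + k),
      Function.Injective T ∧ LinearMap.range T.toLinearMap = vertical (a := n + k) (b := n) 𝒢.rng g ∧
      Function.Injective S ∧
      LinearMap.range S.toLinearMap =
        vertical (a := n + k) (b := n) 𝒢.rng (𝒢.unit (𝒢.src g)) ∧
      (∀ w, tder (a := n + k) (b := n) 𝒢.src g (T w) =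
        tder (a := n + k) (b := n) 𝒢.src (𝒢.unit (𝒢.src g)) (S w)) ∧
      ∀ w, tder (a := n + k) (b := n) 𝒢.src g (T w) = 0 → w = 0 := by
  set u := 𝒢.unit (𝒢.src g) with hu
  obtain ⟨B, hB⟩ := exists_box 𝒢.submersion_rng u
  have hru : 𝒢.rng u = 𝒢.src g := 𝒢.rng_unit _
  set z₀ := B.co u
  have hd : (𝒢.src g, z₀) ∈ B.dom := by have := B.mem_dom u hB; rwa [hru] at this
  have hpt : B.pt (𝒢.src g, z₀) = u := by have := B.pt_co u hB; rwa [hru] at this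
  have hO := B.isOpen_fdom (𝒢.src g)
  set c : Eu k → G := fun z => 𝒢.mul g (B.pt (𝒢.src g, z)) with hc
  have hcomp : ∀ z ∈ B.fdom (𝒢.src g), 𝒢.src g = 𝒢.rng (B.pt (𝒢.src g, z)) := fun z hz =>
    (B.f_pt _ hz).symm
  have hcs : ContMDiffOn (𝓡 k) (𝓡 (n + k)) ∞ c (B.fdom (𝒢.src g)) :=
    𝒢.contMDiffOn_mul.comp (contMDiffOn_const.prodMk (B.contMDiffOn_slice _)) hcomp
  have hc0 : c z₀ = g := by rw [hc]; simp only; rw [hpt, hu, 𝒢.mul_unit]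
  have hcd : MDifferentiableAt (𝓡 k) (𝓡 (n + k)) c z₀ :=
    (hcs.contMDiffAt (hO.mem_nhds hd)).mdifferentiableAt (by simp)
  let S := B.slice (𝒢.src g, z₀)
  let T : Eu k →L[ℝ] Eu (n + k) := tder (a := k) (b := n + k) c z₀
  have hSinj : Function.Injective S := B.slice_injective hd
  have hSr : LinearMap.range S.toLinearMap = vertical (a := n + k) (b := n) 𝒢.rng u := by
    apply le_antisymm
    · rintro _ ⟨w, rfl⟩
      have := B.slice_mem_vertical 𝒢.submersion_rng hd w
      rwa [hpt] at this
    · intro v hv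
      have := B.slice_tder_co 𝒢.submersion_rng hB hv
      rw [hru] at this
      exact ⟨_, this⟩
  -- Since s(gh) = s(h), left translation does not change the source. Injectivity of ds at the units
  -- thus spreads to every arrow.
  have hsrc : ∀ w, tder (a := n + k) (b := n) 𝒢.src g (T w) =
      tder (a := n + k) (b := n) 𝒢.src u (S w) := by
    intro w
    have h1 := mfderiv_comp (I := 𝓡 k) (I' := 𝓡 (n + k)) (I'' := 𝓡 n) z₀ (g := 𝒢.src) (f := c)
      ((𝒢.submersion_src.contMDiff _).mdifferentiableAt (by simp)) hcd
    have h2 := mfderiv_comp (I := 𝓡 k) (I' := 𝓡 (n + k)) (I'' := 𝓡 n) z₀ (g := 𝒢.src)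
      (f := fun z => B.pt (𝒢.src g, z))
      ((𝒢.submersion_src.contMDiff _).mdifferentiableAt (by simp)) (B.mdifferentiableAt_slice hd)
    have h3 : 𝒢.src ∘ c =ᶠ[𝓝 z₀] 𝒢.src ∘ fun z => B.pt (𝒢.src g, z) := by
      filter_upwards [hO.mem_nhds hd] with z hz
      exact 𝒢.src_mul _ _ (hcomp z hz)
    have h4 := h3.mfderiv_eq (I := 𝓡 k) (I' := 𝓡 n)
    have h5 : tder (a := n + k) (b := n) 𝒢.src (c z₀) (T w) =
        tder (a := n + k) (b := n) 𝒢.src (B.pt (𝒢.src g, z₀)) (S w) := by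
      have e1 := DFunLike.congr_fun h1 w
      have e2 := DFunLike.congr_fun h2 w
      have e3 : (mfderiv (𝓡 k) (𝓡 n) (𝒢.src ∘ c) z₀ : Eu k →L[ℝ] Eu n) w =
        (mfderiv (𝓡 k) (𝓡 n) (𝒢.src ∘ fun z => B.pt (𝒢.src g, z)) z₀ : Eu k →L[ℝ] Eu n) w :=
        congrArg (fun L : Eu k →L[ℝ] Eu n => L w) h4
      exact e1.symm.trans (e3.trans e2)
    rwa [hc0, hpt] at h5
  have hT0 : ∀ w, tder (a := n + k) (b := n) 𝒢.src g (T w) = 0 → w = 0 := by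
    intro w hw
    rw [hsrc] at hw
    have hSw : S w ∈ vertical (a := n + k) (b := n) 𝒢.rng u := by rw [← hSr]; exact ⟨w, rfl⟩
    have := h𝒢 (𝒢.src g) (S w) hSw hw
    exact hSinj (by rw [this, map_zero])
  have hTinj : Function.Injective T := by
    refine (injective_iff_map_eq_zero T).2 fun w hw => hT0 w ?_
    rw [hw, map_zero]
  have hTv : LinearMap.range T.toLinearMap ≤ vertical (a := n + k) (b := n) 𝒢.rng g := by
    rintro _ ⟨w, rfl⟩
    have h1 := mfderiv_comp (I := 𝓡 k) (I' := 𝓡 (n + k)) (I'' := 𝓡 n) z₀ (g := 𝒢.rng) (f := c)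
      ((𝒢.submersion_rng.contMDiff _).mdifferentiableAt (by simp)) hcd
    have h3 : 𝒢.rng ∘ c =ᶠ[𝓝 z₀] fun _ => 𝒢.rng g := by
      filter_upwards [hO.mem_nhds hd] with z hz
      exact 𝒢.rng_mul _ _ (hcomp z hz)
    have h4 := h3.mfderiv_eq (I := 𝓡 k) (I' := 𝓡 n)
    have h5 : tder (a := n + k) (b := n) 𝒢.rng (c z₀) (T w) = 0 := by
      have e1 := DFunLike.congr_fun h1 w
      have e3 : (mfderiv (𝓡 k) (𝓡 n) (𝒢.rng ∘ c) z₀ : Eu k →L[ℝ] Eu n) w =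
        (mfderiv (𝓡 k) (𝓡 n) (fun _ : Eu k => 𝒢.rng g) z₀ : Eu k →L[ℝ] Eu n) w :=
        congrArg (fun L : Eu k →L[ℝ] Eu n => L w) h4
      refine e1.symm.trans (e3.trans ?_)
      rw [mfderiv_const]; rfl
    rw [hc0] at h5
    exact h5
  refine ⟨T, S, hTinj, ?_, hSinj, hSr, hsrc, hT0⟩
  -- Both spaces have dimension k.
  refine Submodule.eq_of_le_of_finrank_eq hTv ?_
  rw [finrank_vertical 𝒢.submersion_rng, LinearMap.finrank_range_of_inj hTinj,
    finrank_euclideanSpace_fin]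

theorem tder_src_injective (h𝒢 : 𝒢.IsFoliationGroupoid) {g : G} {v : Eu (n + k)}
    (hv : v ∈ vertical (a := n + k) (b := n) 𝒢.rng g)
    (h0 : tder (a := n + k) (b := n) 𝒢.src g v = 0) : v = 0 := by
  obtain ⟨T, S, -, hT, -, -, -, h⟩ := 𝒢.exists_translation h𝒢 g
  rw [← hT] at hv
  obtain ⟨w, rfl⟩ := hv
  rw [show w = 0 from h w h0, map_zero]

theorem map_vertical_eq (h𝒢 : 𝒢.IsFoliationGroupoid) (g : G) :
    (vertical (a := n + k) (b := n) 𝒢.rng g).map (tder (a := n + k) (b := n) 𝒢.src g).toLinearMap =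
      𝒢.leafTangent (𝒢.src g) := by
  obtain ⟨T, S, -, hT, -, hS, hTS, -⟩ := 𝒢.exists_translation h𝒢 g
  rw [leafTangent, ← hT, ← hS, ← LinearMap.range_comp]
  have : (tder (a := n + k) (b := n) 𝒢.src g).toLinearMap ∘ₗ T.toLinearMap =
      (tder (a := n + k) (b := n) 𝒢.src (𝒢.unit (𝒢.src g))).toLinearMap ∘ₗ S.toLinearMap :=
    LinearMap.ext hTS
  rw [this, LinearMap.range_comp]

theorem tder_src_mem (h𝒢 : 𝒢.IsFoliationGroupoid) {g : G} {v : Eu (n + k)}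
    (hv : v ∈ vertical (a := n + k) (b := n) 𝒢.rng g) :
    tder (a := n + k) (b := n) 𝒢.src g v ∈ 𝒢.leafTangent (𝒢.src g) := by
  rw [← 𝒢.map_vertical_eq h𝒢]
  exact ⟨v, hv, rfl⟩

theorem tder_src_linearIndependent (h𝒢 : 𝒢.IsFoliationGroupoid) {g : G} {ι : Type*}
    {v : ι → Eu (n + k)}
    (hv : ∀ i, v i ∈ vertical (a := n + k) (b := n) 𝒢.rng g) (hlin : LinearIndependent ℝ v) :
    LinearIndependent ℝ (fun i => tder (a := n + k) (b := n) 𝒢.src g (v i)) := by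
  refine hlin.map (f := (tder (a := n + k) (b := n) 𝒢.src g).toLinearMap) ?_
  rw [Submodule.disjoint_def]
  intro x hx hx0
  refine 𝒢.tder_src_injective h𝒢 (Submodule.span_le.2 ?_ hx) hx0
  rintro _ ⟨i, rfl⟩
  exact hv i

theorem finrank_leafTangent (h𝒢 : 𝒢.IsFoliationGroupoid) (m : M) :
    Module.finrank ℝ (𝒢.leafTangent m) = k := by
  obtain ⟨T, S, -, hT, -, hS, hTS, h0⟩ := 𝒢.exists_translation h𝒢 (𝒢.unit m)
  have h1 := 𝒢.map_vertical_eq h𝒢 (𝒢.unit m)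
  rw [𝒢.src_unit, ← hT, ← LinearMap.range_comp] at h1
  exact finrank_eq_of_range ((injective_iff_map_eq_zero _).2 h0) h1

/-- Restrict a local frame of ker dr to the units and apply ds: it remains independent by the
foliation hypothesis and spans the leafwise directions. -/
theorem exists_leaf_frame (h𝒢 : 𝒢.IsFoliationGroupoid) (m : M) :
    ∃ (U : Set M) (X : M → Fin k → Eu n), IsOpen U ∧ m ∈ U ∧ IsSmoothFrameOn 𝒢.leafTangent U X := by
  obtain ⟨U, Y, hU, hmU, hY⟩ := exists_vertical_frame 𝒢.submersion_rng (𝒢.unit m)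
  refine ⟨𝒢.unit ⁻¹' U, fun m j => tder (a := n + k) (b := n) 𝒢.src (𝒢.unit m) (Y (𝒢.unit m) j),
    hU.preimage 𝒢.contMDiff_unit.continuous, hmU, fun j => ?_, fun m hm => ⟨?_, fun j => ?_⟩⟩
  · have h1 : ContMDiff (𝓡 (n + k)).tangent (𝓡 n).tangent ∞ (tangentMap (𝓡 (n + k)) (𝓡 n) 𝒢.src) :=
      𝒢.submersion_src.contMDiff.contMDiff_tangentMap (by simp)
    have h2 := h1.comp_contMDiffOn ((hY.1 j).comp 𝒢.contMDiff_unit.contMDiffOn (fun m hm => hm))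
    refine h2.congr fun m _ => ?_
    exact tangentBundle_mk_congr (𝒢.src_unit m).symm _
  · exact 𝒢.tder_src_linearIndependent h𝒢 (hY.2 _ hm).2 (hY.2 _ hm).1
  · have := 𝒢.tder_src_mem h𝒢 ((hY.2 _ hm).2 j)
    rwa [𝒢.src_unit] at this

/-- The positive density on the range fibres of `G` which is the pull-back of the leafwise volume by
the source map. -/
def fiberVol (g : G) (v : Fin k → Eu (n + k)) : ℝ :=
  vol (𝒢.src g) (fun i => tder (a := n + k) (b := n) 𝒢.src g (v i))

/-- Positivity is where the foliation hypothesis enters: ds sends an independent vertical tuple to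
an independent one. -/
theorem vertDensity_fiberVol (h𝒢 : 𝒢.IsFoliationGroupoid) :
    VertDensity (n := n) (k := k) 𝒢.rng 𝒢.fiberVol where
  density g v _ B := by
    unfold fiberVol
    simp only [map_sum, map_smul]
    exact vol_combination _ _ _
  pos g v hv hlin := vol_pos _ (𝒢.tder_src_linearIndependent h𝒢 hv hlin)
  smooth B := by
    intro x hx
    have h1 : ContMDiff (𝓡 (n + k)).tangent (𝓡 n).tangent ∞ (tangentMap (𝓡 (n + k)) (𝓡 n) 𝒢.src) :=
      𝒢.submersion_src.contMDiff.contMDiff_tangentMap (by simp)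
    refine contMDiffWithinAt_vol (y := fun x => 𝒢.src (B.pt x))
      (V := fun x i => tder (a := n + k) (b := n) 𝒢.src (B.pt x)
        (B.slice x (EuclideanSpace.single i 1)))
      ((𝒢.submersion_src.contMDiff.comp_contMDiffOn B.contMDiffOn_pt) x hx)
      (fun j => (h1.comp_contMDiffOn (B.contMDiffOn_slice_single j)) x hx) ?_
    refine 𝒢.tder_src_linearIndependent h𝒢
      (fun i => B.slice_mem_vertical 𝒢.submersion_rng hx _) ?_
    exact linearIndependent_map_single (B.slice x).toLinearMap (B.slice_injective hx)

section Sections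

variable {a : ℕ} {N : Type*} [TopologicalSpace N] [ChartedSpace (Eu a) N]

/-- The section of the pull-back of the density bundle with a given coefficient with respect to the
leafwise volume. -/
def density (f : N → M) (u : N → ℂ) (y : N) (v : Fin k → Eu n) : ℂ :=
  open Classical in if ∀ i, v i ∈ 𝒢.leafTangent (f y) then u y * (vol (f y) v : ℂ) else 0

variable {f : N → M} {u : N → ℂ}

theorem density_apply {y : N} {v : Fin k → Eu n} (hv : ∀ i, v i ∈ 𝒢.leafTangent (f y)) :
    𝒢.density f u y v = u y * (vol (f y) v : ℂ) := if_pos hv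

theorem isDensity_density (y : N) : IsDensity (𝒢.leafTangent (f y)) (𝒢.density f u y) := by
  refine ⟨fun v ⟨i, hi⟩ => if_neg fun h => hi (h i), fun v hv B => ?_⟩
  have h : ∀ i, ∑ j, B i j • v j ∈ 𝒢.leafTangent (f y) := fun i =>
    Submodule.sum_mem _ fun j _ => Submodule.smul_mem _ _ (hv j)
  rw [𝒢.density_apply hv, 𝒢.density_apply h, vol_combination]
  push_cast
  rw [smul_eq_mul]; ring

theorem contMDiffOn_vol_frame {U : Set M} {X : M → Fin k → Eu n}
    (hX : IsSmoothFrameOn 𝒢.leafTangent U X) :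
    ContMDiffOn (𝓡 n) 𝓘(ℝ, ℝ) ∞ (fun m => vol m (X m)) U := fun m hm =>
  contMDiffWithinAt_vol contMDiffWithinAt_id (fun j => hX.1 j m hm) (hX.2 m hm).1

theorem density_mem (hf : ContMDiff (𝓡 a) (𝓡 n) ∞ f) (hu : IsCc (a := a) u) :
    𝒢.density f u ∈ 𝒢.densitySections (a := a) f := by
  refine ⟨𝒢.isDensity_density, fun U X hU hX => ?_, ?_⟩
  · have h1 : ContMDiffOn (𝓡 a) 𝓘(ℝ, ℂ) ∞ (fun y => (vol (f y) (X (f y)) : ℂ)) (f ⁻¹' U) :=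
      Complex.ofRealCLM.contMDiff.comp_contMDiffOn
        ((𝒢.contMDiffOn_vol_frame hX).comp hf.contMDiffOn (fun y hy => hy))
    refine (contMDiffOn_cmul hu.1.contMDiffOn h1).congr fun y hy => ?_
    exact 𝒢.density_apply (hX.2 _ hy).2
  · refine hu.2.mono fun y hy => ?_
    contrapose! hy
    simp only [Function.mem_support, not_not] at hy ⊢
    funext v
    simp [density, hy]

/-- The section of the pull-back of the density bundle with a given coefficient with respect to the
leafwise volume. -/
def mkDens (hf : ContMDiff (𝓡 a) (𝓡 n) ∞ f) (u : N → ℂ) (hu : IsCc (a := a) u) :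
    𝒢.densitySections (a := a) f := ⟨𝒢.density f u, 𝒢.density_mem hf hu⟩

/-- The coefficient is the quotient of the section by the leafwise volume on any independent tuple.
The quotient does not depend on the tuple, so its smoothness can be checked with local smooth
frames. -/
theorem exists_scalar (h𝒢 : 𝒢.IsFoliationGroupoid) (hf : ContMDiff (𝓡 a) (𝓡 n) ∞ f)
    (σ : 𝒢.densitySections (a := a) f) :
    ∃ (u : N → ℂ) (_ : IsCc (a := a) u), σ.1 = 𝒢.density f u := by
  -- These tuples need not vary continuously with the point.
  choose e he heW using fun m => exists_independent_tuple (𝒢.finrank_leafTangent h𝒢 m)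
  have hpos : ∀ m, (vol m (e m) : ℂ) ≠ 0 := fun m => by exact_mod_cast (vol_pos m (he m)).ne'
  have key : ∀ y v, (∀ i, v i ∈ 𝒢.leafTangent (f y)) →
      σ.1 y v = σ.1 y (e (f y)) / (vol (f y) (e (f y)) : ℂ) * (vol (f y) v : ℂ) := by
    intro y v hv
    have := (σ.2.1 y).smul_eq_smul (𝒢.finrank_leafTangent h𝒢 _)
      (fun v _ B => vol_combination (f y) v B) (he _) (heW _) hv
    simp only [smul_eq_mul] at this
    field_simp [hpos (f y)]
    rw [mul_comm, this, mul_comm]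
  refine ⟨fun y => σ.1 y (e (f y)) / (vol (f y) (e (f y)) : ℂ), ⟨fun y => ?_, ?_⟩, ?_⟩
  · obtain ⟨U, X, hU, hyU, hX⟩ := 𝒢.exists_leaf_frame h𝒢 (f y)
    have hU' : IsOpen (f ⁻¹' U) := hU.preimage hf.continuous
    have h1 : ContMDiffOn (𝓡 a) 𝓘(ℝ, ℝ) ∞ (fun y => (vol (f y) (X (f y)))) (f ⁻¹' U) :=
        ((𝒢.contMDiffOn_vol_frame hX).comp hf.contMDiffOn (fun y hy => hy))
    have h2 : ContMDiffOn (𝓡 a) 𝓘(ℝ, ℝ) ∞ (fun y => (vol (f y) (X (f y)))⁻¹) (f ⁻¹' U) := by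
      intro z hz
      have : ContDiffAt ℝ ∞ (fun x : ℝ => x⁻¹) (vol (f z) (X (f z))) :=
        contDiffAt_inv ℝ (vol_pos _ (hX.2 _ hz).1).ne'
      exact this.contMDiffAt.comp_contMDiffWithinAt z (h1 z hz)
    have h3 := Complex.ofRealCLM.contMDiff.comp_contMDiffOn h2
    have h4 := contMDiffOn_cmul (σ.2.2.1 U X hU hX) h3
    refine (h4.congr fun z hz => ?_).contMDiffAt (hU'.mem_nhds hyU)
    have h5 : (vol (f z) (X (f z)) : ℂ) ≠ 0 := by
      exact_mod_cast (vol_pos (a := n) (f z) (hX.2 _ hz).1).ne'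
    rw [key z (X (f z)) (hX.2 _ hz).2]
    simp only [Function.comp_apply, Complex.ofRealCLM_apply, Complex.ofReal_inv]
    field_simp
  · refine σ.2.2.2.mono fun y hy => ?_
    contrapose! hy
    simp only [Function.mem_support, not_not] at hy ⊢
    simp [hy]
  · funext y v
    by_cases hv : ∀ i, v i ∈ 𝒢.leafTangent (f y)
    · rw [𝒢.density_apply hv, key y v hv]
    · rw [density, if_neg hv]
      push Not at hv
      exact (σ.2.1 y).1 v hv

end Sections

end LieGroupoid

/-! ### Convolution in terms of coefficients -/

section Cutoff

variable {a : ℕ} {N : Type*} [TopologicalSpace N] [ChartedSpace (Eu a) N] [IsManifold (𝓡 a) ∞ N]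

theorem exists_cutoff [T2Space N] [SecondCountableTopology N] {K U : Set N} (hK : IsCompact K)
    (hU : IsOpen U) (hKU : K ⊆ U) : ∃ χ : N → ℝ, ContMDiff (𝓡 a) 𝓘(ℝ, ℝ) ∞ χ ∧
      HasCompactSupport χ ∧ tsupport χ ⊆ U ∧ (∀ x ∈ K, χ x = 1) ∧ ∀ x, 0 ≤ χ x := by
  have hloc := locallyCompactSpace_of_euclidean a N
  obtain ⟨O, h1, h2, h3, h4⟩ := exists_open_between_and_isCompact_closure hK hU hKU
  obtain ⟨χ, hχ0, hχ1, hχ2⟩ := exists_contMDiffMap_zero_one_of_isClosed (n := ⊤) (𝓡 a)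
    h1.isClosed_compl hK.isClosed (disjoint_compl_left_iff_subset.2 h2)
  have hs : tsupport χ ⊆ closure O := closure_mono fun x hx => by
    by_contra h
    exact hx (hχ0 h)
  exact ⟨χ, χ.contMDiff, h4.of_isClosed_subset (isClosed_tsupport _) hs, hs.trans h3,
    fun x hx => hχ1 hx, fun x => (hχ2 x).1⟩

theorem IsCc.ofReal {χ : N → ℝ} (h : ContMDiff (𝓡 a) 𝓘(ℝ, ℝ) ∞ χ) (h' : HasCompactSupport χ) :
    IsCc (a := a) (fun x => (χ x : ℂ)) :=
  ⟨Complex.ofRealCLM.contMDiff.comp h, h'.comp_left (g := fun x : ℝ => (x : ℂ)) (by simp)⟩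

end Cutoff

namespace LieGroupoid

variable {n k : ℕ} {M G : Type*} [TopologicalSpace M] [ChartedSpace (Eu n) M]
  [IsManifold (𝓡 n) ∞ M] [T2Space M] [SecondCountableTopology M]
  [TopologicalSpace G] [ChartedSpace (Eu (n + k)) G] [IsManifold (𝓡 (n + k)) ∞ G]
  [T2Space G] [SecondCountableTopology G] (𝒢 : LieGroupoid n k M G)

theorem inv_inv (g : G) : 𝒢.inv (𝒢.inv g) = g := by
  have h1 := 𝒢.mul_unit (𝒢.inv (𝒢.inv g))
  rw [𝒢.src_inv, 𝒢.rng_inv, ← 𝒢.inv_mul g, ← 𝒢.mul_assoc _ _ _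
    (by rw [𝒢.src_inv]) (by rw [𝒢.src_inv]), 𝒢.inv_mul, 𝒢.src_inv, 𝒢.unit_mul] at h1
  exact h1.symm

theorem continuous_src : Continuous 𝒢.src := 𝒢.submersion_src.contMDiff.continuous

theorem continuous_rng : Continuous 𝒢.rng := 𝒢.submersion_rng.contMDiff.continuous

theorem mul_inv_mul {g g' : G} (h : 𝒢.rng g' = 𝒢.rng g) :
    𝒢.mul g' (𝒢.mul (𝒢.inv g') g) = g := by
  rw [← 𝒢.mul_assoc _ _ _ (by rw [𝒢.rng_inv]) (by rw [𝒢.src_inv, h]), 𝒢.mul_inv, h, 𝒢.unit_mul]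

variable [MeasurableSpace G] [BorelSpace G]

/-- The measure on `G^m` given by the leafwise volume. -/
abbrev haar (m : M) : Measure G := fibMeas 𝒢.submersion_rng 𝒢.fiberVol m

/-- The convolution of coefficients. -/
def conv (u₁ u₂ : G → ℂ) (g : G) : ℂ := ∫ g', u₁ g' * u₂ (𝒢.mul (𝒢.inv g') g) ∂𝒢.haar (𝒢.rng g)

variable (h𝒢 : 𝒢.IsFoliationGroupoid)

theorem contMDiffOn_conv_integrand {u₁ u₂ : G → ℂ} (h₁ : IsCc (a := n + k) u₁)
    (h₂ : IsCc (a := n + k) u₂) :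
    ContMDiffOn ((𝓡 (n + k)).prod (𝓡 (n + k))) 𝓘(ℝ, ℂ) ∞
      (fun y : G × G => u₁ y.1 * u₂ (𝒢.mul (𝒢.inv y.1) y.2)) {y | 𝒢.rng y.1 = 𝒢.rng y.2} := by
  refine contMDiffOn_cmul (h₁.1.comp contMDiff_fst).contMDiffOn
    (h₂.1.comp_contMDiffOn (𝒢.contMDiffOn_mul.comp
      ((𝒢.contMDiff_inv.comp contMDiff_fst).prodMk contMDiff_snd).contMDiffOn ?_))
  intro y hy
  simpa [𝒢.src_inv] using hy

include h𝒢

/-- Smoothness is that of a fibre integral with parameter g. The support lies in the set of products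
of composable pairs from the two supports, which is compact. -/
theorem isCc_conv {u₁ u₂ : G → ℂ} (h₁ : IsCc (a := n + k) u₁) (h₂ : IsCc (a := n + k) u₂) :
    IsCc (a := n + k) (𝒢.conv u₁ u₂) := by
  constructor
  · rw [← contMDiffOn_univ]
    refine contMDiffOn_integral_fibMeas (I := 𝓡 (n + k)) 𝒢.submersion_rng
      (𝒢.vertDensity_fiberVol h𝒢) isSmoothRetract_univ
      𝒢.submersion_rng.contMDiff.contMDiffOn
      ((𝒢.contMDiffOn_conv_integrand h₁ h₂).mono fun y hy => hy.2) fun x₀ _ =>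
      ⟨univ, Filter.univ_mem, tsupport u₁, h₁.2, fun x _ y _ hy => subset_tsupport _ fun h => hy ?_⟩
    simp [h]
  · have hK : IsCompact ((tsupport u₁ ×ˢ tsupport u₂) ∩ {x : G × G | 𝒢.src x.1 = 𝒢.rng x.2}) :=
      (h₁.2.isCompact.prod h₂.2.isCompact).inter_right
        (isClosed_eq (𝒢.continuous_src.comp continuous_fst) (𝒢.continuous_rng.comp continuous_snd))
    refine HasCompactSupport.intro
      (hK.image_of_continuousOn (𝒢.contMDiffOn_mul.continuousOn.mono inter_subset_right)) fun g hg => ?_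
    rw [conv]
    refine integral_eq_zero_of_ae ?_
    filter_upwards [ae_fibMeas (lam := 𝒢.fiberVol) (m := 𝒢.rng g) 𝒢.submersion_rng] with g' hg'
    by_contra h
    refine hg ⟨(g', 𝒢.mul (𝒢.inv g') g), ⟨⟨subset_tsupport _ (left_ne_zero_of_mul h),
      subset_tsupport _ (right_ne_zero_of_mul h)⟩, ?_⟩, 𝒢.mul_inv_mul hg'⟩
    simp only [mem_ofPred_eq]
    rw [𝒢.rng_mul _ _ (by rw [𝒢.src_inv, hg']), 𝒢.rng_inv]

theorem isConv_mkDens {u₁ u₂ : G → ℂ} (h₁ : IsCc (a := n + k) u₁) (h₂ : IsCc (a := n + k) u₂) :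
    𝒢.IsConv (𝒢.mkDens 𝒢.submersion_src.contMDiff u₁ h₁) (𝒢.mkDens 𝒢.submersion_src.contMDiff u₂ h₂)
      (𝒢.mkDens 𝒢.submersion_src.contMDiff _ (𝒢.isCc_conv h𝒢 h₁ h₂)) := by
  intro g w
  -- Since s(g'⁻¹g) = s(g), the density part of the second factor is the same for all g' and leaves
  -- the integral as a constant.
  set W : ℂ := open Classical in if ∀ i, w i ∈ 𝒢.leafTangent (𝒢.src g) then
    (vol (𝒢.src g) w : ℂ) else 0 with hW
  have hdens : ∀ (u : G → ℂ) g', 𝒢.src g' = 𝒢.src g → 𝒢.density 𝒢.src u g' w = u g' * W := by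
    intro u g' hg'
    rw [density, hW, hg']
    split_ifs <;> simp
  have hsub : MapsTo (fun y : G => (y, g)) (𝒢.rng ⁻¹' {𝒢.rng g}) {y | 𝒢.rng y.1 = 𝒢.rng y.2} :=
    fun y hy => hy
  refine (hasFiberIntegral_iff 𝒢.submersion_rng (𝒢.vertDensity_fiberVol h𝒢)
    (g := fun g' => (u₁ g' * u₂ (𝒢.mul (𝒢.inv g') g)) * W) ?_ ?_ h₁.2 ?_).2 ?_
  · intro g' hg' v hv
    simp only [mkDens]
    rw [𝒢.density_apply fun i => 𝒢.tder_src_mem h𝒢 (hv i), hdens _ _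
      (𝒢.src_mul _ _ (by rw [𝒢.src_inv, hg'])), fiberVol]
    ring
  · exact ((𝒢.contMDiffOn_conv_integrand h₁ h₂).continuousOn.comp (by fun_prop) hsub).mul
      continuousOn_const
  · intro y _ hy
    exact subset_tsupport _ (left_ne_zero_of_mul (left_ne_zero_of_mul hy))
  · rw [integral_mul_const]
    exact hdens _ g rfl

/-- A trace is invariant under the inversion of `G`. -/
theorem trace_inv {ρ : 𝒢.LeafDensities →ₗ[ℂ] ℂ} (hρ : 𝒢.IsTrace (ρ ∘ₗ 𝒢.restrictUnits))
    {c : G → ℂ} (hc : IsCc (a := n + k) c) {u u' : M → ℂ} (hu : IsCc (a := n) u)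
    (hu' : IsCc (a := n) u') (h : ∀ m, u m = ∫ g, c g ∂𝒢.haar m)
    (h' : ∀ m, u' m = ∫ g, c (𝒢.inv g) ∂𝒢.haar m) :
    ρ (𝒢.mkDens contMDiff_id u hu) = ρ (𝒢.mkDens contMDiff_id u' hu') := by
  -- The cutoff χ acts as a unit in the two products below: evaluated at a unit, they involve χ only
  -- at points where the other factor, at the inverse arrow, is nonzero, and there χ = 1.
  obtain ⟨χ, hχ, hχc, -, hχ1, -⟩ := exists_cutoff (a := n + k)
    (hc.2.isCompact.image 𝒢.contMDiff_inv.continuous) isOpen_univ (subset_univ _)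
  have hχ' := IsCc.ofReal hχ hχc
  have key : ∀ g, c g * (χ (𝒢.inv g) : ℂ) = c g := by
    intro g
    by_cases hg : c g = 0
    · simp [hg]
    · rw [hχ1 _ ⟨g, subset_tsupport _ hg, rfl⟩]; simp
  have hres : ∀ (w : G → ℂ) (hw : IsCc (a := n + k) w) (w' : M → ℂ) (hw' : IsCc (a := n) w'),
      (∀ m, w' m = w (𝒢.unit m)) →
      𝒢.restrictUnits (𝒢.mkDens 𝒢.submersion_src.contMDiff w hw) = 𝒢.mkDens contMDiff_id w' hw' := by
    intro w hw w' hw' hww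
    refine Subtype.ext (funext fun m => funext fun v => ?_)
    simp only [restrictUnits, mkDens, LinearMap.coe_mk, AddHom.coe_mk, density, hww, 𝒢.src_unit, id]
    classical
    exact if_congr (by rw [𝒢.src_unit]) rfl rfl
  have h1 := hρ _ _ _ _ (𝒢.isConv_mkDens h𝒢 hc hχ') (𝒢.isConv_mkDens h𝒢 hχ' hc)
  simp only [LinearMap.comp_apply] at h1
  have hmu : ∀ m g, 𝒢.rng g = m → 𝒢.mul (𝒢.inv g) (𝒢.unit m) = 𝒢.inv g := by
    rintro m g rfl
    have := 𝒢.mul_unit (𝒢.inv g)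
    rwa [𝒢.src_inv] at this
  rw [hres _ _ u hu, hres _ _ u' hu'] at h1
  · exact h1
  · intro m
    rw [h' m, conv, 𝒢.rng_unit]
    refine integral_congr_ae ?_
    filter_upwards [ae_fibMeas (lam := 𝒢.fiberVol) (m := m) 𝒢.submersion_rng] with g hg
    have := key (𝒢.inv g)
    rw [𝒢.inv_inv] at this
    rw [hmu m g hg, mul_comm, this]
  · intro m
    rw [h m, conv, 𝒢.rng_unit]
    refine integral_congr_ae ?_
    filter_upwards [ae_fibMeas (lam := 𝒢.fiberVol) (m := m) 𝒢.submersion_rng] with g hg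
    rw [hmu m g hg, key]

end LieGroupoid

/-! ### The action on the fibres of a `G`-manifold -/

namespace GManifold

variable {n k d : ℕ} {M G P : Type*} [TopologicalSpace M] [ChartedSpace (Eu n) M]
  [IsManifold (𝓡 n) ∞ M] [T2Space M] [SecondCountableTopology M]
  [TopologicalSpace G] [ChartedSpace (Eu (n + k)) G] [IsManifold (𝓡 (n + k)) ∞ G]
  [T2Space G] [SecondCountableTopology G] {𝒢 : LieGroupoid n k M G}
  [TopologicalSpace P] [ChartedSpace (Eu (n + d)) P] [IsManifold (𝓡 (n + d)) ∞ P]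
  [T2Space P] [SecondCountableTopology P] (𝒬 : GManifold 𝒢 d P)

theorem continuous_proj : Continuous 𝒬.proj := 𝒬.submersion_proj.contMDiff.continuous

theorem act_inv {p : P} {g : G} (h : 𝒬.proj p = 𝒢.rng g) :
    𝒬.act (𝒬.act p g) (𝒢.inv g) = p := by
  rw [𝒬.act_mul _ _ _ h (by rw [𝒢.rng_inv]), 𝒢.mul_inv, ← h, 𝒬.act_unit]

theorem proj_act_inv {p : P} {g : G} (h : 𝒬.proj p = 𝒢.src g) :
    𝒬.proj (𝒬.act p (𝒢.inv g)) = 𝒢.rng g := by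
  rw [𝒬.proj_act _ _ (by rw [𝒢.rng_inv, h]), 𝒢.src_inv]

theorem act_inv' {p : P} {g : G} (h : 𝒬.proj p = 𝒢.src g) :
    𝒬.act (𝒬.act p (𝒢.inv g)) g = p := by
  have := 𝒬.act_inv (p := p) (g := 𝒢.inv g) (by rw [𝒢.rng_inv, h])
  rwa [𝒢.inv_inv] at this

/-- Properness of the action in the form used throughout: the arrows moving some point of `K` into
`L` form a compact set. -/
theorem isCompact_pairs (hproper : 𝒬.IsProper) {K L : Set P} (hK : IsCompact K) (hL : IsCompact L) :
    IsCompact {x : P × G | 𝒬.proj x.1 = 𝒢.rng x.2 ∧ x.1 ∈ K ∧ 𝒬.act x.1 x.2 ∈ L} := by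
  have h1 := (IsProperMap.isCompact_preimage hproper (hK.prod hL)).image continuous_subtype_val
  convert h1 using 1
  ext x
  constructor
  · rintro ⟨h1, h2, h3⟩
    exact ⟨⟨x, h1⟩, ⟨h2, h3⟩, rfl⟩
  · rintro ⟨y, ⟨h2, h3⟩, rfl⟩
    exact ⟨y.2, h2, h3⟩

theorem contMDiffOn_act_right (g : G) :
    ContMDiffOn (𝓡 (n + d)) (𝓡 (n + d)) ∞ (fun p => 𝒬.act p g) (𝒬.proj ⁻¹' {𝒢.rng g}) :=
  𝒬.contMDiffOn_act.comp (contMDiffOn_id.prodMk contMDiffOn_const) (fun _ hp => hp)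

theorem continuousOn_act_inv (g : G) :
    ContinuousOn (fun p => 𝒬.act p (𝒢.inv g)) (𝒬.proj ⁻¹' {𝒢.src g}) := by
  have := (𝒬.contMDiffOn_act_right (𝒢.inv g)).continuousOn
  rwa [𝒢.rng_inv] at this

variable {𝒬}

/-- The right translation by `g` of a parametrized piece of the fibre over `r(g)`. -/
def translate (g : G) (φ : FiberChart d (n + d) 𝒬.proj (𝒢.rng g)) :
    FiberChart d (n + d) 𝒬.proj (𝒢.src g) where
  toFun x := 𝒬.act (φ.toFun x) g
  source := φ.source
  isOpen_source := φ.isOpen_source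
  contMDiffOn := (𝒬.contMDiffOn_act_right g).comp φ.contMDiffOn φ.maps
  injective_der x hx := by
    have hy : 𝒬.proj (𝒬.act (φ.toFun x) g) = 𝒢.src g := 𝒬.proj_act _ _ (φ.maps x hx)
    obtain ⟨B, hB⟩ := exists_box 𝒬.submersion_proj (𝒬.act (φ.toFun x) g)
    set O : Set P := B.src ∩ B.co ⁻¹' B.fdom (𝒢.src g)
    have hO : IsOpen O :=
      B.contMDiffOn_co.continuousOn.isOpen_inter_preimage B.isOpen_src (B.isOpen_fdom _)
    have hyO : 𝒬.act (φ.toFun x) g ∈ O := by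
      refine ⟨hB, ?_⟩
      have := B.mem_dom _ hB
      rwa [hy] at this
    -- Translation by g and its inverse are defined on single fibres only. Projecting first to the
    -- fibre over s(g) along product coordinates gives a smooth left inverse on an open set, so the
    -- derivative of the translated parametrization is injective.
    set ψ : P → P := fun q => 𝒬.act (B.pt (𝒢.src g, B.co q)) (𝒢.inv g)
    have hψ : ContMDiffOn (𝓡 (n + d)) (𝓡 (n + d)) ∞ ψ O :=
      (𝒬.contMDiffOn_act_right (𝒢.inv g)).comp
        ((B.contMDiffOn_slice (𝒢.src g)).comp (B.contMDiffOn_co.mono inter_subset_left)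
          (fun q hq => hq.2))
        (fun q hq => by
          simp only [mem_preimage, mem_singleton_iff, 𝒢.rng_inv]
          exact B.f_pt _ hq.2)
    have hφ' : ContMDiffOn (𝓡 d) (𝓡 (n + d)) ∞ (fun x => 𝒬.act (φ.toFun x) g) φ.source :=
      (𝒬.contMDiffOn_act_right g).comp φ.contMDiffOn φ.maps
    have hφd := (hφ'.contMDiffAt (φ.isOpen_source.mem_nhds hx))
    have h1 := mfderiv_comp (I := 𝓡 d) (I' := 𝓡 (n + d)) (I'' := 𝓡 (n + d)) x (g := ψ)
      (f := fun x => 𝒬.act (φ.toFun x) g)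
      ((hψ.contMDiffAt (hO.mem_nhds hyO)).mdifferentiableAt (by simp))
      (hφd.mdifferentiableAt (by simp))
    have h3 : ψ ∘ (fun x => 𝒬.act (φ.toFun x) g) =ᶠ[𝓝 x] φ.toFun := by
      filter_upwards [φ.isOpen_source.mem_nhds hx, hφd.continuousAt.preimage_mem_nhds
        (hO.mem_nhds hyO)] with z hz hzO
      have h4 : 𝒬.proj (𝒬.act (φ.toFun z) g) = 𝒢.src g := 𝒬.proj_act _ _ (φ.maps z hz)
      have h5 := B.pt_co _ hzO.1
      rw [h4] at h5
      change 𝒬.act (B.pt (𝒢.src g, B.co _)) (𝒢.inv g) = _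
      rw [h5, 𝒬.act_inv (φ.maps z hz)]
    have h4 := h3.mfderiv_eq (I := 𝓡 d) (I' := 𝓡 (n + d))
    have h6 : ∀ w, tder (a := d) (b := n + d) φ.toFun x w =
        tder (a := n + d) (b := n + d) ψ (𝒬.act (φ.toFun x) g)
          (tder (a := d) (b := n + d) (fun x => 𝒬.act (φ.toFun x) g) x w) := by
      intro w
      have e1 := DFunLike.congr_fun h1 w
      have e3 : (mfderiv (𝓡 d) (𝓡 (n + d)) (ψ ∘ fun x => 𝒬.act (φ.toFun x) g) x :
          Eu d →L[ℝ] Eu (n + d)) w =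
        (mfderiv (𝓡 d) (𝓡 (n + d)) φ.toFun x : Eu d →L[ℝ] Eu (n + d)) w :=
        congrArg (fun L : Eu d →L[ℝ] Eu (n + d) => L w) h4
      exact e3.symm.trans e1
    intro v w hvw
    refine φ.injective_der x hx ?_
    rw [h6, h6, hvw]
  injOn x hx y hy hxy := by
    refine φ.injOn hx hy ?_
    rw [← 𝒬.act_inv (φ.maps x hx), ← 𝒬.act_inv (φ.maps y hy)]
    exact congrArg (fun q => 𝒬.act q (𝒢.inv g)) hxy
  maps x hx := 𝒬.proj_act _ _ (φ.maps x hx)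
  open_map O hO hO' := by
    obtain ⟨W, hW, h⟩ := φ.open_map O hO hO'
    obtain ⟨U, hU, h'⟩ := continuousOn_iff'.1 (𝒬.continuousOn_act_inv g) W hW
    refine ⟨U, hU, ?_⟩
    rw [← h']
    ext y
    constructor
    · rintro ⟨x, hx, rfl⟩
      refine ⟨?_, 𝒬.proj_act _ _ (φ.maps x (hO hx))⟩
      simp only [mem_preimage]
      rw [𝒬.act_inv (φ.maps x (hO hx))]
      exact (h.subset ⟨x, hx, rfl⟩).1
    · rintro ⟨hy1, hy2⟩
      obtain ⟨x, hx, hxy⟩ := h.superset ⟨hy1, 𝒬.proj_act_inv hy2⟩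
      refine ⟨x, hx, ?_⟩
      simp only
      rw [hxy, 𝒬.act_inv' hy2]

/-- The translate of `φ` is the translate of the box chart precomposed with the same coordinate
change, so both velocity frames transform by one Jacobian matrix. -/
theorem tder_translate (g : G) (φ : FiberChart d (n + d) 𝒬.proj (𝒢.rng g)) (B : FBox n d 𝒬.proj)
    {x : Eu d} (hx : x ∈ φ.source) (hx' : φ.toFun x ∈ B.src) (w : Eu d) :
    tder (a := d) (b := n + d) (translate g φ).toFun x w =
      tder (a := d) (b := n + d) (translate g (B.chart (𝒢.rng g))).toFun (φ.trans B x) (fderiv ℝ (φ.trans B) x w) := by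
  have hT := φ.hasFDerivAt_trans B hx hx'
  have hd : φ.trans B x ∈ (B.chart (𝒢.rng g)).source := φ.trans_mem B hx hx'
  have hO := (φ.isOpen_preimage_src B).mem_nhds ⟨hx, hx'⟩
  have h1 := mfderiv_comp (I := 𝓡 d) (I' := 𝓡 d) (I'' := 𝓡 (n + d)) x
    (g := (translate g (B.chart (𝒢.rng g))).toFun) (f := φ.trans B)
    (((translate g (B.chart (𝒢.rng g))).contMDiffAt hd).mdifferentiableAt (by simp))
    hT.differentiableAt.mdifferentiableAt
  have h3 : (translate g (B.chart (𝒢.rng g))).toFun ∘ φ.trans B =ᶠ[𝓝 x] (translate g φ).toFun := by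
    filter_upwards [hO] with z hz
    have : B.pt (𝒢.rng g, φ.trans B z) = φ.toFun z := φ.pt_trans B hz.1 hz.2
    exact congrArg (fun q => 𝒬.act q g) this
  have h4 := h3.mfderiv_eq (I := 𝓡 d) (I' := 𝓡 (n + d))
  have e1 := DFunLike.congr_fun h1 w
  have e3 : (mfderiv (𝓡 d) (𝓡 (n + d)) ((translate g (B.chart (𝒢.rng g))).toFun ∘ φ.trans B) x :
      Eu d →L[ℝ] Eu (n + d)) w =
    (mfderiv (𝓡 d) (𝓡 (n + d)) (translate g φ).toFun x : Eu d →L[ℝ] Eu (n + d)) w :=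
    congrArg (fun L : Eu d →L[ℝ] Eu (n + d) => L w) h4
  refine e3.symm.trans (e1.trans ?_)
  rw [mfderiv_eq_fderiv]
  rfl

variable {lam : P → (Fin d → Eu (n + d)) → ℝ} 

theorem dens_translate (hlam : VertDensity (n := n) 𝒬.proj lam) (g : G)
    (φ : FiberChart d (n + d) 𝒬.proj (𝒢.rng g)) (B : FBox n d 𝒬.proj)
    {x : Eu d} (hx : x ∈ φ.source) (hx' : φ.toFun x ∈ B.src) :
    (translate g φ).dens lam x = |(fderiv ℝ (φ.trans B) x).det| *
      (translate g (B.chart (𝒢.rng g))).dens lam (φ.trans B x) := by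
  set ψ := translate g (B.chart (𝒢.rng g)) with hψ
  have hd : φ.trans B x ∈ ψ.source := φ.trans_mem B hx hx'
  have hpt : (translate g φ).toFun x = ψ.toFun (φ.trans B x) :=
    congrArg (fun q => 𝒬.act q g) (φ.pt_trans B hx hx').symm
  have h1 := hlam.density (ψ.toFun (φ.trans B x))
    (fun j => tder ψ.toFun (φ.trans B x) (EuclideanSpace.single j 1))
    (fun j => ψ.tder_mem_vertical 𝒬.submersion_proj.contMDiff hd _)
    (Matrix.of fun j i => (fderiv ℝ (φ.trans B) x (EuclideanSpace.single j 1)) i)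
  rw [det_of_single] at h1
  rw [FiberChart.dens, FiberChart.dens, ← h1, hpt]
  congr 1
  funext j
  rw [tder_translate g φ B hx hx']
  conv_lhs => rw [sum_smul_single (fderiv ℝ (φ.trans B) x (EuclideanSpace.single j 1))]
  rw [map_sum]
  simp only [map_smul, Matrix.of_apply]
  rfl

variable (𝒬 lam) in
/-- The Jacobian, with respect to given densities, of the right translation by `g`. -/
def jac (g : G) (q : P) : ℝ :=
  let B := (exists_box 𝒬.submersion_proj q).choose
  (translate g (B.chart (𝒢.rng g))).dens lam (B.co q) / (B.chart (𝒢.rng g)).dens lam (B.co q)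

/-- Numerator and denominator of the Jacobian change by the same determinant under
reparametrization. Hence the box chosen in `jac` does not matter. -/
theorem jac_eq (hlam : VertDensity (n := n) 𝒬.proj lam) (g : G)
    (φ : FiberChart d (n + d) 𝒬.proj (𝒢.rng g)) {x : Eu d} (hx : x ∈ φ.source) :
    φ.dens lam x * jac 𝒬 lam g (φ.toFun x) = (translate g φ).dens lam x := by
  unfold jac
  set B := (exists_box 𝒬.submersion_proj (φ.toFun x)).choose
  have hB : φ.toFun x ∈ B.src := (exists_box 𝒬.submersion_proj (φ.toFun x)).choose_spec
  have hd : φ.trans B x ∈ (B.chart (𝒢.rng g)).source := φ.trans_mem B hx hB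
  have hpos := (B.chart (𝒢.rng g)).dens_pos 𝒬.submersion_proj hlam hd
  rw [dens_translate hlam g φ B hx hB, φ.dens_eq B 𝒬.submersion_proj hlam hx hB]
  change _ * (_ / (B.chart (𝒢.rng g)).dens lam (φ.trans B x)) = _
  field_simp
  rfl

theorem jac_pos (hlam : VertDensity (n := n) 𝒬.proj lam) {g : G} {q : P}
    (hq : 𝒬.proj q = 𝒢.rng g) : 0 < jac 𝒬 lam g q := by
  obtain ⟨B, hB⟩ := exists_box 𝒬.submersion_proj q
  have hd := B.mem_dom q hB
  have hp := B.pt_co q hB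
  rw [hq] at hd hp
  have h1 := jac_eq hlam g (B.chart (𝒢.rng g)) (x := B.co q) hd
  rw [show (B.chart (𝒢.rng g)).toFun (B.co q) = q from hp] at h1
  have h2 := (B.chart (𝒢.rng g)).dens_pos 𝒬.submersion_proj hlam (x := B.co q) hd
  have h3 := (translate g (B.chart (𝒢.rng g))).dens_pos 𝒬.submersion_proj hlam (x := B.co q) hd
  rw [← h1] at h3
  exact (mul_pos_iff_of_pos_left h2).1 h3

theorem continuousOn_jac (hlam : VertDensity (n := n) 𝒬.proj lam) (g : G) :
    ContinuousOn (jac 𝒬 lam g) (𝒬.proj ⁻¹' {𝒢.rng g}) := by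
  intro q hq
  obtain ⟨B, hB⟩ := exists_box 𝒬.submersion_proj q
  set φ := B.chart (𝒢.rng g)
  have h1 : ContinuousOn (fun x => (translate g φ).dens lam x / φ.dens lam x) φ.source :=
    ((translate g φ).continuousOn_dens 𝒬.submersion_proj hlam).div
      (φ.continuousOn_dens 𝒬.submersion_proj hlam)
      (fun x hx => (φ.dens_pos 𝒬.submersion_proj hlam hx).ne')
  have hm : ∀ q ∈ B.src ∩ 𝒬.proj ⁻¹' {𝒢.rng g}, B.co q ∈ φ.source := fun q hq => by
    have := B.mem_dom q hq.1
    rwa [show 𝒬.proj q = 𝒢.rng g from hq.2] at this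
  have h2 : ContinuousOn (fun q => (translate g φ).dens lam (B.co q) / φ.dens lam (B.co q))
      (B.src ∩ 𝒬.proj ⁻¹' {𝒢.rng g}) :=
    h1.comp (B.contMDiffOn_co.continuousOn.mono inter_subset_left) hm
  have h3 : ContinuousOn (jac 𝒬 lam g) (B.src ∩ 𝒬.proj ⁻¹' {𝒢.rng g}) := by
    refine h2.congr fun q hq => ?_
    have hp := B.pt_co q hq.1
    rw [show 𝒬.proj q = 𝒢.rng g from hq.2] at hp
    have h4 := jac_eq hlam g φ (hm q hq)
    rw [show φ.toFun (B.co q) = q from hp] at h4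
    rw [eq_div_iff (φ.dens_pos 𝒬.submersion_proj hlam (hm q hq)).ne', mul_comm, h4]
  exact (h3 q ⟨hB, hq⟩).mono_of_mem_nhdsWithin
    (Filter.inter_mem (mem_nhdsWithin_of_mem_nhds (B.isOpen_src.mem_nhds hB)) self_mem_nhdsWithin)

variable [MeasurableSpace P] [BorelSpace P] {V : Type*} [NormedAddCommGroup V] [NormedSpace ℝ V]

/-- Change of variables q ↦ qg between two fibres. After a partition of unity, each piece is
parametrized by some `φ` upstairs and by its translate downstairs. In coordinates both sides are
integrals over the same domain, and `jac_eq` matches the densities. -/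
theorem integral_translate (hlam : VertDensity (n := n) 𝒬.proj lam) (g : G) {F : P → V}
    (hF : ContinuousOn F (𝒬.proj ⁻¹' {𝒢.src g})) {C : Set P} (hC : IsCompact C)
    (hFC : ∀ q, 𝒬.proj q = 𝒢.src g → F q ≠ 0 → q ∈ C) :
    ∫ q, F q ∂fibMeas 𝒬.submersion_proj lam (𝒢.src g) =
      ∫ q, jac 𝒬 lam g q • F (𝒬.act q g) ∂fibMeas 𝒬.submersion_proj lam (𝒢.rng g) := by
  have hf := 𝒬.submersion_proj
  set C' : Set P := (fun q => 𝒬.act q (𝒢.inv g)) '' (C ∩ 𝒬.proj ⁻¹' {𝒢.src g})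
  have hC' : IsCompact C' := (hC.inter_right
    (isClosed_singleton.preimage 𝒬.continuous_proj)).image_of_continuousOn
    ((𝒬.continuousOn_act_inv g).mono inter_subset_right)
  have hact := (𝒬.contMDiffOn_act_right g).continuousOn
  have hmaps : MapsTo (fun q => 𝒬.act q g) (𝒬.proj ⁻¹' {𝒢.rng g}) (𝒬.proj ⁻¹' {𝒢.src g}) :=
    fun q hq => 𝒬.proj_act _ _ hq
  have hmaps' : MapsTo (fun q => 𝒬.act q (𝒢.inv g)) (𝒬.proj ⁻¹' {𝒢.src g})
      (𝒬.proj ⁻¹' {𝒢.rng g}) := fun q hq => 𝒬.proj_act_inv hq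
  obtain ⟨t, B, χ, hχ1, hχ2, hχ3, hχ4⟩ := exists_box_partition hf hC'
  have hχc := fun i => (hχ1 i).continuous
  set R : P → V := fun q => jac 𝒬 lam g q • F (𝒬.act q g)
  have hR : ContinuousOn R (𝒬.proj ⁻¹' {𝒢.rng g}) :=
    (continuousOn_jac hlam g).smul (hF.comp hact hmaps)
  have hRC : ∀ q, 𝒬.proj q = 𝒢.rng g → R q ≠ 0 → q ∈ C' := fun q hq h =>
    ⟨𝒬.act q g, ⟨hFC _ (𝒬.proj_act _ _ hq) (right_ne_zero_of_smul h), 𝒬.proj_act _ _ hq⟩,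
      𝒬.act_inv hq⟩
  have hL : ∀ i, ContinuousOn (fun q => χ i (𝒬.act q (𝒢.inv g)) • F q) (𝒬.proj ⁻¹' {𝒢.src g}) :=
    fun i => ((hχc i).comp_continuousOn (𝒬.continuousOn_act_inv g)).smul hF
  have hR' : ∀ i, ContinuousOn (fun q => χ i q • R q) (𝒬.proj ⁻¹' {𝒢.rng g}) :=
    fun i => (hχc i).continuousOn.smul hR
  have piece : ∀ i, ∫ q, χ i (𝒬.act q (𝒢.inv g)) • F q ∂fibMeas hf lam (𝒢.src g) =
      ∫ q, χ i q • R q ∂fibMeas hf lam (𝒢.rng g) := by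
    intro i
    set φ := (B i).chart (𝒢.rng g)
    rw [← setIntegral_eq_integral_fibMeas hf hlam (g := fun q => χ i q • R q)
        (A := φ.toFun '' φ.source) ?_ (φ.measurableSet_image 𝒬.continuous_proj),
      ← setIntegral_eq_integral_fibMeas hf hlam (A := (translate g φ).toFun '' (translate g φ).source)
        ?_ ((translate g φ).measurableSet_image 𝒬.continuous_proj),
      setIntegral_image_fibMeas hf hlam (hL i), setIntegral_image_fibMeas hf hlam (hR' i)]
    · refine setIntegral_congr_fun φ.isOpen_source.measurableSet fun x hx => ?_
      change (translate g φ).dens lam x • χ i (𝒬.act (𝒬.act (φ.toFun x) g) (𝒢.inv g)) •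
        F (𝒬.act (φ.toFun x) g) = φ.dens lam x • χ i (φ.toFun x) •
        jac 𝒬 lam g (φ.toFun x) • F (𝒬.act (φ.toFun x) g)
      rw [𝒬.act_inv (φ.maps x hx), ← jac_eq hlam g φ hx, mul_smul,
        smul_comm (jac 𝒬 lam g (φ.toFun x))]
    · intro q hq h
      have h1 : 𝒬.act q (𝒢.inv g) ∈ (B i).src := hχ3 i (subset_tsupport _ (left_ne_zero_of_smul h))
      have h2 : 𝒬.act q (𝒢.inv g) ∈ φ.toFun '' φ.source := by
        rw [FBox.image_chart]
        exact ⟨h1, 𝒬.proj_act_inv hq⟩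
      obtain ⟨x, hx, hxq⟩ := h2
      refine ⟨x, hx, ?_⟩
      change 𝒬.act (φ.toFun x) g = q
      rw [hxq, 𝒬.act_inv' hq]
    · intro q hq h
      rw [FBox.image_chart]
      exact ⟨hχ3 i (subset_tsupport _ (left_ne_zero_of_smul h)), hq⟩
  have e1 : ∫ q, F q ∂fibMeas hf lam (𝒢.src g) =
      ∫ q, ∑ i, χ i (𝒬.act q (𝒢.inv g)) • F q ∂fibMeas hf lam (𝒢.src g) := by
    refine integral_congr_ae ?_
    filter_upwards [ae_fibMeas (lam := lam) (m := 𝒢.src g) hf] with q hq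
    rw [← Finset.sum_smul]
    by_cases h : F q = 0
    · simp [h]
    · rw [hχ4 _ ⟨q, ⟨hFC q hq h, hq⟩, rfl⟩, one_smul]
  have e2 : ∫ q, R q ∂fibMeas hf lam (𝒢.rng g) =
      ∫ q, ∑ i, χ i q • R q ∂fibMeas hf lam (𝒢.rng g) := by
    refine integral_congr_ae ?_
    filter_upwards [ae_fibMeas (lam := lam) (m := 𝒢.rng g) hf] with q hq
    rw [← Finset.sum_smul]
    by_cases h : R q = 0
    · simp [h]
    · rw [hχ4 _ (hRC q hq h), one_smul]
  rw [e1, e2, integral_finsetSum, integral_finsetSum]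
  · exact Finset.sum_congr rfl fun i _ => piece i
  · exact fun i _ => integrable_fibMeas hf hlam (hR' i) hC'
      (fun q hq h => hRC q hq (right_ne_zero_of_smul h))
  · exact fun i _ => integrable_fibMeas hf hlam (hL i) hC
      (fun q hq h => hFC q hq (right_ne_zero_of_smul h))

end GManifold

/-! ### Weak integrals in finite-dimensional spaces -/

section WeakIntegral

variable {α : Type*} [MeasurableSpace α] {μ : Measure α}
  {V : Type*} [AddCommGroup V] [Module ℂ V] [FiniteDimensional ℂ V]

variable (μ) in
/-- The integral of a function with values in a finite-dimensional space, computed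
componentwise. -/
def vint (w : α → V) : V :=
  ∑ j, (∫ x, (Module.finBasis ℂ V).coord j (w x) ∂μ) • Module.finBasis ℂ V j

/-- Expansion in the chosen basis shows that the integral commutes with every linear map, so it does
not depend on that basis. The fibres of `E` carry no norm, hence integration is made weak. -/
theorem map_vint {W : Type*} [NormedAddCommGroup W] [NormedSpace ℂ W] [CompleteSpace W]
    {w : α → V}
    (hw : ∀ ℓ : V →ₗ[ℂ] ℂ, Integrable (fun x => ℓ (w x)) μ) (L : V →ₗ[ℂ] W) :
    L (vint μ w) = ∫ x, L (w x) ∂μ := by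
  have h : ∀ x, L (w x) = ∑ j, (Module.finBasis ℂ V).coord j (w x) • L (Module.finBasis ℂ V j) := by
    intro x
    conv_lhs => rw [← (Module.finBasis ℂ V).sum_repr (w x), map_sum]
    simp only [map_smul, Module.Basis.coord_apply]
  simp_rw [h]
  rw [integral_finsetSum _ fun j _ => (hw _).smul_const _, vint, map_sum]
  refine Finset.sum_congr rfl fun j _ => ?_
  rw [map_smul, integral_smul_const]

/-- Every functional on Hom(X, V) is a finite combination of matrix coefficients T ↦ ℓ(Tv). -/
theorem integrable_dual_hom {X : Type*} [AddCommGroup X] [Module ℂ X] [FiniteDimensional ℂ X]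
    {T : α → X →ₗ[ℂ] V} (h : ∀ (v : X) (ℓ : V →ₗ[ℂ] ℂ), Integrable (fun x => ℓ (T x v)) μ)
    (Λ : (X →ₗ[ℂ] V) →ₗ[ℂ] ℂ) : Integrable (fun x => Λ (T x)) μ := by
  set a := Module.finBasis ℂ X
  set b := Module.finBasis ℂ V
  have hT : ∀ x, T x = ∑ i, ∑ j, b.coord i (T x (a j)) • (a.coord j).smulRight (b i) := by
    intro x
    refine a.ext fun j => ?_
    simp only [LinearMap.sum_apply, LinearMap.smul_apply, LinearMap.smulRight_apply,
      Module.Basis.coord_apply, Module.Basis.repr_self, Finsupp.single_apply]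
    conv_lhs => rw [← b.sum_repr (T x (a j))]
    refine Finset.sum_congr rfl fun i _ => ?_
    rw [Finset.sum_eq_single j]
    · simp
    · intro l _ hl
      simp [hl.symm]
    · simp
  have : (fun x => Λ (T x)) = fun x => ∑ i, ∑ j, b.coord i (T x (a j)) •
      Λ ((a.coord j).smulRight (b i)) := by
    funext x
    conv_lhs => rw [hT x]
    simp only [map_sum, map_smul]
  rw [this]
  exact integrable_finsetSum _ fun i _ => integrable_finsetSum _ fun j _ => (h _ _).smul_const _

end WeakIntegral

/-! ### Test functions and Fubini on fibres, and smooth retractions onto fibres. -/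

section FiberIntegral

variable {n k : ℕ} {N M : Type*}
  [TopologicalSpace N] [ChartedSpace (Eu (n + k)) N] [IsManifold (𝓡 (n + k)) ∞ N]
  [TopologicalSpace M] [ChartedSpace (Eu n) M] [IsManifold (𝓡 n) ∞ M]
  [SecondCountableTopology N] [T2Space N] [MeasurableSpace N] [BorelSpace N] [T2Space M]
  {f : N → M} {lam : N → (Fin k → Eu (n + k)) → ℝ} {m : M}
  (hf : IsSubmersion (𝓡 (n + k)) (𝓡 n) ∞ f) (hlam : VertDensity f lam)

include hlam

/-- A continuous function on a fibre vanishes if its integrals against test functions vanish. -/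
theorem eq_zero_of_integral_smul_fibMeas {g : N → ℂ} (hg : ContinuousOn g (f ⁻¹' {m}))
    (h : ∀ χ : N → ℝ, ContMDiff (𝓡 (n + k)) 𝓘(ℝ, ℝ) ∞ χ → HasCompactSupport χ →
      ∫ y, χ y • g y ∂fibMeas hf lam m = 0) {y : N} (hy : f y = m) : g y = 0 := by
  have hloc := locallyCompactSpace_of_euclidean (n + k) N
  have := isLocallyFinite_fibMeas (m := m) hf hlam
  have hcl : IsClosed (f ⁻¹' {m}) := isClosed_singleton.preimage hf.contMDiff.continuous
  refine eq_zero_of_ae_fibMeas hf hlam hg ?_ hy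
  refine ae_eq_zero_of_integral_contMDiff_smul_eq_zero (𝓡 (n + k)) (fun x => ?_) h
  obtain ⟨K, hK, hxK⟩ := exists_compact_mem_nhds x
  refine ⟨K, hxK, ?_⟩
  have h1 : IntegrableOn g (K ∩ f ⁻¹' {m}) (fibMeas hf lam m) :=
    (hg.mono inter_subset_right).integrableOn_compact (hK.inter_right hcl)
  rw [IntegrableOn, ← Measure.restrict_restrict hK.measurableSet, fibMeas_restrict_fiber hf] at h1
  exact h1

variable {k' : ℕ} {N' : Type*}
  [TopologicalSpace N'] [ChartedSpace (Eu (n + k')) N'] [IsManifold (𝓡 (n + k')) ∞ N']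
  [SecondCountableTopology N'] [T2Space N'] [MeasurableSpace N'] [BorelSpace N']
  {f' : N' → M} {lam' : N' → (Fin k' → Eu (n + k')) → ℝ} {m' : M}
  (hf' : IsSubmersion (𝓡 (n + k')) (𝓡 n) ∞ f') (hlam' : VertDensity f' lam')

include hlam'

/-- Fubini: the product measure is carried by the product of the two fibres, where the integrand is
continuous with support in a compact set, hence integrable. -/
theorem integral_integral_swap_fibMeas {F : N → N' → ℂ}
    (hF : ContinuousOn (Function.uncurry F) ((f ⁻¹' {m}) ×ˢ (f' ⁻¹' {m'})))
    {C : Set N} {C' : Set N'} (hC : IsCompact C) (hC' : IsCompact C')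
    (hFC : ∀ x y, f x = m → f' y = m' → F x y ≠ 0 → x ∈ C ∧ y ∈ C') :
    ∫ x, ∫ y, F x y ∂fibMeas hf' lam' m' ∂fibMeas hf lam m =
      ∫ y, ∫ x, F x y ∂fibMeas hf lam m ∂fibMeas hf' lam' m' := by
  have := isLocallyFinite_fibMeas (m := m) hf hlam
  have := isLocallyFinite_fibMeas (m := m') hf' hlam'
  refine integral_integral_swap ?_
  have hcl : IsClosed (f ⁻¹' {m}) := isClosed_singleton.preimage hf.contMDiff.continuous
  have hcl' : IsClosed (f' ⁻¹' {m'}) := isClosed_singleton.preimage hf'.contMDiff.continuous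
  have hK : IsCompact ((C ∩ f ⁻¹' {m}) ×ˢ (C' ∩ f' ⁻¹' {m'})) :=
    (hC.inter_right hcl).prod (hC'.inter_right hcl')
  have h1 : IntegrableOn (Function.uncurry F) ((C ∩ f ⁻¹' {m}) ×ˢ (C' ∩ f' ⁻¹' {m'}))
      ((fibMeas hf lam m).prod (fibMeas hf' lam' m')) :=
    (hF.mono (prod_mono inter_subset_right inter_subset_right)).integrableOn_compact hK
  rw [← integrable_indicator_iff hK.isClosed.measurableSet] at h1
  refine h1.congr ?_
  filter_upwards [Measure.quasiMeasurePreserving_fst.ae (ae_fibMeas (lam := lam) (m := m) hf),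
    Measure.quasiMeasurePreserving_snd.ae (ae_fibMeas (lam := lam') (m := m') hf')] with x hx hx'
  by_cases h : Function.uncurry F x = 0
  · classical rw [indicator_apply, h, ite_self]
  · obtain ⟨h2, h3⟩ := hFC x.1 x.2 hx hx' h
    rw [indicator_of_mem]
    exact ⟨⟨h2, hx⟩, ⟨h3, hx'⟩⟩

omit hlam hlam'

include hf in
theorem isSmoothRetract_fiber (m : M) : IsSmoothRetract (𝓡 (n + k)) (f ⁻¹' {m}) := by
  intro y₀ h0
  obtain ⟨B, hB⟩ := exists_box hf y₀
  have hd := B.mem_dom y₀ hB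
  rw [show f y₀ = m from h0] at hd
  refine ⟨B.src ∩ B.co ⁻¹' B.fdom m, fun y => B.pt (m, B.co y),
    B.contMDiffOn_co.continuousOn.isOpen_inter_preimage B.isOpen_src (B.isOpen_fdom m), ⟨hB, hd⟩,
    (B.contMDiffOn_slice m).comp (B.contMDiffOn_co.mono inter_subset_left) (fun y hy => hy.2),
    fun y hy => B.f_pt _ hy.2, fun y hy => ?_⟩
  have := B.pt_co y hy.2.1
  rwa [show f y = m from hy.1] at this

theorem IsSmoothRetract.inter_open {EQ HQ Q : Type*} [NormedAddCommGroup EQ] [NormedSpace ℝ EQ]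
    [TopologicalSpace HQ] {I : ModelWithCorners ℝ EQ HQ} [TopologicalSpace Q] [ChartedSpace HQ Q]
    {S O : Set Q} (hS : IsSmoothRetract I S) (hO : IsOpen O) : IsSmoothRetract I (S ∩ O) := by
  rintro x₀ ⟨hx₀, hxO⟩
  obtain ⟨W, R, hW, hxW, hR, hRS, hRid⟩ := hS x₀ hx₀
  refine ⟨W ∩ R ⁻¹' O, R, hR.continuousOn.isOpen_inter_preimage hW hO, ⟨hxW, ?_⟩,
    hR.mono inter_subset_left, fun x hx => ⟨hRS hx.1, hx.2⟩, fun x hx => hRid x ⟨hx.1.1, hx.2.1⟩⟩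
  rw [mem_preimage, hRid x₀ ⟨hx₀, hxW⟩]
  exact hxO

end FiberIntegral

/-! ### Smooth families of vectors and of linear maps in a vector bundle -/

section VectorBundles

theorem contMDiffWithinAt_csmul {EQ HQ Q : Type*} [NormedAddCommGroup EQ] [NormedSpace ℝ EQ]
    [TopologicalSpace HQ] {I : ModelWithCorners ℝ EQ HQ} [TopologicalSpace Q] [ChartedSpace HQ Q]
    {F : Type*} [NormedAddCommGroup F] [NormedSpace ℂ F]
    {c : Q → ℂ} {v : Q → F} {S : Set Q} {x₀ : Q} (hc : ContMDiffWithinAt I 𝓘(ℝ, ℂ) ∞ c S x₀)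
    (hv : ContMDiffWithinAt I 𝓘(ℝ, F) ∞ v S x₀) :
    ContMDiffWithinAt I 𝓘(ℝ, F) ∞ (fun x => c x • v x) S x₀ :=
  (isBoundedBilinearMap_smul (𝕜 := ℝ) (A := ℂ) (E := F)).contDiff.contMDiff.contMDiffAt.comp_contMDiffWithinAt x₀
    (hc.prodMk_space hv)

variable {a : ℕ} {P : Type*} [TopologicalSpace P] [ChartedSpace (Eu a) P] [IsManifold (𝓡 a) ∞ P]
  {F : Type*} [NormedAddCommGroup F] [NormedSpace ℂ F] [FiniteDimensional ℂ F]
  {E : P → Type*} [∀ p, AddCommGroup (E p)] [∀ p, Module ℂ (E p)]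
  [TopologicalSpace (TotalSpace F E)] [∀ p, TopologicalSpace (E p)]
  [FiberBundle F E] [VectorBundle ℂ F E] [VectorBundle ℝ F E]
  [ContMDiffVectorBundle ∞ F E (𝓡 a)]
  {EQ HQ Q : Type*} [NormedAddCommGroup EQ] [NormedSpace ℝ EQ]
  [TopologicalSpace HQ] {I : ModelWithCorners ℝ EQ HQ} [TopologicalSpace Q] [ChartedSpace HQ Q]

variable (F E) in
include F in
theorem finiteDimensional_fiber (p : P) : FiniteDimensional ℂ (E p) :=
  ((trivializationAt F E p).linearEquivAt ℂ p
    (FiberBundle.mem_baseSet_trivializationAt' p)).symm.finiteDimensional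

/-- The coordinate map of a trivialization, as a linear map. -/
def trivMap (e : Trivialization F (TotalSpace.proj : TotalSpace F E → P)) [MemTrivializationAtlas e]
    (p : P) (hp : p ∈ e.baseSet) : E p →ₗ[ℂ] F := (e.linearEquivAt ℂ p hp).toLinearMap

theorem trivMap_apply (e : Trivialization F (TotalSpace.proj : TotalSpace F E → P))
    [MemTrivializationAtlas e] {p : P} (hp : p ∈ e.baseSet) (v : E p) :
    trivMap e p hp v = (e ⟨p, v⟩).2 := rfl

theorem contMDiff_functional (ℓ : F →ₗ[ℂ] ℂ) : ContMDiff 𝓘(ℝ, F) 𝓘(ℝ, ℂ) ∞ ℓ :=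
  ((LinearMap.toContinuousLinearMap ℓ).restrictScalars ℝ).contMDiff

variable {S : Set Q} {x₀ : Q}

theorem contMDiffWithinAt_mk_iff {p : Q → P} {s : ∀ x, E (p x)}
    (e : Trivialization F (TotalSpace.proj : TotalSpace F E → P)) [MemTrivializationAtlas e]
    (h : p x₀ ∈ e.baseSet) :
    ContMDiffWithinAt I ((𝓡 a).prod 𝓘(ℝ, F)) ∞ (fun x => (⟨p x, s x⟩ : TotalSpace F E)) S x₀ ↔
      ContMDiffWithinAt I (𝓡 a) ∞ p S x₀ ∧
      ContMDiffWithinAt I 𝓘(ℝ, F) ∞ (fun x => (e ⟨p x, s x⟩).2) S x₀ :=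
  e.contMDiffWithinAt_iff (by rwa [Trivialization.mem_source])

theorem contMDiffWithinAt_symm {p : Q → P}
    (e : Trivialization F (TotalSpace.proj : TotalSpace F E → P)) [MemTrivializationAtlas e]
    (hp : ContMDiffWithinAt I (𝓡 a) ∞ p S x₀) (h : p x₀ ∈ e.baseSet) (u : F) :
    ContMDiffWithinAt I ((𝓡 a).prod 𝓘(ℝ, F)) ∞
      (fun x => (⟨p x, e.symm (p x) u⟩ : TotalSpace F E)) S x₀ := by
  refine (contMDiffWithinAt_mk_iff e h).2 ⟨hp, ?_⟩
  refine (contMDiffWithinAt_const (c := u)).congr_of_eventuallyEq ?_ ?_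
  · filter_upwards [hp.continuousWithinAt (e.open_baseSet.mem_nhds h)] with x hx
    rw [e.apply_mk_symm hx]
  · rw [e.apply_mk_symm h]

theorem contMDiffWithinAt_functional {p₀ : P} {s : Q → E p₀}
    (hs : ContMDiffWithinAt I ((𝓡 a).prod 𝓘(ℝ, F)) ∞ (fun x => (⟨p₀, s x⟩ : TotalSpace F E)) S x₀)
    (ℓ : E p₀ →ₗ[ℂ] ℂ) : ContMDiffWithinAt I 𝓘(ℝ, ℂ) ∞ (fun x => ℓ (s x)) S x₀ := by
  set e := trivializationAt F E p₀
  have h0 : p₀ ∈ e.baseSet := FiberBundle.mem_baseSet_trivializationAt' p₀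
  have h1 := ((contMDiffWithinAt_mk_iff e h0).1 hs).2
  have h2 := (contMDiff_functional (ℓ ∘ₗ ((e.linearEquivAt ℂ p₀ h0).symm.toLinearMap))).contMDiffAt.comp_contMDiffWithinAt x₀ h1
  refine h2.congr (fun x _ => ?_) ?_ <;>
  exact congrArg ℓ ((e.linearEquivAt ℂ p₀ h0).symm_apply_apply _).symm

theorem contMDiffWithinAt_smul_section {p : Q → P} {s : ∀ x, E (p x)} {c : Q → ℂ}
    (hc : ContMDiffWithinAt I 𝓘(ℝ, ℂ) ∞ c S x₀)
    (hs : ContMDiffWithinAt I ((𝓡 a).prod 𝓘(ℝ, F)) ∞ (fun x => (⟨p x, s x⟩ : TotalSpace F E)) S x₀) :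
    ContMDiffWithinAt I ((𝓡 a).prod 𝓘(ℝ, F)) ∞
      (fun x => (⟨p x, c x • s x⟩ : TotalSpace F E)) S x₀ := by
  set e := trivializationAt F E (p x₀)
  have h0 : p x₀ ∈ e.baseSet := FiberBundle.mem_baseSet_trivializationAt' _
  obtain ⟨hp, h1⟩ := (contMDiffWithinAt_mk_iff e h0).1 hs
  refine (contMDiffWithinAt_mk_iff e h0).2 ⟨hp, ?_⟩
  refine (contMDiffWithinAt_csmul hc h1).congr_of_eventuallyEq ?_ ?_
  · filter_upwards [hp.continuousWithinAt (e.open_baseSet.mem_nhds h0)] with x hx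
    exact (trivMap e (p x) hx).map_smul _ _
  · exact (trivMap e (p x₀) h0).map_smul _ _

theorem symm_eq_sum (e : Trivialization F (TotalSpace.proj : TotalSpace F E → P))
    [MemTrivializationAtlas e] {p : P} (hp : p ∈ e.baseSet) (v : E p) :
    v = ∑ j, (Module.finBasis ℂ F).coord j (e ⟨p, v⟩).2 • e.symm p (Module.finBasis ℂ F j) := by
  have h1 : v = (e.linearEquivAt ℂ p hp).symm (e ⟨p, v⟩).2 :=
    ((e.linearEquivAt ℂ p hp).symm_apply_apply v).symm
  have h2 := (Module.finBasis ℂ F).sum_repr (e ⟨p, v⟩).2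
  conv_lhs => rw [h1, ← h2, map_sum]
  refine Finset.sum_congr rfl fun j _ => ?_
  rw [map_smul]
  rfl

/-- A family of linear maps which is smooth in trivializations maps smooth families of vectors to
smooth families of vectors. -/
theorem contMDiffWithinAt_hom_apply {p' p : Q → P} {T : ∀ x, E (p' x) →ₗ[ℂ] E (p x)}
    (e' e : Trivialization F (TotalSpace.proj : TotalSpace F E → P)) [MemTrivializationAtlas e']
    [MemTrivializationAtlas e] (hp : ContMDiffWithinAt I (𝓡 a) ∞ p S x₀)
    (h' : p' x₀ ∈ e'.baseSet) (h : p x₀ ∈ e.baseSet)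
    (hT : ∀ u : F, ContMDiffWithinAt I 𝓘(ℝ, F) ∞
      (fun x => (e ⟨p x, T x (e'.symm (p' x) u)⟩).2) S x₀)
    {s : ∀ x, E (p' x)}
    (hs : ContMDiffWithinAt I ((𝓡 a).prod 𝓘(ℝ, F)) ∞
      (fun x => (⟨p' x, s x⟩ : TotalSpace F E)) S x₀) :
    ContMDiffWithinAt I ((𝓡 a).prod 𝓘(ℝ, F)) ∞
      (fun x => (⟨p x, T x (s x)⟩ : TotalSpace F E)) S x₀ := by
  obtain ⟨hp', h1⟩ := (contMDiffWithinAt_mk_iff e' h').1 hs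
  refine (contMDiffWithinAt_mk_iff e h).2 ⟨hp, ?_⟩
  have h2 : ContMDiffWithinAt I 𝓘(ℝ, F) ∞ (fun x => ∑ j,
      (Module.finBasis ℂ F).coord j (e' ⟨p' x, s x⟩).2 •
        (e ⟨p x, T x (e'.symm (p' x) (Module.finBasis ℂ F j))⟩).2) S x₀ :=
    ContMDiffWithinAt.sum fun j _ => contMDiffWithinAt_csmul
      ((contMDiff_functional _).contMDiffAt.comp_contMDiffWithinAt x₀ h1) (hT _)
  have key : ∀ x, p' x ∈ e'.baseSet → p x ∈ e.baseSet → (e ⟨p x, T x (s x)⟩).2 =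
      ∑ j, (Module.finBasis ℂ F).coord j (e' ⟨p' x, s x⟩).2 •
        (e ⟨p x, T x (e'.symm (p' x) (Module.finBasis ℂ F j))⟩).2 := by
    intro x hx' hx
    conv_lhs => rw [symm_eq_sum e' hx' (s x), map_sum, ← trivMap_apply e hx, map_sum]
    refine Finset.sum_congr rfl fun j _ => ?_
    rw [map_smul, map_smul, trivMap_apply]
  refine h2.congr_of_eventuallyEq ?_ (key x₀ h' h)
  filter_upwards [hp.continuousWithinAt (e.open_baseSet.mem_nhds h),
    hp'.continuousWithinAt (e'.open_baseSet.mem_nhds h')] with x hx hx'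
  exact key x hx' hx

/-- In a trivialization the trace is the sum of the diagonal matrix entries. -/
theorem contMDiffWithinAt_trace {p : Q → P} {T : ∀ x, E (p x) →ₗ[ℂ] E (p x)}
    (hp : ContMDiffWithinAt I (𝓡 a) ∞ p S x₀)
    (hT : ∀ s : ∀ x, E (p x), ContMDiffWithinAt I ((𝓡 a).prod 𝓘(ℝ, F)) ∞
      (fun x => (⟨p x, s x⟩ : TotalSpace F E)) S x₀ →
      ContMDiffWithinAt I ((𝓡 a).prod 𝓘(ℝ, F)) ∞
        (fun x => (⟨p x, T x (s x)⟩ : TotalSpace F E)) S x₀) :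
    ContMDiffWithinAt I 𝓘(ℝ, ℂ) ∞ (fun x => LinearMap.trace ℂ (E (p x)) (T x)) S x₀ := by
  set e := trivializationAt F E (p x₀)
  have h0 : p x₀ ∈ e.baseSet := FiberBundle.mem_baseSet_trivializationAt' _
  set b := Module.finBasis ℂ F
  have h1 : ContMDiffWithinAt I 𝓘(ℝ, ℂ) ∞ (fun x => ∑ j,
      b.coord j (e ⟨p x, T x (e.symm (p x) (b j))⟩).2) S x₀ :=
    ContMDiffWithinAt.sum fun j _ => (contMDiff_functional _).contMDiffAt.comp_contMDiffWithinAt x₀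
      ((contMDiffWithinAt_mk_iff e h0).1 (hT _ (contMDiffWithinAt_symm e hp h0 (b j)))).2
  have key : ∀ x, p x ∈ e.baseSet → LinearMap.trace ℂ (E (p x)) (T x) = ∑ j,
      b.coord j (e ⟨p x, T x (e.symm (p x) (b j))⟩).2 := by
    intro x hx
    rw [LinearMap.trace_eq_matrix_trace ℂ (b.map (e.linearEquivAt ℂ (p x) hx).symm), Matrix.trace]
    refine Finset.sum_congr rfl fun j _ => ?_
    rw [Matrix.diag_apply, LinearMap.toMatrix_apply]
    rfl
  refine h1.congr_of_eventuallyEq ?_ (key x₀ h0)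
  filter_upwards [hp.continuousWithinAt (e.open_baseSet.mem_nhds h0)] with x hx
  exact key x hx

theorem mul_mem_ccSections {χ : P → ℝ} (hχ : ContMDiff (𝓡 a) 𝓘(ℝ, ℝ) ∞ χ) (ξ : CcSections (a := a) F E) :
    (fun p => (χ p : ℂ) • ξ.1 p) ∈ CcSections (a := a) F E := by
  refine ⟨fun p => ?_, ξ.2.2.of_isClosed_subset isClosed_closure (closure_mono fun p hp h => ?_)⟩
  · exact contMDiffWithinAt_smul_section (S := univ) (c := fun p => (χ p : ℂ))
      ((Complex.ofRealCLM.contMDiff.comp hχ) p) (ξ.2.1 p)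
  · exact hp (by simp [h])

/-- Sections reach every vector of every fibre, so an identity of kernels can be tested on sections.
-/
theorem exists_section_through [T2Space P] [SecondCountableTopology P] (p₀ : P) (v : E p₀) :
    ∃ ξ : CcSections (a := a) F E, ξ.1 p₀ = v := by
  set e := trivializationAt F E p₀
  have h0 : p₀ ∈ e.baseSet := FiberBundle.mem_baseSet_trivializationAt' _
  obtain ⟨χ, hχ, hχc, hχs, hχ1, -⟩ := exists_cutoff (a := a) (isCompact_singleton (x := p₀))
    e.open_baseSet (singleton_subset_iff.2 h0)
  refine ⟨⟨fun p => (χ p : ℂ) • e.symm p (e ⟨p₀, v⟩).2, fun p => ?_, ?_⟩, ?_⟩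
  · by_cases hp : p ∈ e.baseSet
    · exact contMDiffWithinAt_smul_section (S := univ) (c := fun p => (χ p : ℂ))
        ((Complex.ofRealCLM.contMDiff.comp hχ) p) (contMDiffWithinAt_symm e contMDiffWithinAt_id hp _)
    · have h2 : (tsupport χ)ᶜ ∈ 𝓝 p :=
        (isClosed_tsupport χ).isOpen_compl.mem_nhds fun h => hp (hχs h)
      refine (Bundle.contMDiff_zeroSection ℝ E p).congr_of_eventuallyEq ?_
      filter_upwards [h2] with q hq
      simp [image_eq_zero_of_notMem_tsupport hq, zeroSection]
  · refine hχc.isCompact.of_isClosed_subset isClosed_closure (closure_mono fun p hp h => ?_)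
    exact hp (by simp [h])
  · simp only [hχ1 p₀ rfl, Complex.ofReal_one, one_smul]
    exact (e.linearEquivAt ℂ p₀ h0).symm_apply_apply v

end VectorBundles

/-! ### Linearity of the weak integral. -/

section WeakIntegral

variable {α : Type*} [MeasurableSpace α] {μ : Measure α}
  {V : Type*} [AddCommGroup V] [Module ℂ V] [FiniteDimensional ℂ V]

theorem eq_of_forall_functional {v w : V} (h : ∀ ℓ : V →ₗ[ℂ] ℂ, ℓ v = ℓ w) : v = w := by
  rw [← sub_eq_zero, ← Module.forall_dual_apply_eq_zero_iff ℂ]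
  intro ℓ
  rw [map_sub, h ℓ, sub_self]

theorem vint_add {w w' : α → V} (hw : ∀ ℓ : V →ₗ[ℂ] ℂ, Integrable (fun x => ℓ (w x)) μ)
    (hw' : ∀ ℓ : V →ₗ[ℂ] ℂ, Integrable (fun x => ℓ (w' x)) μ) :
    vint μ (fun x => w x + w' x) = vint μ w + vint μ w' := by
  simp only [vint, map_add]
  rw [← Finset.sum_add_distrib]
  refine Finset.sum_congr rfl fun j _ => ?_
  rw [integral_add (hw _) (hw' _), add_smul]

theorem vint_smul (c : ℂ) (w : α → V) : vint μ (fun x => c • w x) = c • vint μ w := by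
  simp only [vint, map_smul, smul_eq_mul]
  rw [Finset.smul_sum]
  refine Finset.sum_congr rfl fun j _ => ?_
  rw [integral_const_mul, mul_smul]

theorem vint_congr {w w' : α → V} (h : w =ᵐ[μ] w') : vint μ w = vint μ w' := by
  simp only [vint]
  refine Finset.sum_congr rfl fun j _ => ?_
  congr 1
  exact integral_congr_ae (h.fun_comp _)

theorem vint_eq_zero {w : α → V} (h : ∀ᵐ x ∂μ, w x = 0) : vint μ w = 0 := by
  rw [vint_congr (w' := fun _ => 0) h]
  simp [vint]

end WeakIntegral

/-! ### Fibre integrals with values in a vector bundle. -/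

section BundleIntegral

variable {n k a : ℕ} {N M : Type*}
  [TopologicalSpace N] [ChartedSpace (Eu (n + k)) N] [IsManifold (𝓡 (n + k)) ∞ N]
  [TopologicalSpace M] [ChartedSpace (Eu n) M] [IsManifold (𝓡 n) ∞ M]
  [SecondCountableTopology N] [T2Space N] [MeasurableSpace N] [BorelSpace N] [T2Space M]
  {f : N → M} {lam : N → (Fin k → Eu (n + k)) → ℝ} {m : M}
  (hf : IsSubmersion (𝓡 (n + k)) (𝓡 n) ∞ f) (hlam : VertDensity f lam)
  {P : Type*} [TopologicalSpace P] [ChartedSpace (Eu a) P] [IsManifold (𝓡 a) ∞ P]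
  {F : Type*} [NormedAddCommGroup F] [NormedSpace ℂ F] [FiniteDimensional ℂ F]
  {E : P → Type*} [∀ p, AddCommGroup (E p)] [∀ p, Module ℂ (E p)]
  [TopologicalSpace (TotalSpace F E)] [∀ p, TopologicalSpace (E p)]
  [FiberBundle F E] [VectorBundle ℂ F E] [VectorBundle ℝ F E]
  [ContMDiffVectorBundle ∞ F E (𝓡 a)]
  {EQ HQ Q : Type*} [NormedAddCommGroup EQ] [NormedSpace ℝ EQ]
  [TopologicalSpace HQ] {I : ModelWithCorners ℝ EQ HQ} [TopologicalSpace Q] [ChartedSpace HQ Q]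

include hlam

theorem integrable_functional {p₀ : P} {s : N → E p₀}
    (hs : ContMDiffOn (𝓡 (n + k)) ((𝓡 a).prod 𝓘(ℝ, F)) ∞
      (fun y => (⟨p₀, s y⟩ : TotalSpace F E)) (f ⁻¹' {m}))
    {C : Set N} (hC : IsCompact C) (hsC : ∀ y, f y = m → s y ≠ 0 → y ∈ C) (ℓ : E p₀ →ₗ[ℂ] ℂ) :
    Integrable (fun y => ℓ (s y)) (fibMeas hf lam m) :=
  integrable_fibMeas hf hlam
    (fun y hy => (contMDiffWithinAt_functional (hs y hy) ℓ).continuousWithinAt) hC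
    fun y hy h => hsC y hy fun h0 => h (by rw [h0, map_zero])

/-- The integral over a fibre of a smooth family of vectors is a smooth family. -/
theorem contMDiffOn_vint [I.Boundaryless] [IsManifold I ∞ Q] {S : Set Q} (hS : IsSmoothRetract I S)
    {w : Q → M} (hw : ContMDiffOn I (𝓡 n) ∞ w S) {p : Q → P} (hp : ContMDiffOn I (𝓡 a) ∞ p S)
    {s : ∀ x : Q, N → E (p x)}
    (hs : ContMDiffOn ((𝓡 (n + k)).prod I) ((𝓡 a).prod 𝓘(ℝ, F)) ∞
      (fun y : N × Q => (⟨p y.2, s y.2 y.1⟩ : TotalSpace F E)) {y | y.2 ∈ S ∧ f y.1 = w y.2})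
    (hsC : ∀ x₀ ∈ S, ∃ O ∈ 𝓝 x₀, ∃ C : Set N, IsCompact C ∧
      ∀ x ∈ O ∩ S, ∀ y, f y = w x → s x y ≠ 0 → y ∈ C) :
    have := fun p => finiteDimensional_fiber F E p
    ContMDiffOn I ((𝓡 a).prod 𝓘(ℝ, F)) ∞
      (fun x => (⟨p x, vint (fibMeas hf lam (w x)) (s x)⟩ : TotalSpace F E)) S := by
  intro hfin x₀ hx₀
  set e := trivializationAt F E (p x₀)
  have h0 : p x₀ ∈ e.baseSet := FiberBundle.mem_baseSet_trivializationAt' _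
  -- Near x₀ within `S` all values lie over one trivialization, where the weak integral becomes an
  -- integral in the typical fibre `F`.
  obtain ⟨O, hO, hxO, hOS⟩ := mem_nhdsWithin.1
    ((hp x₀ hx₀).continuousWithinAt (e.open_baseSet.mem_nhds h0))
  have hbase : ∀ x ∈ S ∩ O, p x ∈ e.baseSet := fun x hx => hOS ⟨hx.2, hx.1⟩
  have hh : ContMDiffOn ((𝓡 (n + k)).prod I) 𝓘(ℝ, F) ∞
      (fun y : N × Q => (e ⟨p y.2, s y.2 y.1⟩).2) {y | y.2 ∈ S ∩ O ∧ f y.1 = w y.2} := by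
    intro y hy
    have hsub : {y : N × Q | y.2 ∈ S ∩ O ∧ f y.1 = w y.2} ⊆ {y | y.2 ∈ S ∧ f y.1 = w y.2} :=
      fun z hz => ⟨hz.1.1, hz.2⟩
    have h1 := (hs y ⟨hy.1.1, hy.2⟩).mono hsub
    exact ((contMDiffWithinAt_mk_iff (p := fun y : N × Q => p y.2) e (hbase _ hy.1)).1 h1).2
  have key := contMDiffOn_integral_fibMeas hf hlam (hS.inter_open hO)
    (hw.mono inter_subset_left) hh (fun x hx => by
      obtain ⟨O', hO', C, hC, hCs⟩ := hsC x hx.1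
      refine ⟨O', hO', C, hC, fun z hz y hy h => hCs z ⟨hz.1, hz.2.1⟩ y hy fun h' => h ?_⟩
      simp only [h']
      exact (trivMap e (p z) (hbase z hz.2)).map_zero)
  have hmem : S ∩ O ∈ 𝓝[S] x₀ :=
    Filter.inter_mem self_mem_nhdsWithin (mem_nhdsWithin_of_mem_nhds (hO.mem_nhds hxO))
  refine ((contMDiffWithinAt_mk_iff e h0).2 ⟨(hp x₀ hx₀).mono inter_subset_left, ?_⟩ :
    ContMDiffWithinAt _ _ _ _ (S ∩ O) x₀).mono_of_mem_nhdsWithin hmem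
  have hfinF : CompleteSpace F := FiniteDimensional.complete ℂ F
  have hv : ∀ x ∈ S ∩ O, (e ⟨p x, vint (fibMeas hf lam (w x)) (s x)⟩).2 =
      ∫ y, (e ⟨p x, s x y⟩).2 ∂fibMeas hf lam (w x) := by
    intro x hx
    obtain ⟨O', hO', C, hC, hCs⟩ := hsC x hx.1
    refine map_vint (W := F) (fun ℓ => ?_) (trivMap e (p x) (hbase x hx))
    have h1 : ContMDiffOn (𝓡 (n + k)) ((𝓡 (n + k)).prod I) ∞ (fun y : N => (y, x))
      (f ⁻¹' {w x}) := contMDiffOn_id.prodMk contMDiffOn_const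
    have h2 : ContMDiffOn (𝓡 (n + k)) ((𝓡 a).prod 𝓘(ℝ, F)) ∞
        (fun y => (⟨p x, s x y⟩ : TotalSpace F E)) (f ⁻¹' {w x}) :=
      hs.comp h1 (fun y hy => ⟨hx.1, hy⟩)
    exact integrable_functional (F := F) hf hlam h2 hC
      (fun y hy => hCs x ⟨mem_of_mem_nhds hO', hx.1⟩ y hy) ℓ
  exact (key x₀ ⟨hx₀, hxO⟩).congr hv (hv x₀ ⟨hx₀, hxO⟩)

end BundleIntegral

/-! ### The action of the convolution algebra on sections. -/

namespace EquivariantGrading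

variable {n k d : ℕ} {M G P : Type*} [TopologicalSpace M] [ChartedSpace (Eu n) M]
  [IsManifold (𝓡 n) ∞ M] [T2Space M] [SecondCountableTopology M]
  [TopologicalSpace G] [ChartedSpace (Eu (n + k)) G] [IsManifold (𝓡 (n + k)) ∞ G]
  [T2Space G] [SecondCountableTopology G] {𝒢 : LieGroupoid n k M G}
  [TopologicalSpace P] [ChartedSpace (Eu (n + d)) P] [IsManifold (𝓡 (n + d)) ∞ P]
  [T2Space P] [SecondCountableTopology P] {𝒬 : GManifold 𝒢 d P}
  {F : Type*} [NormedAddCommGroup F] [NormedSpace ℂ F] [FiniteDimensional ℂ F]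
  {E : P → Type*} [∀ p, AddCommGroup (E p)] [∀ p, Module ℂ (E p)]
  [TopologicalSpace (TotalSpace F E)] [∀ p, TopologicalSpace (E p)]
  [FiberBundle F E] [VectorBundle ℂ F E] [VectorBundle ℝ F E]
  [ContMDiffVectorBundle ∞ F E (𝓡 (n + d))]
  (𝓔 : EquivariantGrading 𝒬 F E)
  {EQ HQ Q : Type*} [NormedAddCommGroup EQ] [NormedSpace ℝ EQ]
  [TopologicalSpace HQ] {I : ModelWithCorners ℝ EQ HQ} [TopologicalSpace Q] [ChartedSpace HQ Q]

/-- The inverse of the identification by g is the identification by g⁻¹. This gives smoothness of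
the inverse. The equality is in the total space because the base points agree only propositionally.
-/
theorem lift_symm_eq {p : P} {g : G} (h : 𝒬.proj p = 𝒢.rng g) (w : E (𝒬.act p g)) :
    (⟨p, (𝓔.lift p g).symm w⟩ : TotalSpace F E) =
      ⟨𝒬.act (𝒬.act p g) (𝒢.inv g), 𝓔.lift (𝒬.act p g) (𝒢.inv g) w⟩ := by
  have h1 := 𝓔.lift_mul p g (𝒢.inv g) ((𝓔.lift p g).symm w) h (by rw [𝒢.rng_inv])
  rw [LinearEquiv.apply_symm_apply] at h1
  rw [h1, 𝒢.mul_inv, ← h, 𝓔.lift_unit]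

theorem contMDiffOn_lift_symm {S : Set Q} {p : Q → P} {g : Q → G} {s : ∀ x, E (𝒬.act (p x) (g x))}
    (hg : ContMDiffOn I (𝓡 (n + k)) ∞ g S) (hpg : ∀ x ∈ S, 𝒬.proj (p x) = 𝒢.rng (g x))
    (hs : ContMDiffOn I ((𝓡 (n + d)).prod 𝓘(ℝ, F)) ∞
      (fun x => (⟨𝒬.act (p x) (g x), s x⟩ : TotalSpace F E)) S) :
    ContMDiffOn I ((𝓡 (n + d)).prod 𝓘(ℝ, F)) ∞
      (fun x => (⟨p x, (𝓔.lift (p x) (g x)).symm (s x)⟩ : TotalSpace F E)) S := by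
  have h1 := 𝓔.contMDiffOn_lift.comp (hs.prodMk (𝒢.contMDiff_inv.comp_contMDiffOn hg))
    (fun x hx => by
      simp only [mem_ofPred_eq, mem_preimage, Function.comp_apply]
      rw [𝒬.proj_act _ _ (hpg x hx), 𝒢.rng_inv])
  exact h1.congr fun x hx => 𝓔.lift_symm_eq (hpg x hx) (s x)

theorem contMDiffOn_lift_section (ξ : 𝓔.Sec) :
    ContMDiffOn ((𝓡 (n + k)).prod (𝓡 (n + d))) ((𝓡 (n + d)).prod 𝓘(ℝ, F)) ∞
      (fun y : G × P => (⟨y.2, (𝓔.lift y.2 y.1).symm (ξ.1 (𝒬.act y.2 y.1))⟩ : TotalSpace F E))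
      {y | 𝒢.rng y.1 = 𝒬.proj y.2} := by
  have h1 : ContMDiffOn ((𝓡 (n + k)).prod (𝓡 (n + d))) (𝓡 (n + d)) ∞
      (fun y : G × P => 𝒬.act y.2 y.1) {y | 𝒢.rng y.1 = 𝒬.proj y.2} :=
    𝒬.contMDiffOn_act.comp (contMDiff_snd.prodMk contMDiff_fst).contMDiffOn (fun y hy => hy.symm)
  exact 𝓔.contMDiffOn_lift_symm (p := fun y : G × P => y.2) (g := Prod.fst)
    (s := fun y => ξ.1 (𝒬.act y.2 y.1)) contMDiffOn_fst (fun y hy => hy.symm)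
    (ξ.2.1.comp_contMDiffOn h1)

section Module

variable [MeasurableSpace G] [BorelSpace G] (h𝒢 : 𝒢.IsFoliationGroupoid)

/-- The integrand of the action of the convolution algebra on sections. -/
def actIntegrand (u : G → ℂ) (ξ : 𝓔.Sec) (p : P) (g : G) : E p :=
  u g • (𝓔.lift p g).symm (ξ.1 (𝒬.act p g))

theorem contMDiffOn_actIntegrand {u : G → ℂ} (hu : IsCc (a := n + k) u) (ξ : 𝓔.Sec) :
    ContMDiffOn ((𝓡 (n + k)).prod (𝓡 (n + d))) ((𝓡 (n + d)).prod 𝓘(ℝ, F)) ∞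
      (fun y : G × P => (⟨y.2, 𝓔.actIntegrand u ξ y.2 y.1⟩ : TotalSpace F E))
      {y | 𝒢.rng y.1 = 𝒬.proj y.2} :=
  fun y hy => contMDiffWithinAt_smul_section
    ((hu.1.comp contMDiff_fst).contMDiffOn y hy) (𝓔.contMDiffOn_lift_section ξ y hy)

theorem contMDiffOn_actIntegrand_fiber {u : G → ℂ} (hu : IsCc (a := n + k) u) (ξ : 𝓔.Sec) (p : P) :
    ContMDiffOn (𝓡 (n + k)) ((𝓡 (n + d)).prod 𝓘(ℝ, F)) ∞
      (fun g => (⟨p, 𝓔.actIntegrand u ξ p g⟩ : TotalSpace F E)) (𝒢.rng ⁻¹' {𝒬.proj p}) := by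
  have h : ContMDiffOn (𝓡 (n + k)) ((𝓡 (n + k)).prod (𝓡 (n + d))) ∞ (fun g : G => (g, p))
    (𝒢.rng ⁻¹' {𝒬.proj p}) := contMDiffOn_id.prodMk contMDiffOn_const
  exact (𝓔.contMDiffOn_actIntegrand hu ξ).comp h (fun _ hg => hg)

include h𝒢

theorem integrable_actIntegrand {u : G → ℂ} (hu : IsCc (a := n + k) u) (ξ : 𝓔.Sec) (p : P)
    (ℓ : E p →ₗ[ℂ] ℂ) : Integrable (fun g => ℓ (𝓔.actIntegrand u ξ p g)) (𝒢.haar (𝒬.proj p)) :=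
  integrable_functional (F := F) 𝒢.submersion_rng (𝒢.vertDensity_fiberVol h𝒢)
    (𝓔.contMDiffOn_actIntegrand_fiber hu ξ p) hu.2
    (fun _ _ h => subset_tsupport _ (left_ne_zero_of_smul h)) ℓ

/-- If g contributes at p, then p = (pg)g⁻¹ with pg in supp ξ and g in supp u. Thus p lies in the
compact set of products of supp ξ with the inverse of supp u. -/
theorem actSec_mem {u : G → ℂ} (hu : IsCc (a := n + k) u) (ξ : 𝓔.Sec) :
    have := fun p => finiteDimensional_fiber F E p
    (fun p => vint (𝒢.haar (𝒬.proj p)) (𝓔.actIntegrand u ξ p)) ∈ CcSections (a := n + d) F E := by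
  intro hfin
  constructor
  · rw [← contMDiffOn_univ]
    exact contMDiffOn_vint (I := 𝓡 (n + d)) 𝒢.submersion_rng (𝒢.vertDensity_fiberVol h𝒢)
      isSmoothRetract_univ 𝒬.submersion_proj.contMDiff.contMDiffOn contMDiffOn_id
      ((𝓔.contMDiffOn_actIntegrand hu ξ).mono fun y hy => hy.2)
      (fun p _ => ⟨univ, Filter.univ_mem, tsupport u, hu.2,
        fun _ _ g _ h => subset_tsupport _ (left_ne_zero_of_smul h)⟩)
  · have hK : IsCompact ((closure {p | ξ.1 p ≠ 0} ×ˢ (𝒢.inv '' tsupport u)) ∩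
        {x : P × G | 𝒬.proj x.1 = 𝒢.rng x.2}) :=
      (ξ.2.2.prod (hu.2.isCompact.image 𝒢.contMDiff_inv.continuous)).inter_right
        (isClosed_eq (𝒬.continuous_proj.comp continuous_fst) (𝒢.continuous_rng.comp continuous_snd))
    refine IsCompact.closure_of_subset
      (hK.image_of_continuousOn (𝒬.contMDiffOn_act.continuousOn.mono inter_subset_right)) fun p hp => ?_
    by_contra hpK
    refine hp (vint_eq_zero ?_)
    filter_upwards [ae_fibMeas (lam := 𝒢.fiberVol) (m := 𝒬.proj p) 𝒢.submersion_rng] with g hg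
    by_contra h
    refine hpK ⟨(𝒬.act p g, 𝒢.inv g), ⟨⟨subset_closure fun h' => ?_, ⟨g, subset_tsupport _
      (left_ne_zero_of_smul h), rfl⟩⟩, ?_⟩, 𝒬.act_inv hg.symm⟩
    · exact h (by rw [actIntegrand, h', map_zero, smul_zero])
    · simp only [mem_ofPred_eq]
      rw [𝒬.proj_act _ _ hg.symm, 𝒢.rng_inv]

/-- The action of an element of the convolution algebra, given by its coefficient, on a section. -/
def actSec (u : G → ℂ) (hu : IsCc (a := n + k) u) (ξ : 𝓔.Sec) : 𝓔.Sec :=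
  ⟨_, 𝓔.actSec_mem h𝒢 hu ξ⟩

theorem apply_actSec {u : G → ℂ} (hu : IsCc (a := n + k) u) (ξ : 𝓔.Sec) (p : P)
    (ℓ : E p →ₗ[ℂ] ℂ) : ℓ ((𝓔.actSec h𝒢 u hu ξ).1 p) =
      ∫ g, ℓ (𝓔.actIntegrand u ξ p g) ∂𝒢.haar (𝒬.proj p) := by
  have hfin := fun p => finiteDimensional_fiber F E p
  exact map_vint (𝓔.integrable_actIntegrand h𝒢 hu ξ p) ℓ

/-- Relative to `fiberVol`, the relation defining bξ has exactly one solution. Uniqueness follows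
because functionals separate vectors of E_p. -/
theorem isSMul_iff {u : G → ℂ} (hu : IsCc (a := n + k) u) {b : 𝒢.ConvAlg}
    (hb : b.1 = 𝒢.density 𝒢.src u) {ξ ζ : 𝓔.Sec} :
    𝓔.IsSMul b ξ ζ ↔ ζ = 𝓔.actSec h𝒢 u hu ξ := by
  have hfin := fun p => finiteDimensional_fiber F E p
  have key : ∀ (p : P) (ℓ : E p →ₗ[ℂ] ℂ) (J : ℂ),
      HasFiberIntegral (a := n + k) (b := n) k 𝒢.rng (𝒬.proj p)
      (fun g v => b.1 g (fun i => tder (a := n + k) (b := n) 𝒢.src g (v i)) *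
        ℓ ((𝓔.lift p g).symm (ξ.1 (𝒬.act p g)))) J ↔ J = ℓ ((𝓔.actSec h𝒢 u hu ξ).1 p) := by
    intro p ℓ J
    rw [𝓔.apply_actSec]
    refine hasFiberIntegral_iff 𝒢.submersion_rng (𝒢.vertDensity_fiberVol h𝒢) ?_ ?_ hu.2 ?_
    · intro g _ v hv
      rw [hb, 𝒢.density_apply fun i => 𝒢.tder_src_mem h𝒢 (hv i), actIntegrand, map_smul,
        smul_eq_mul, LieGroupoid.fiberVol]
      ring
    · intro g hg
      exact (contMDiffWithinAt_functional (𝓔.contMDiffOn_actIntegrand_fiber hu ξ p g hg)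
        ℓ).continuousWithinAt
    · intro g _ h
      refine subset_tsupport _ fun h' => h ?_
      rw [actIntegrand, h', zero_smul, map_zero]
  constructor
  · intro h
    exact Subtype.ext (funext fun p => eq_of_forall_functional fun ℓ => (key p ℓ _).1 (h p ℓ))
  · rintro rfl p ℓ
    exact (key p ℓ _).2 rfl

/-- Every element of the convolution algebra is given by a smooth compactly supported coefficient,
by `exists_scalar`. -/
theorem isModuleEnd_iff {K : Module.End ℂ 𝓔.Sec} : 𝓔.IsModuleEnd K ↔
    ∀ (u : G → ℂ) (hu : IsCc (a := n + k) u) (ξ : 𝓔.Sec),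
      K (𝓔.actSec h𝒢 u hu ξ) = 𝓔.actSec h𝒢 u hu (K ξ) := by
  constructor
  · intro h u hu ξ
    exact (𝓔.isSMul_iff h𝒢 hu rfl).1 (h (𝒢.mkDens 𝒢.submersion_src.contMDiff u hu) ξ _
      ((𝓔.isSMul_iff h𝒢 hu rfl).2 rfl))
  · intro h b ξ ζ hb
    obtain ⟨u, hu, hbu⟩ := 𝒢.exists_scalar h𝒢 𝒢.submersion_src.contMDiff b
    rw [𝓔.isSMul_iff h𝒢 hu hbu] at hb ⊢
    rw [hb, h u hu]

theorem actSec_add {u : G → ℂ} (hu : IsCc (a := n + k) u) (ξ ζ : 𝓔.Sec) :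
    𝓔.actSec h𝒢 u hu (ξ + ζ) = 𝓔.actSec h𝒢 u hu ξ + 𝓔.actSec h𝒢 u hu ζ := by
  have hfin := fun p => finiteDimensional_fiber F E p
  refine Subtype.ext (funext fun p => ?_)
  refine Eq.trans ?_ (vint_add (𝓔.integrable_actIntegrand h𝒢 hu ξ p)
    (𝓔.integrable_actIntegrand h𝒢 hu ζ p))
  refine vint_congr (Filter.Eventually.of_forall fun g => ?_)
  simp [actIntegrand]

theorem actSec_smul {u : G → ℂ} (hu : IsCc (a := n + k) u) (c : ℂ) (ξ : 𝓔.Sec) :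
    𝓔.actSec h𝒢 u hu (c • ξ) = c • 𝓔.actSec h𝒢 u hu ξ := by
  have hfin := fun p => finiteDimensional_fiber F E p
  refine Subtype.ext (funext fun p => ?_)
  refine Eq.trans ?_ (vint_smul c (𝓔.actIntegrand u ξ p))
  refine vint_congr (Filter.Eventually.of_forall fun g => ?_)
  simp [actIntegrand, smul_comm c]

end Module

end EquivariantGrading

/-! ### Kernels -/

namespace EquivariantGrading

variable {n k d : ℕ} {M G P : Type*} [TopologicalSpace M] [ChartedSpace (Eu n) M]
  [IsManifold (𝓡 n) ∞ M] [T2Space M] [SecondCountableTopology M]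
  [TopologicalSpace G] [ChartedSpace (Eu (n + k)) G] [IsManifold (𝓡 (n + k)) ∞ G]
  [T2Space G] [SecondCountableTopology G] {𝒢 : LieGroupoid n k M G}
  [TopologicalSpace P] [ChartedSpace (Eu (n + d)) P] [IsManifold (𝓡 (n + d)) ∞ P]
  [T2Space P] [SecondCountableTopology P] {𝒬 : GManifold 𝒢 d P}
  {F : Type*} [NormedAddCommGroup F] [NormedSpace ℂ F] [FiniteDimensional ℂ F]
  {E : P → Type*} [∀ p, AddCommGroup (E p)] [∀ p, Module ℂ (E p)]
  [TopologicalSpace (TotalSpace F E)] [∀ p, TopologicalSpace (E p)]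
  [FiberBundle F E] [VectorBundle ℂ F E] [VectorBundle ℝ F E]
  [ContMDiffVectorBundle ∞ F E (𝓡 (n + d))]
  (𝓔 : EquivariantGrading 𝒬 F E)

/-- A family of linear maps `E_{p'} → E_p`, for `(p', p) ∈ P ×_M P`, which is smooth and whose support
is compact modulo the action of `G`. -/
structure IsKer (_ : EquivariantGrading 𝒬 F E) (T : ∀ p' p : P, E p' →ₗ[ℂ] E p) : Prop where
  smooth : ∀ (e' e : Trivialization F (Bundle.TotalSpace.proj : TotalSpace F E → P))
      [MemTrivializationAtlas e'] [MemTrivializationAtlas e] (u : F),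
    ContMDiffOn ((𝓡 (n + d)).prod (𝓡 (n + d))) 𝓘(ℝ, F) ∞
      (fun x : P × P => (e ⟨x.2, T x.1 x.2 (e'.symm x.1 u)⟩).2)
      {x | 𝒬.proj x.1 = 𝒬.proj x.2 ∧ x.1 ∈ e'.baseSet ∧ x.2 ∈ e.baseSet}
  support : ∃ C : Set (P × P), IsCompact C ∧ (∀ c ∈ C, 𝒬.proj c.1 = 𝒬.proj c.2) ∧
    ∀ p' p, 𝒬.proj p' = 𝒬.proj p → T p' p ≠ 0 →
      ∃ c ∈ C, ∃ g, 𝒬.proj c.1 = 𝒢.rng g ∧ p' = 𝒬.act c.1 g ∧ p = 𝒬.act c.2 g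

variable {𝓔}

theorem contMDiffOn_vol_vertical {U : Set P} {Y : P → Fin d → Eu (n + d)}
    (hY : IsSmoothFrameOn (vertical (a := n + d) (b := n) 𝒬.proj) U Y) :
    ContMDiffOn (𝓡 (n + d)) 𝓘(ℝ, ℝ) ∞ (fun p => vol p (Y p)) U := fun p hp =>
  contMDiffWithinAt_vol contMDiffWithinAt_id (fun j => hY.1 j p hp) (hY.2 p hp).1

/-- Divide the kernel by the fibre volume on an independent tuple. The quotient is independent of
the tuple, so smoothness follows by using a local vertical frame instead. -/
theorem exists_isKer {κ : 𝓔.Kernel} (hκ : 𝓔.IsSmoothKernel κ) :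
    ∃ T : ∀ p' p : P, E p' →ₗ[ℂ] E p, 𝓔.IsKer T ∧ ∀ p' p, 𝒬.proj p' = 𝒬.proj p →
      ∀ v, (∀ i, v i ∈ vertical (a := n + d) (b := n) 𝒬.proj p') →
        κ p' p v = (vol p' v : ℂ) • T p' p := by
  obtain ⟨h1, h2, C, hC, hC1, hC2⟩ := hκ
  have hrank := fun p => finrank_vertical 𝒬.submersion_proj p
  choose ε hε hεv using fun p => exists_independent_tuple (hrank p)
  have hpos : ∀ p, (vol p (ε p) : ℂ) ≠ 0 := fun p => by exact_mod_cast (vol_pos p (hε p)).ne'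
  have key : ∀ p' p, 𝒬.proj p' = 𝒬.proj p →
      ∀ v, (∀ i, v i ∈ vertical (a := n + d) (b := n) 𝒬.proj p') →
        κ p' p v = (vol p' v : ℂ) • ((vol p' (ε p') : ℂ)⁻¹ • κ p' p (ε p')) := by
    intro p' p hp v hv
    have h3 := (h1 p' p hp).smul_eq_smul (hrank p') (fun v _ B => vol_combination p' v B) (hε p')
      (hεv p') hv
    rw [smul_comm, ← h3, smul_smul, inv_mul_cancel₀ (hpos p'), one_smul]
  refine ⟨fun p' p => (vol p' (ε p') : ℂ)⁻¹ • κ p' p (ε p'), ⟨?_, C, hC, hC1, ?_⟩, key⟩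
  · intro e' e _ _ u x₀ hx₀
    obtain ⟨U, Y, hU, hxU, hY⟩ := exists_vertical_frame 𝒬.submersion_proj x₀.1
    have h3 := h2 e' e U Y hU hY u
    set S := {x : P × P | 𝒬.proj x.1 = 𝒬.proj x.2 ∧ x.1 ∈ U ∧ x.1 ∈ e'.baseSet ∧ x.2 ∈ e.baseSet}
    have hxS : x₀ ∈ S := ⟨hx₀.1, hxU, hx₀.2⟩
    have hYpos : ∀ x ∈ S, vol x.1 (Y x.1) ≠ 0 := fun x hx => (vol_pos x.1 (hY.2 _ hx.2.1).1).ne'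
    have h4 : ContMDiffOn ((𝓡 (n + d)).prod (𝓡 (n + d))) 𝓘(ℝ, ℝ) ∞
        (fun x : P × P => (vol x.1 (Y x.1))⁻¹) S := by
      intro x hx
      have : ContDiffAt ℝ ∞ (fun x : ℝ => x⁻¹) (vol x.1 (Y x.1)) := contDiffAt_inv ℝ (hYpos x hx)
      exact this.contMDiffAt.comp_contMDiffWithinAt x
        (((contMDiffOn_vol_vertical hY).comp contMDiffOn_fst (fun x hx => hx.2.1)) x hx)
    have h5 := contMDiffWithinAt_csmul ((Complex.ofRealCLM.contMDiff.comp_contMDiffOn h4) x₀ hxS)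
      (h3 x₀ hxS)
    have hmem : S ∈ 𝓝[{x : P × P | 𝒬.proj x.1 = 𝒬.proj x.2 ∧ x.1 ∈ e'.baseSet ∧ x.2 ∈ e.baseSet}] x₀ := by
      filter_upwards [self_mem_nhdsWithin, mem_nhdsWithin_of_mem_nhds
        ((hU.preimage continuous_fst).mem_nhds hxU)] with x hx hxu
      exact ⟨hx.1, hxu, hx.2⟩
    have hcongr : ∀ x ∈ S, (e ⟨x.2, ((vol x.1 (ε x.1) : ℂ)⁻¹ • κ x.1 x.2 (ε x.1)) (e'.symm x.1 u)⟩).2 =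
        ((vol x.1 (Y x.1))⁻¹ : ℝ) • (e ⟨x.2, κ x.1 x.2 (Y x.1) (e'.symm x.1 u)⟩).2 := by
      intro x hx
      rw [key x.1 x.2 hx.1 (Y x.1) (hY.2 _ hx.2.1).2, LinearMap.smul_apply _ (_ • _),
        ← trivMap_apply e hx.2.2.2, ← trivMap_apply e hx.2.2.2, map_smul,
        Complex.coe_smul, smul_smul, inv_mul_cancel₀ (hYpos x hx), one_smul]
    have h6 := h5.congr (fun x hx => (hcongr x hx).trans
      (Complex.coe_smul _ _).symm) ((hcongr x₀ hxS).trans (Complex.coe_smul _ _).symm)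
    exact h6.mono_of_mem_nhdsWithin hmem
  · intro p' p hp h
    exact hC2 p' p hp fun h0 => h (by rw [h0]; simp)

/-- The kernel with given coefficient with respect to the volume. -/
def mkKernel (T : ∀ p' p : P, E p' →ₗ[ℂ] E p) (p' p : P) (v : Fin d → Eu (n + d)) : E p' →ₗ[ℂ] E p :=
  open Classical in if ∀ i, v i ∈ vertical (a := n + d) (b := n) 𝒬.proj p' then
    (vol p' v : ℂ) • T p' p else 0

variable {T T' : ∀ p' p : P, E p' →ₗ[ℂ] E p}

theorem mkKernel_apply {p' p : P} {v : Fin d → Eu (n + d)}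
    (hv : ∀ i, v i ∈ vertical (a := n + d) (b := n) 𝒬.proj p') :
    mkKernel (𝒬 := 𝒬) T p' p v = (vol p' v : ℂ) • T p' p := if_pos hv

theorem isSmoothKernel_mkKernel (hT : 𝓔.IsKer T) : 𝓔.IsSmoothKernel (mkKernel (𝒬 := 𝒬) T) := by
  obtain ⟨C, hC, hC1, hC2⟩ := hT.support
  refine ⟨fun p' p _ => ⟨fun v ⟨i, hi⟩ => if_neg fun h => hi (h i), fun v hv B => ?_⟩,
    fun e' e _ _ U Y hU hY u => ?_, C, hC, hC1, fun p' p hp h => hC2 p' p hp fun h0 => h ?_⟩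
  · have h : ∀ i, ∑ j, B i j • v j ∈ vertical (a := n + d) (b := n) 𝒬.proj p' := fun i =>
      Submodule.sum_mem _ fun j _ => Submodule.smul_mem _ _ (hv j)
    rw [mkKernel_apply hv, mkKernel_apply h, vol_combination, smul_smul, Complex.ofReal_mul]
  · intro x hx
    have h1 := ((hT.smooth e' e u) x ⟨hx.1, hx.2.2⟩).mono
      (show {x : P × P | 𝒬.proj x.1 = 𝒬.proj x.2 ∧ x.1 ∈ U ∧ x.1 ∈ e'.baseSet ∧ x.2 ∈ e.baseSet} ⊆ _
        from fun y hy => ⟨hy.1, hy.2.2⟩)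
    have h2 := contMDiffWithinAt_csmul ((Complex.ofRealCLM.contMDiff.comp_contMDiffOn
      ((contMDiffOn_vol_vertical hY).comp contMDiffOn_fst (fun y hy => hy.2.1))) x hx) h1
    have h3 : ∀ y ∈ {x : P × P | 𝒬.proj x.1 = 𝒬.proj x.2 ∧ x.1 ∈ U ∧ x.1 ∈ e'.baseSet ∧
        x.2 ∈ e.baseSet}, (e ⟨y.2, mkKernel (𝒬 := 𝒬) T y.1 y.2 (Y y.1) (e'.symm y.1 u)⟩).2 =
        (vol y.1 (Y y.1) : ℂ) • (e ⟨y.2, T y.1 y.2 (e'.symm y.1 u)⟩).2 := by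
      intro y hy
      rw [mkKernel_apply (hY.2 _ hy.2.1).2, LinearMap.smul_apply, ← trivMap_apply e hy.2.2.2,
        map_smul, trivMap_apply]
    exact h2.congr h3 (h3 x hx)
  · funext v
    simp [mkKernel, h0]

theorem IsKer.add (hT : 𝓔.IsKer T) (hT' : 𝓔.IsKer T') : 𝓔.IsKer (fun p' p => T p' p + T' p' p) := by
  obtain ⟨C, hC, hC1, hC2⟩ := hT.support
  obtain ⟨C', hC', hC1', hC2'⟩ := hT'.support
  refine ⟨fun e' e _ _ u => ((hT.smooth e' e u).add (hT'.smooth e' e u)).congr fun x hx => ?_,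
    C ∪ C', hC.union hC', ?_, fun p' p hp h => ?_⟩
  · rw [LinearMap.add_apply, ← trivMap_apply e hx.2.2, map_add]
    rfl
  · rintro c (hc | hc)
    exacts [hC1 c hc, hC1' c hc]
  · by_cases h0 : T p' p = 0
    · obtain ⟨c, hc, hh⟩ := hC2' p' p hp fun h1 => h (by rw [h0, h1, add_zero])
      exact ⟨c, Or.inr hc, hh⟩
    · obtain ⟨c, hc, hh⟩ := hC2 p' p hp h0
      exact ⟨c, Or.inl hc, hh⟩

theorem IsKer.smul (hT : 𝓔.IsKer T) (c : ℂ) : 𝓔.IsKer (fun p' p => c • T p' p) := by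
  obtain ⟨C, hC, hC1, hC2⟩ := hT.support
  refine ⟨fun e' e _ _ u x hx => ?_, C, hC, hC1, fun p' p hp h => hC2 p' p hp fun h0 => h ?_⟩
  · refine (contMDiffWithinAt_csmul (contMDiffWithinAt_const (c := c)) (hT.smooth e' e u x hx)).congr
      (fun y hy => ?_) ?_
    · rw [LinearMap.smul_apply, ← trivMap_apply e hy.2.2, map_smul, trivMap_apply]
    · rw [LinearMap.smul_apply, ← trivMap_apply e hx.2.2, map_smul, trivMap_apply]
  · rw [h0, smul_zero]

variable (𝓔) in
theorem isKer_zero : 𝓔.IsKer (fun _ _ => 0) := by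
  refine ⟨fun e' e _ _ u => ?_, ∅, isCompact_empty, by simp, fun p' p _ h => absurd rfl h⟩
  refine (contMDiffOn_const (c := (0 : F))).congr fun x hx => ?_
  rw [LinearMap.zero_apply, ← trivMap_apply e hx.2.2, map_zero]

section Apply

variable {EQ HQ Q : Type*} [NormedAddCommGroup EQ] [NormedSpace ℝ EQ]
  [TopologicalSpace HQ] {I : ModelWithCorners ℝ EQ HQ} [TopologicalSpace Q] [ChartedSpace HQ Q]

theorem IsKer.contMDiffWithinAt_apply (hT : 𝓔.IsKer T) {S : Set Q} {x₀ : Q} (hx₀ : x₀ ∈ S)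
    {p' p : Q → P} {s : ∀ x, E (p' x)}
    (hp : ContMDiffWithinAt I (𝓡 (n + d)) ∞ p S x₀) (hpp : ∀ x ∈ S, 𝒬.proj (p' x) = 𝒬.proj (p x))
    (hs : ContMDiffWithinAt I ((𝓡 (n + d)).prod 𝓘(ℝ, F)) ∞
      (fun x => (⟨p' x, s x⟩ : TotalSpace F E)) S x₀) :
    ContMDiffWithinAt I ((𝓡 (n + d)).prod 𝓘(ℝ, F)) ∞
      (fun x => (⟨p x, T (p' x) (p x) (s x)⟩ : TotalSpace F E)) S x₀ := by
  set e' := trivializationAt F E (p' x₀)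
  set e := trivializationAt F E (p x₀)
  have h' : p' x₀ ∈ e'.baseSet := FiberBundle.mem_baseSet_trivializationAt' _
  have h : p x₀ ∈ e.baseSet := FiberBundle.mem_baseSet_trivializationAt' _
  have hp' := ((contMDiffWithinAt_mk_iff e' h').1 hs).1
  refine contMDiffWithinAt_hom_apply (T := fun x => T (p' x) (p x)) e' e hp h' h
    (fun u => ?_) hs
  have h1 := (hT.smooth e' e u (p' x₀, p x₀) ⟨hpp x₀ hx₀, h', h⟩).comp' x₀
    (f := fun x => (p' x, p x)) (hp'.prodMk hp)
  refine h1.mono_of_mem_nhdsWithin ?_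
  filter_upwards [self_mem_nhdsWithin, hp.continuousWithinAt (e.open_baseSet.mem_nhds h),
    hp'.continuousWithinAt (e'.open_baseSet.mem_nhds h')] with x hx hx1 hx2
  exact ⟨hx, hpp x hx, hx2, hx1⟩

theorem IsKer.contMDiffOn_apply (hT : 𝓔.IsKer T) {S : Set Q} {p' p : Q → P} {s : ∀ x, E (p' x)}
    (hp : ContMDiffOn I (𝓡 (n + d)) ∞ p S) (hpp : ∀ x ∈ S, 𝒬.proj (p' x) = 𝒬.proj (p x))
    (hs : ContMDiffOn I ((𝓡 (n + d)).prod 𝓘(ℝ, F)) ∞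
      (fun x => (⟨p' x, s x⟩ : TotalSpace F E)) S) :
    ContMDiffOn I ((𝓡 (n + d)).prod 𝓘(ℝ, F)) ∞
      (fun x => (⟨p x, T (p' x) (p x) (s x)⟩ : TotalSpace F E)) S := fun x hx =>
  hT.contMDiffWithinAt_apply hx (hp x hx) hpp (hs x hx)

end Apply

/-- By properness, the arrows g carrying some second component of `C` into `L` form a compact set.
Applying them to the first components gives a compact set again. -/
theorem exists_compact_translates (hproper : 𝒬.IsProper) {C : Set (P × P)} (hC : IsCompact C)
    (hC1 : ∀ c ∈ C, 𝒬.proj c.1 = 𝒬.proj c.2) {L : Set P} (hL : IsCompact L) :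
    ∃ L' : Set P, IsCompact L' ∧ ∀ c ∈ C, ∀ g, 𝒬.proj c.1 = 𝒢.rng g → 𝒬.act c.2 g ∈ L →
      𝒬.act c.1 g ∈ L' := by
  have h1 := (𝒬.isCompact_pairs hproper (hC.image continuous_snd) hL).image continuous_snd
  have h2 : IsCompact ((C ×ˢ (Prod.snd '' {x : P × G | 𝒬.proj x.1 = 𝒢.rng x.2 ∧
      x.1 ∈ Prod.snd '' C ∧ 𝒬.act x.1 x.2 ∈ L})) ∩
      {y : (P × P) × G | 𝒬.proj y.1.1 = 𝒢.rng y.2}) :=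
    (hC.prod h1).inter_right (isClosed_eq
      (𝒬.continuous_proj.comp (continuous_fst.comp continuous_fst))
      (𝒢.continuous_rng.comp continuous_snd))
  have h3 : ContinuousOn (fun y : (P × P) × G => 𝒬.act y.1.1 y.2)
      {y | 𝒬.proj y.1.1 = 𝒢.rng y.2} :=
    𝒬.contMDiffOn_act.continuousOn.comp (f := fun y : (P × P) × G => (y.1.1, y.2))
      (by fun_prop) (fun y hy => hy)
  refine ⟨_, h2.image_of_continuousOn (h3.mono inter_subset_right), ?_⟩
  intro c hc g hg hgL
  exact ⟨(c, g), ⟨⟨hc, (c.2, g), ⟨(hC1 c hc).symm.trans hg, ⟨c, hc, rfl⟩, hgL⟩, rfl⟩, hg⟩, rfl⟩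

/-- Compact support modulo G becomes proper support: over a compact set of p, only a compact set of
p' matters. This yields the integrability and the local uniformity needed for parameter integrals.
-/
theorem IsKer.exists_compact_left (hproper : 𝒬.IsProper) (hT : 𝓔.IsKer T) {L : Set P}
    (hL : IsCompact L) : ∃ L' : Set P, IsCompact L' ∧
      ∀ p ∈ L, ∀ p', 𝒬.proj p' = 𝒬.proj p → T p' p ≠ 0 → p' ∈ L' := by
  obtain ⟨C, hC, hC1, hC2⟩ := hT.support
  obtain ⟨L', hL', h⟩ := exists_compact_translates hproper hC hC1 hL
  refine ⟨L', hL', fun p hp p' hpp h0 => ?_⟩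
  obtain ⟨c, hc, g, hg, rfl, rfl⟩ := hC2 p' p hpp h0
  exact h c hc g hg hp

theorem IsKer.exists_compact_right (hproper : 𝒬.IsProper) (hT : 𝓔.IsKer T) {L : Set P}
    (hL : IsCompact L) : ∃ L' : Set P, IsCompact L' ∧
      ∀ p' ∈ L, ∀ p, 𝒬.proj p' = 𝒬.proj p → T p' p ≠ 0 → p ∈ L' := by
  obtain ⟨C, hC, hC1, hC2⟩ := hT.support
  obtain ⟨L', hL', h⟩ := exists_compact_translates hproper (hC.image continuous_swap)
    (by rintro _ ⟨c, hc, rfl⟩; exact (hC1 c hc).symm) hL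
  refine ⟨L', hL', fun p' hp p hpp h0 => ?_⟩
  obtain ⟨c, hc, g, hg, rfl, rfl⟩ := hC2 p' p hpp h0
  exact h c.swap ⟨c, hc, rfl⟩ g ((hC1 c hc).symm.trans hg) hp

variable [MeasurableSpace P] [BorelSpace P]

variable (𝒬) in
/-- The measure on the fibre `Z_m` given by the volume. -/
abbrev _root_.GManifold.zMeas (m : M) : Measure P :=
  fibMeas 𝒬.submersion_proj (vol (a := n + d) (k := d) (N := P)) m

/-- `T` is the kernel of `K` with respect to the volume of the fibres. -/
def Represents (T : ∀ p' p : P, E p' →ₗ[ℂ] E p) (K : Module.End ℂ 𝓔.Sec) : Prop :=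
  ∀ (ξ : 𝓔.Sec) (p : P) (ℓ : E p →ₗ[ℂ] ℂ),
    ℓ ((K ξ).1 p) = ∫ q, ℓ (T q p (ξ.1 q)) ∂𝒬.zMeas (𝒬.proj p)

theorem IsKer.contMDiffOn_section (hT : 𝓔.IsKer T) (ξ : 𝓔.Sec) (p : P) :
    ContMDiffOn (𝓡 (n + d)) ((𝓡 (n + d)).prod 𝓘(ℝ, F)) ∞
      (fun q => (⟨p, T q p (ξ.1 q)⟩ : TotalSpace F E)) (𝒬.proj ⁻¹' {𝒬.proj p}) :=
  hT.contMDiffOn_apply (p' := id) (p := fun _ => p) contMDiffOn_const (fun _ hq => hq)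
    ξ.2.1.contMDiffOn

theorem IsKer.continuousOn_section (hT : 𝓔.IsKer T) (ξ : 𝓔.Sec) (p : P) (ℓ : E p →ₗ[ℂ] ℂ) :
    ContinuousOn (fun q => ℓ (T q p (ξ.1 q))) (𝒬.proj ⁻¹' {𝒬.proj p}) := fun q hq =>
  (contMDiffWithinAt_functional (hT.contMDiffOn_section ξ p q hq) ℓ).continuousWithinAt

theorem mem_of_functional_ne_zero {ξ : 𝓔.Sec} {p q : P} {ℓ : E p →ₗ[ℂ] ℂ} {L : E q →ₗ[ℂ] E p}
    (h : ℓ (L (ξ.1 q)) ≠ 0) : q ∈ closure {p | ξ.1 p ≠ 0} :=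
  subset_closure fun h0 => h (by rw [h0, map_zero, map_zero])

theorem IsKer.integrable_section (hT : 𝓔.IsKer T) (ξ : 𝓔.Sec) (p : P) (ℓ : E p →ₗ[ℂ] ℂ) :
    Integrable (fun q => ℓ (T q p (ξ.1 q))) (𝒬.zMeas (𝒬.proj p)) :=
  integrable_fibMeas 𝒬.submersion_proj (vertDensity_vol _) (hT.continuousOn_section ξ p ℓ) ξ.2.2
    fun _ _ h => mem_of_functional_ne_zero h

theorem hasKernel_iff (hT : 𝓔.IsKer T) {κ : 𝓔.Kernel} (hκ : ∀ p' p, 𝒬.proj p' = 𝒬.proj p →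
      ∀ v, (∀ i, v i ∈ vertical (a := n + d) (b := n) 𝒬.proj p') →
        κ p' p v = (vol p' v : ℂ) • T p' p) {K : Module.End ℂ 𝓔.Sec} :
    𝓔.HasKernel K κ ↔ Represents T K := by
  refine forall_congr' fun ξ => forall_congr' fun p => forall_congr' fun ℓ => ?_
  refine hasFiberIntegral_iff 𝒬.submersion_proj (vertDensity_vol _) ?_
    (hT.continuousOn_section ξ p ℓ) ξ.2.2 fun _ _ h => mem_of_functional_ne_zero h
  intro q hq v hv
  rw [hκ q p hq v hv, LinearMap.smul_apply, map_smul, smul_eq_mul, mul_comm]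

theorem mem_smoothingEnd_iff {K : Module.End ℂ 𝓔.Sec} :
    K ∈ 𝓔.smoothingEnd ↔ 𝓔.IsModuleEnd K ∧ ∃ T, 𝓔.IsKer T ∧ Represents T K := by
  refine and_congr_right fun _ => ⟨?_, ?_⟩
  · rintro ⟨κ, hκ, hK⟩
    obtain ⟨T, hT, h⟩ := exists_isKer hκ
    exact ⟨T, hT, (hasKernel_iff hT h).1 hK⟩
  · rintro ⟨T, hT, hK⟩
    exact ⟨mkKernel (𝒬 := 𝒬) T, isSmoothKernel_mkKernel hT,
      (hasKernel_iff hT fun _ _ _ _ hv => mkKernel_apply hv).2 hK⟩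

/-- Two families of linear maps into `E_p` with the same integrals against all sections agree. -/
theorem eq_of_integral_eq {p : P} {S S' : ∀ q, E q →ₗ[ℂ] E p}
    (hS : ∀ (ξ : 𝓔.Sec) (ℓ : E p →ₗ[ℂ] ℂ),
      ContinuousOn (fun q => ℓ (S q (ξ.1 q))) (𝒬.proj ⁻¹' {𝒬.proj p}))
    (hS' : ∀ (ξ : 𝓔.Sec) (ℓ : E p →ₗ[ℂ] ℂ),
      ContinuousOn (fun q => ℓ (S' q (ξ.1 q))) (𝒬.proj ⁻¹' {𝒬.proj p}))
    (h : ∀ (ξ : 𝓔.Sec) (ℓ : E p →ₗ[ℂ] ℂ), ∫ q, ℓ (S q (ξ.1 q)) ∂𝒬.zMeas (𝒬.proj p) =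
      ∫ q, ℓ (S' q (ξ.1 q)) ∂𝒬.zMeas (𝒬.proj p)) {q : P} (hq : 𝒬.proj q = 𝒬.proj p) :
    S q = S' q := by
  have hfin := fun p => finiteDimensional_fiber F E p
  refine LinearMap.ext fun v => eq_of_forall_functional fun ℓ => ?_
  obtain ⟨ξ, rfl⟩ := exists_section_through (a := n + d) (F := F) q v
  rw [← sub_eq_zero]
  refine eq_zero_of_integral_smul_fibMeas (m := 𝒬.proj p)
    (g := fun q => ℓ (S q (ξ.1 q)) - ℓ (S' q (ξ.1 q))) 𝒬.submersion_proj
    (vertDensity_vol (k := d) 𝒬.proj) ((hS ξ ℓ).sub (hS' ξ ℓ)) (fun χ hχ _ => ?_) hq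
  set ζ : 𝓔.Sec := ⟨_, mul_mem_ccSections hχ ξ⟩
  have hint : ∀ S : ∀ q, E q →ₗ[ℂ] E p,
      ContinuousOn (fun q => ℓ (S q (ζ.1 q))) (𝒬.proj ⁻¹' {𝒬.proj p}) →
      Integrable (fun q => ℓ (S q (ζ.1 q))) (𝒬.zMeas (𝒬.proj p)) := fun S hS =>
    integrable_fibMeas 𝒬.submersion_proj (vertDensity_vol _) hS ζ.2.2
      fun _ _ h => mem_of_functional_ne_zero h
  rw [← sub_eq_zero.2 (h ζ ℓ), ← integral_sub (hint S (hS ζ ℓ)) (hint S' (hS' ζ ℓ))]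
  refine integral_congr_ae (Filter.Eventually.of_forall fun q => ?_)
  simp only [ζ, map_smul, smul_eq_mul, Complex.real_smul, mul_sub]

/-- Uniqueness of the kernel on P ×_M P, which makes τ well defined and linear. -/
theorem IsKer.eq_of_represents (hT : 𝓔.IsKer T) (hT' : 𝓔.IsKer T') {K : Module.End ℂ 𝓔.Sec}
    (h : Represents T K) (h' : Represents T' K) {q p : P} (hq : 𝒬.proj q = 𝒬.proj p) :
    T q p = T' q p :=
  eq_of_integral_eq (𝓔 := 𝓔) (S := fun q => T q p) (S' := fun q => T' q p)
    (fun ξ ℓ => hT.continuousOn_section ξ p ℓ)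
    (fun ξ ℓ => hT'.continuousOn_section ξ p ℓ) (fun ξ ℓ => (h ξ p ℓ).symm.trans (h' ξ p ℓ)) hq

theorem Represents.add (hT : 𝓔.IsKer T) (hT' : 𝓔.IsKer T') {K K' : Module.End ℂ 𝓔.Sec}
    (h : Represents T K) (h' : Represents T' K') :
    Represents (fun p' p => T p' p + T' p' p) (K + K') := by
  intro ξ p ℓ
  have : ((K + K') ξ).1 p = (K ξ).1 p + (K' ξ).1 p := rfl
  rw [this, map_add, h ξ p ℓ, h' ξ p ℓ, ← integral_add (hT.integrable_section ξ p ℓ)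
    (hT'.integrable_section ξ p ℓ)]
  refine integral_congr_ae (Filter.Eventually.of_forall fun q => ?_)
  simp

theorem Represents.smul {K : Module.End ℂ 𝓔.Sec} (h : Represents T K) (c : ℂ) :
    Represents (fun p' p => c • T p' p) (c • K) := by
  intro ξ p ℓ
  have : ((c • K) ξ).1 p = c • (K ξ).1 p := rfl
  rw [this, map_smul, h ξ p ℓ, smul_eq_mul, ← integral_const_mul]
  refine integral_congr_ae (Filter.Eventually.of_forall fun q => ?_)
  simp

end EquivariantGrading

namespace EquivariantGrading

variable {n k d : ℕ} {M G P : Type*} [TopologicalSpace M] [ChartedSpace (Eu n) M]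
  [IsManifold (𝓡 n) ∞ M] [T2Space M] [SecondCountableTopology M]
  [TopologicalSpace G] [ChartedSpace (Eu (n + k)) G] [IsManifold (𝓡 (n + k)) ∞ G]
  [T2Space G] [SecondCountableTopology G] {𝒢 : LieGroupoid n k M G}
  [TopologicalSpace P] [ChartedSpace (Eu (n + d)) P] [IsManifold (𝓡 (n + d)) ∞ P]
  [T2Space P] [SecondCountableTopology P] {𝒬 : GManifold 𝒢 d P}
  {F : Type*} [NormedAddCommGroup F] [NormedSpace ℂ F] [FiniteDimensional ℂ F]
  {E : P → Type*} [∀ p, AddCommGroup (E p)] [∀ p, Module ℂ (E p)]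
  [TopologicalSpace (TotalSpace F E)] [∀ p, TopologicalSpace (E p)]
  [FiberBundle F E] [VectorBundle ℂ F E] [VectorBundle ℝ F E]
  [ContMDiffVectorBundle ∞ F E (𝓡 (n + d))]
  {𝓔 : EquivariantGrading 𝒬 F E}
  {T T' T₁ T₂ : ∀ p' p : P, E p' →ₗ[ℂ] E p}
  [MeasurableSpace P] [BorelSpace P]

/-! ### Invariance of the kernels of module endomorphisms -/

theorem IsKer.contMDiffOn_translated (hT : 𝓔.IsKer T) (ξ : 𝓔.Sec) (p : P) :
    ContMDiffOn ((𝓡 (n + d)).prod (𝓡 (n + k))) ((𝓡 (n + d)).prod 𝓘(ℝ, F)) ∞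
      (fun y : P × G => (⟨p, T y.1 p ((𝓔.lift y.1 y.2).symm (ξ.1 (𝒬.act y.1 y.2)))⟩ :
        TotalSpace F E)) {y | 𝒬.proj y.1 = 𝒬.proj p ∧ 𝒢.rng y.2 = 𝒬.proj p} := by
  have h1 : ContMDiffOn ((𝓡 (n + d)).prod (𝓡 (n + k))) ((𝓡 (n + d)).prod 𝓘(ℝ, F)) ∞
      (fun y : P × G => (⟨y.1, (𝓔.lift y.1 y.2).symm (ξ.1 (𝒬.act y.1 y.2))⟩ : TotalSpace F E))
      {y | 𝒬.proj y.1 = 𝒬.proj p ∧ 𝒢.rng y.2 = 𝒬.proj p} :=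
    (𝓔.contMDiffOn_lift_section ξ).comp (contMDiff_snd.prodMk contMDiff_fst).contMDiffOn
      (fun y hy => hy.2.trans hy.1.symm)
  exact hT.contMDiffOn_apply (p' := Prod.fst) (p := fun _ => p) contMDiffOn_const
    (fun y hy => hy.1) h1

theorem contMDiffOn_lift_section_fiber (ξ : 𝓔.Sec) (p : P) :
    ContMDiffOn (𝓡 (n + k)) ((𝓡 (n + d)).prod 𝓘(ℝ, F)) ∞
      (fun g => (⟨p, (𝓔.lift p g).symm (ξ.1 (𝒬.act p g))⟩ : TotalSpace F E))
      (𝒢.rng ⁻¹' {𝒬.proj p}) := by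
  have h : ContMDiffOn (𝓡 (n + k)) ((𝓡 (n + k)).prod (𝓡 (n + d))) ∞ (fun g : G => (g, p))
    (𝒢.rng ⁻¹' {𝒬.proj p}) := contMDiffOn_id.prodMk contMDiffOn_const
  exact (𝓔.contMDiffOn_lift_section ξ).comp h (fun _ hg => hg)

section Invariance

variable (h𝒢 : 𝒢.IsFoliationGroupoid) (hproper : 𝒬.IsProper) (hT : 𝓔.IsKer T)
  {K : Module.End ℂ 𝓔.Sec} (hK : 𝓔.IsModuleEnd K) (hTK : Represents T K)

include h𝒢 hproper hT hK hTK

/-- Commuting with the algebra implies commuting with each single translation by g. Integrated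
against an arbitrary test function of g, the two sides agree by the module property and Fubini. Both
are continuous in g on the fibre G^{π(p)}, hence equal pointwise. -/
theorem lift_symm_apply_eq_integral (ξ : 𝓔.Sec) {p : P} {g : G} (hg : 𝒬.proj p = 𝒢.rng g)
    (ℓ : E p →ₗ[ℂ] ℂ) :
    ℓ ((𝓔.lift p g).symm ((K ξ).1 (𝒬.act p g))) =
      ∫ q, ℓ (T q p ((𝓔.lift q g).symm (ξ.1 (𝒬.act q g)))) ∂𝒬.zMeas (𝒬.proj p) := by
  borelize G
  set A : G → ℂ := fun g => ℓ ((𝓔.lift p g).symm ((K ξ).1 (𝒬.act p g)))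
  set B : G → ℂ := fun g =>
    ∫ q, ℓ (T q p ((𝓔.lift q g).symm (ξ.1 (𝒬.act q g)))) ∂𝒬.zMeas (𝒬.proj p)
  have hvd := vertDensity_vol (n := n) (k := d) 𝒬.proj
  have hA : ContinuousOn A (𝒢.rng ⁻¹' {𝒬.proj p}) := fun g hg => (contMDiffWithinAt_functional
    (contMDiffOn_lift_section_fiber (K ξ) p g hg) ℓ).continuousWithinAt
  obtain ⟨L, hL, hL'⟩ := hT.exists_compact_left hproper (isCompact_singleton (x := p))
  have hh : ContMDiffOn ((𝓡 (n + d)).prod (𝓡 (n + k))) 𝓘(ℝ, ℂ) ∞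
      (fun y : P × G => ℓ (T y.1 p ((𝓔.lift y.1 y.2).symm (ξ.1 (𝒬.act y.1 y.2)))))
      {y | 𝒬.proj y.1 = 𝒬.proj p ∧ 𝒢.rng y.2 = 𝒬.proj p} := fun y hy =>
    contMDiffWithinAt_functional (hT.contMDiffOn_translated ξ p y hy) ℓ
  have hB : ContinuousOn B (𝒢.rng ⁻¹' {𝒬.proj p}) := by
    refine (contMDiffOn_integral_fibMeas (I := 𝓡 (n + k)) 𝒬.submersion_proj hvd
      (isSmoothRetract_fiber 𝒢.submersion_rng (𝒬.proj p)) (w := fun _ => 𝒬.proj p)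
      contMDiffOn_const (h := fun y : P × G =>
        ℓ (T y.1 p ((𝓔.lift y.1 y.2).symm (ξ.1 (𝒬.act y.1 y.2)))))
      (hh.mono fun y hy => ⟨hy.2, hy.1⟩) fun x _ => ⟨univ, Filter.univ_mem, L, hL, ?_⟩).continuousOn
    intro g _ q hq h
    refine hL' p rfl q hq fun h0 => h ?_
    simp only [h0, LinearMap.zero_apply, map_zero]
  rw [← sub_eq_zero]
  -- The test function χ is itself the coefficient of an element of the convolution algebra.
  refine eq_zero_of_integral_smul_fibMeas (g := fun g => A g - B g) 𝒢.submersion_rng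
    (𝒢.vertDensity_fiberVol h𝒢) (m := 𝒬.proj p) (hA.sub hB) (fun χ hχ hχc => ?_) hg.symm
  have hu := IsCc.ofReal hχ hχc
  have hint : ∀ D : G → ℂ, ContinuousOn D (𝒢.rng ⁻¹' {𝒬.proj p}) →
      Integrable (fun g => χ g • D g) (𝒢.haar (𝒬.proj p)) := fun D hD =>
    integrable_fibMeas 𝒢.submersion_rng (𝒢.vertDensity_fiberVol h𝒢)
      (hχ.continuous.continuousOn.smul hD) hχc
      fun g _ h => subset_tsupport _ (left_ne_zero_of_smul h)
  simp only [smul_sub]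
  rw [integral_sub (hint A hA) (hint B hB), sub_eq_zero]
  have e1 : ∫ g, χ g • A g ∂𝒢.haar (𝒬.proj p) = ℓ ((K (𝓔.actSec h𝒢 _ hu ξ)).1 p) := by
    rw [(𝓔.isModuleEnd_iff h𝒢).1 hK _ hu ξ, 𝓔.apply_actSec]
    refine integral_congr_ae (Filter.Eventually.of_forall fun g => ?_)
    simp only [A, actIntegrand, map_smul, smul_eq_mul, Complex.real_smul]
  have e2 : ∀ᵐ q ∂𝒬.zMeas (𝒬.proj p), ℓ (T q p ((𝓔.actSec h𝒢 _ hu ξ).1 q)) =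
      ∫ g, χ g • ℓ (T q p ((𝓔.lift q g).symm (ξ.1 (𝒬.act q g)))) ∂𝒢.haar (𝒬.proj p) := by
    filter_upwards [ae_fibMeas (lam := vol (a := n + d) (k := d) (N := P)) (m := 𝒬.proj p)
      𝒬.submersion_proj] with q hq
    have h1 := 𝓔.apply_actSec h𝒢 hu ξ q (ℓ ∘ₗ T q p)
    rw [LinearMap.comp_apply] at h1
    rw [h1, hq]
    refine integral_congr_ae (Filter.Eventually.of_forall fun g => ?_)
    simp only [LinearMap.comp_apply, actIntegrand, map_smul, smul_eq_mul, Complex.real_smul]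
  -- Both integrals are values of K(bξ) at p: one computed as b(Kξ), the other through the kernel of
  -- K. Exchanging the order of integration isolates the translated kernel integral.
  rw [e1, hTK, integral_congr_ae e2, integral_integral_swap_fibMeas 𝒬.submersion_proj hvd
    𝒢.submersion_rng (𝒢.vertDensity_fiberVol h𝒢) (C := L) (C' := tsupport χ) ?_ hL hχc ?_]
  · refine integral_congr_ae (Filter.Eventually.of_forall fun g => ?_)
    simp only [B]
    rw [integral_smul]
  · exact ((hχ.continuous.comp continuous_snd).continuousOn).smul
      (hh.continuousOn.mono fun y hy => ⟨hy.1, hy.2⟩)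
  · intro q g hq _ h
    refine ⟨hL' p rfl q hq fun h0 => h ?_, subset_tsupport _ (left_ne_zero_of_smul h)⟩
    simp only [h0, LinearMap.zero_apply, map_zero, smul_zero]

/-- The kernel of a module endomorphism is invariant under the diagonal action of `G`. -/
theorem IsKer.invariant {p q : P} {g : G} (hp : 𝒬.proj p = 𝒢.rng g) (hq : 𝒬.proj q = 𝒢.rng g)
    (v : E q) : 𝓔.lift p g (T q p v) = (GManifold.jac 𝒬 (vol (a := n + d) (N := P)) g q : ℂ) •
      T (𝒬.act q g) (𝒬.act p g) (𝓔.lift q g v) := by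
  have hfin := fun p => finiteDimensional_fiber F E p
  have hvd := vertDensity_vol (n := n) (k := d) 𝒬.proj
  set J := GManifold.jac 𝒬 (vol (a := n + d) (k := d) (N := P)) g
  have hpg := 𝒬.proj_act p g hp
  suffices h : T q p v = (J q : ℂ) • (𝓔.lift p g).symm
      (T (𝒬.act q g) (𝒬.act p g) (𝓔.lift q g v)) by
    rw [h, map_smul, LinearEquiv.apply_symm_apply]
  refine eq_of_forall_functional fun ℓ => ?_
  obtain ⟨ξ, hξ⟩ := exists_section_through (a := n + d) (F := F) (𝒬.act q g) (𝓔.lift q g v)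
  set L : 𝓔.Sec → P → ℂ := fun ξ q => ℓ (T q p ((𝓔.lift q g).symm (ξ.1 (𝒬.act q g))))
  set R : 𝓔.Sec → P → ℂ := fun ξ y => ℓ ((𝓔.lift p g).symm (T y (𝒬.act p g) (ξ.1 y)))
  -- `L` lives on the fibre over r(g) and `R` on the one over s(g). `D` is `L` carried to the
  -- latter, divided by the Jacobian so that the change of variables turns its integral back into
  -- that of `L`.
  set D : 𝓔.Sec → P → ℂ := fun ξ y => (J (𝒬.act y (𝒢.inv g)))⁻¹ • L ξ (𝒬.act y (𝒢.inv g))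
  have hmaps : MapsTo (fun y => 𝒬.act y (𝒢.inv g)) (𝒬.proj ⁻¹' {𝒢.src g}) (𝒬.proj ⁻¹' {𝒢.rng g}) :=
    fun y hy => 𝒬.proj_act_inv hy
  have hL : ∀ ξ, ContinuousOn (L ξ) (𝒬.proj ⁻¹' {𝒢.rng g}) := by
    intro ξ q hq
    have h1 : ContMDiffOn (𝓡 (n + d)) ((𝓡 (n + d)).prod (𝓡 (n + k))) ∞ (fun q : P => (q, g))
      (𝒬.proj ⁻¹' {𝒢.rng g}) := contMDiffOn_id.prodMk contMDiffOn_const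
    have h2 : ContMDiffOn (𝓡 (n + d)) ((𝓡 (n + d)).prod 𝓘(ℝ, F)) ∞
        (fun q => (⟨p, T q p ((𝓔.lift q g).symm (ξ.1 (𝒬.act q g)))⟩ : TotalSpace F E))
        (𝒬.proj ⁻¹' {𝒢.rng g}) :=
      (hT.contMDiffOn_translated ξ p).comp h1 (fun q hq => ⟨(hq : _ = _).trans hp.symm, hp.symm⟩)
    exact (contMDiffWithinAt_functional (h2 q hq) ℓ).continuousWithinAt
  have hR : ∀ ξ, ContinuousOn (R ξ) (𝒬.proj ⁻¹' {𝒢.src g}) := fun ξ => by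
    have := hT.continuousOn_section ξ (𝒬.act p g) (ℓ ∘ₗ (𝓔.lift p g).symm.toLinearMap)
    rwa [hpg] at this
  have hJ := (GManifold.continuousOn_jac (𝒬 := 𝒬) hvd g)
  have hJ0 : ∀ q, 𝒬.proj q = 𝒢.rng g → J q ≠ 0 := fun q hq => (GManifold.jac_pos hvd hq).ne'
  have hD : ∀ ξ, ContinuousOn (D ξ) (𝒬.proj ⁻¹' {𝒢.src g}) := fun ξ =>
    ((hJ.inv₀ hJ0).comp (𝒬.continuousOn_act_inv g) hmaps).smul
      ((hL ξ).comp (𝒬.continuousOn_act_inv g) hmaps)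
  have hDs : ∀ ξ y, 𝒬.proj y = 𝒢.src g → D ξ y ≠ 0 → y ∈ closure {p | ξ.1 p ≠ 0} := by
    intro ξ y hy h
    refine subset_closure fun h0 => h ?_
    have h1 : ξ.1 (𝒬.act (𝒬.act y (𝒢.inv g)) g) = 0 := by rw [𝒬.act_inv' hy, h0]
    simp only [D, L, h1, map_zero, smul_zero]
  have hRs : ∀ ξ y, R ξ y ≠ 0 → y ∈ closure {p | ξ.1 p ≠ 0} := by
    intro ξ y h
    refine subset_closure fun h0 => h ?_
    simp only [R, h0, map_zero]
  have hDL : ∀ ξ q, 𝒬.proj q = 𝒢.rng g → J q • D ξ (𝒬.act q g) = L ξ q := by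
    intro ξ q hq
    simp only [D]
    rw [𝒬.act_inv hq, smul_smul, mul_inv_cancel₀ (hJ0 q hq), one_smul]
  have hint : ∀ ξ, ∫ y, D ξ y ∂𝒬.zMeas (𝒢.src g) = ∫ y, R ξ y ∂𝒬.zMeas (𝒢.src g) := by
    intro ξ
    have h1 := lift_symm_apply_eq_integral h𝒢 hproper hT hK hTK ξ hp ℓ
    have h2 := hTK ξ (𝒬.act p g) (ℓ ∘ₗ (𝓔.lift p g).symm.toLinearMap)
    rw [hpg] at h2
    rw [GManifold.integral_translate hvd g (hD ξ) ξ.2.2 (hDs ξ)]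
    refine Eq.trans ?_ h2
    refine Eq.trans ?_ h1.symm
    rw [hp]
    refine integral_congr_ae ?_
    filter_upwards [ae_fibMeas (lam := vol (a := n + d) (k := d) (N := P)) (m := 𝒢.rng g)
      𝒬.submersion_proj] with q hq
    exact hDL ξ q hq
  -- Replacing ξ by χξ multiplies both integrands by χ, so equality of the integrals for all
  -- sections forces pointwise equality.
  have key : D ξ (𝒬.act q g) - R ξ (𝒬.act q g) = 0 := by
    refine eq_zero_of_integral_smul_fibMeas (m := 𝒢.src g) (g := fun y => D ξ y - R ξ y)
      𝒬.submersion_proj hvd ((hD ξ).sub (hR ξ)) (fun χ hχ _ => ?_) (𝒬.proj_act q g hq)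
    set ζ : 𝓔.Sec := ⟨_, mul_mem_ccSections hχ ξ⟩
    rw [← sub_eq_zero.2 (hint ζ), ← integral_sub
      (integrable_fibMeas 𝒬.submersion_proj hvd (hD ζ) ζ.2.2 (hDs ζ))
      (integrable_fibMeas 𝒬.submersion_proj hvd (hR ζ) ζ.2.2 (fun y _ => hRs ζ y))]
    refine integral_congr_ae ?_
    filter_upwards [ae_fibMeas (lam := vol (a := n + d) (k := d) (N := P)) (m := 𝒢.src g)
      𝒬.submersion_proj] with y hy
    have h1 : χ (𝒬.act (𝒬.act y (𝒢.inv g)) g) = χ y := by rw [𝒬.act_inv' hy]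
    simp only [D, L, R, ζ, map_smul, smul_eq_mul, Complex.real_smul, mul_sub, h1]
    ring
  have h3 := hDL ξ q hq
  rw [sub_eq_zero.1 key] at h3
  simp only [L, R, hξ, LinearEquiv.symm_apply_apply] at h3
  rw [← h3, map_smul, Complex.real_smul, smul_eq_mul]

end Invariance

/-! ### Composition of kernels -/

variable (F) in
include F in
theorem finiteDimensional_hom (p' p : P) : FiniteDimensional ℂ (E p' →ₗ[ℂ] E p) := by
  have hfin := fun p => finiteDimensional_fiber F E p
  infer_instance

/-- The composition of kernels. -/
def compKer (_ : EquivariantGrading 𝒬 F E) (T₁ T₂ : ∀ p' p : P, E p' →ₗ[ℂ] E p) (p' p : P) : E p' →ₗ[ℂ] E p :=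
  have := finiteDimensional_hom (E := E) F p' p
  vint (𝒬.zMeas (𝒬.proj p)) (fun q => T₁ q p ∘ₗ T₂ p' q)

theorem exists_compKer_ne_zero {p' p : P} (h : 𝓔.compKer T₁ T₂ p' p ≠ 0) :
    ∃ q, 𝒬.proj q = 𝒬.proj p ∧ T₁ q p ≠ 0 ∧ T₂ p' q ≠ 0 := by
  by_contra! hc
  have := finiteDimensional_hom (E := E) F p' p
  refine h (vint_eq_zero ?_)
  filter_upwards [ae_fibMeas (lam := vol (a := n + d) (k := d) (N := P)) (m := 𝒬.proj p)
      𝒬.submersion_proj] with q hq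
  by_cases h1 : T₁ q p = 0
  · rw [h1, LinearMap.zero_comp]
  · rw [hc q hq h1, LinearMap.comp_zero]

section Composition

variable (hproper : 𝒬.IsProper) (hT₁ : 𝓔.IsKer T₁) (hT₂ : 𝓔.IsKer T₂)

include hT₁ hT₂ in
theorem IsKer.contMDiffOn_comp_apply {EQ HQ Q : Type*} [NormedAddCommGroup EQ] [NormedSpace ℝ EQ]
    [TopologicalSpace HQ] {I : ModelWithCorners ℝ EQ HQ} [TopologicalSpace Q] [ChartedSpace HQ Q]
    {S : Set Q} {p' q p : Q → P} {s : ∀ x, E (p' x)}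
    (hq : ContMDiffOn I (𝓡 (n + d)) ∞ q S)
    (hp : ContMDiffOn I (𝓡 (n + d)) ∞ p S) (hpq : ∀ x ∈ S, 𝒬.proj (p' x) = 𝒬.proj (q x))
    (hqp : ∀ x ∈ S, 𝒬.proj (q x) = 𝒬.proj (p x))
    (hs : ContMDiffOn I ((𝓡 (n + d)).prod 𝓘(ℝ, F)) ∞
      (fun x => (⟨p' x, s x⟩ : TotalSpace F E)) S) :
    ContMDiffOn I ((𝓡 (n + d)).prod 𝓘(ℝ, F)) ∞
      (fun x => (⟨p x, T₁ (q x) (p x) (T₂ (p' x) (q x) (s x))⟩ : TotalSpace F E)) S :=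
  hT₁.contMDiffOn_apply hp hqp (hT₂.contMDiffOn_apply hq hpq hs)

include hproper hT₁ hT₂

theorem integrable_comp_apply {p' p : P} (hpp : 𝒬.proj p' = 𝒬.proj p) (v : E p') (ℓ : E p →ₗ[ℂ] ℂ) :
    Integrable (fun q => ℓ ((T₁ q p ∘ₗ T₂ p' q) v)) (𝒬.zMeas (𝒬.proj p)) := by
  obtain ⟨L, hL, hL'⟩ := hT₁.exists_compact_left hproper (isCompact_singleton (x := p))
  have hc : ContMDiffOn (𝓡 (n + d)) ((𝓡 (n + d)).prod 𝓘(ℝ, F)) ∞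
      (fun _ : P => (⟨p', v⟩ : TotalSpace F E)) (𝒬.proj ⁻¹' {𝒬.proj p}) := contMDiffOn_const
  have h : ContMDiffOn (𝓡 (n + d)) ((𝓡 (n + d)).prod 𝓘(ℝ, F)) ∞
      (fun q => (⟨p, T₁ q p (T₂ p' q v)⟩ : TotalSpace F E)) (𝒬.proj ⁻¹' {𝒬.proj p}) :=
    hT₁.contMDiffOn_comp_apply hT₂ (p' := fun _ => p') (q := id) (p := fun _ => p)
      (s := fun _ => v) contMDiffOn_id contMDiffOn_const (fun q hq => hpp.trans (hq : _ = _).symm)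
      (fun q hq => hq) hc
  refine integrable_functional (F := F) 𝒬.submersion_proj (vertDensity_vol _)
    (s := fun q => (T₁ q p ∘ₗ T₂ p' q) v) h hL (fun q hq h => hL' p rfl q hq fun h0 => h ?_) ℓ
  rw [h0, LinearMap.zero_comp, LinearMap.zero_apply]

/-- Matrix coefficients are integrable by proper support, so all functionals on Hom(E_{p'}, E_p)
pass through the integral. -/
theorem apply_compKer {p' p : P} (hpp : 𝒬.proj p' = 𝒬.proj p) (Λ : (E p' →ₗ[ℂ] E p) →ₗ[ℂ] ℂ) :
    Λ (𝓔.compKer T₁ T₂ p' p) = ∫ q, Λ (T₁ q p ∘ₗ T₂ p' q) ∂𝒬.zMeas (𝒬.proj p) := by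
  have hfin := fun p => finiteDimensional_fiber F E p
  exact map_vint (integrable_dual_hom (integrable_comp_apply hproper hT₁ hT₂ hpp)) Λ

/-- Smoothness is that of a bundle-valued fibre integral over the retract P ×_M P, with local
compactness of the support supplied by the first kernel. For the support, a nonzero value needs a
common intermediate point q; properness bounds the arrow that matches the two compact sets there. -/
theorem isKer_compKer : 𝓔.IsKer (𝓔.compKer T₁ T₂) := by
  have hfin := fun p => finiteDimensional_fiber F E p
  constructor
  · intro e' e _ _ u
    set S : Set (P × P) := {x | 𝒬.proj x.1 = 𝒬.proj x.2 ∧ x.1 ∈ e'.baseSet ∧ x.2 ∈ e.baseSet}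
    have hS : IsSmoothRetract ((𝓡 (n + d)).prod (𝓡 (n + d))) S :=
      (isSmoothRetract_fiberProduct 𝒬.submersion_proj 𝒬.submersion_proj.contMDiff).inter_open
        (e'.open_baseSet.prod e.open_baseSet)
    have h1 : ContMDiffOn ((𝓡 (n + d)).prod ((𝓡 (n + d)).prod (𝓡 (n + d))))
        ((𝓡 (n + d)).prod 𝓘(ℝ, F)) ∞
        (fun y : P × P × P => (⟨y.2.2, T₁ y.1 y.2.2 (T₂ y.2.1 y.1 (e'.symm y.2.1 u))⟩ :
          TotalSpace F E)) {y | y.2 ∈ S ∧ 𝒬.proj y.1 = 𝒬.proj y.2.2} := by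
      refine hT₁.contMDiffOn_comp_apply hT₂ (p' := fun y : P × P × P => y.2.1) (q := Prod.fst)
        (p := fun y => y.2.2) contMDiffOn_fst (contMDiff_snd.comp contMDiff_snd).contMDiffOn
        (fun y hy => hy.1.1.trans hy.2.symm) (fun y hy => hy.2) fun y hy => ?_
      exact contMDiffWithinAt_symm e' ((contMDiff_fst.comp contMDiff_snd).contMDiffOn y hy)
        hy.1.2.1 u
    have h2 := contMDiffOn_vint (I := (𝓡 (n + d)).prod (𝓡 (n + d))) 𝒬.submersion_proj
      (vertDensity_vol 𝒬.proj) hS (w := fun x => 𝒬.proj x.2) (p := fun x => x.2)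
      (s := fun x q => T₁ q x.2 (T₂ x.1 q (e'.symm x.1 u)))
      (𝒬.submersion_proj.contMDiff.comp contMDiff_snd).contMDiffOn contMDiffOn_snd h1 (by
        intro x _
        have hloc := locallyCompactSpace_of_euclidean (n + d) P
        obtain ⟨O, hO, hxO⟩ := exists_compact_mem_nhds x.2
        obtain ⟨L, hL, hL'⟩ := hT₁.exists_compact_left hproper hO
        refine ⟨Prod.snd ⁻¹' O, continuous_snd.continuousAt.preimage_mem_nhds hxO, L, hL,
          fun y hy q hq h => hL' _ hy.1 q hq fun h0 => h ?_⟩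
        rw [h0, LinearMap.zero_apply])
    intro x hx
    refine ((contMDiffWithinAt_mk_iff e hx.2.2).1 (h2 x hx)).2.congr (fun y hy => ?_) ?_
    all_goals
      congr 2
      refine congrArg _ (eq_of_forall_functional fun ℓ => ?_)
    · have e1 := apply_compKer hproper hT₁ hT₂ hy.1
        (ℓ ∘ₗ LinearMap.applyₗ (e'.symm y.1 u))
      exact e1.trans (map_vint (integrable_comp_apply hproper hT₁ hT₂ hy.1 _) ℓ).symm
    · have e1 := apply_compKer hproper hT₁ hT₂ hx.1
        (ℓ ∘ₗ LinearMap.applyₗ (e'.symm x.1 u))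
      exact e1.trans (map_vint (integrable_comp_apply hproper hT₁ hT₂ hx.1 _) ℓ).symm
  · obtain ⟨C₁, hC₁, hC₁', h₁⟩ := hT₁.support
    obtain ⟨C₂, hC₂, hC₂', h₂⟩ := hT₂.support
    -- The arrows moving a second component of `C₂` to a first component of `C₁`: these are the
    -- possible mismatches at the intermediate point.
    set A : Set G := Prod.snd '' {x : P × G | 𝒬.proj x.1 = 𝒢.rng x.2 ∧ x.1 ∈ Prod.snd '' C₂ ∧
      𝒬.act x.1 x.2 ∈ Prod.fst '' C₁}
    have hA : IsCompact A := (𝒬.isCompact_pairs hproper (hC₂.image continuous_snd)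
      (hC₁.image continuous_fst)).image continuous_snd
    set B : Set (((P × P) × G) × (P × P)) := ((C₂ ×ˢ A) ×ˢ C₁) ∩
      {y | 𝒬.proj y.1.1.1 = 𝒢.rng y.1.2 ∧ 𝒢.src y.1.2 = 𝒬.proj y.2.2}
    have hcl : IsClosed {y : ((P × P) × G) × (P × P) | 𝒬.proj y.1.1.1 = 𝒢.rng y.1.2 ∧
        𝒢.src y.1.2 = 𝒬.proj y.2.2} := by
      have h1 := 𝒬.continuous_proj
      have h2 := 𝒢.continuous_src
      have h3 := 𝒢.continuous_rng
      exact (isClosed_eq (by fun_prop) (by fun_prop)).inter (isClosed_eq (by fun_prop) (by fun_prop))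
    have hB : IsCompact B := ((hC₂.prod hA).prod hC₁).inter_right hcl
    have hcont : ContinuousOn (fun y : ((P × P) × G) × (P × P) => (𝒬.act y.1.1.1 y.1.2, y.2.2)) B := by
      refine ContinuousOn.prodMk ?_ (by fun_prop)
      exact 𝒬.contMDiffOn_act.continuousOn.comp
        (f := fun y : ((P × P) × G) × (P × P) => (y.1.1.1, y.1.2)) (by fun_prop)
        (fun y hy => hy.2.1)
    refine ⟨_, hB.image_of_continuousOn hcont, ?_, fun p' p hpp h => ?_⟩
    · rintro _ ⟨y, hy, rfl⟩
      exact (𝒬.proj_act _ _ hy.2.1).trans hy.2.2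
    · obtain ⟨q, hq, hn₁, hn₂⟩ := exists_compKer_ne_zero h
      obtain ⟨c, hc, g, hg, hqg, hpg⟩ := h₁ q p hq hn₁
      obtain ⟨c', hc', g', hg', hpg', hqg'⟩ := h₂ p' q (hpp.trans hq.symm) hn₂
      have hs : 𝒢.src g = 𝒢.src g' := by
        rw [← 𝒬.proj_act _ _ hg, ← hqg, hqg', 𝒬.proj_act _ _ ((hC₂' c' hc').symm.trans hg')]
      have hcomp : 𝒢.src g' = 𝒢.rng (𝒢.inv g) := by rw [𝒢.rng_inv, hs]
      -- With q = c₁g = c'₂g', the arrow a = g'g⁻¹ satisfies c'₂a = c₁. Then (p', p) is the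
      -- translate by g of (c'₁a, c₂), a pair from the compact set.
      set a := 𝒢.mul g' (𝒢.inv g)
      have hra : 𝒢.rng a = 𝒢.rng g' := 𝒢.rng_mul _ _ hcomp
      have hsa : 𝒢.src a = 𝒢.rng g := by rw [𝒢.src_mul _ _ hcomp, 𝒢.src_inv]
      have hc2 : 𝒬.proj c'.2 = 𝒢.rng g' := (hC₂' c' hc').symm.trans hg'
      have hact : 𝒬.act c'.2 a = c.1 := by
        rw [← 𝒬.act_mul _ _ _ hc2 hcomp, ← hqg', hqg, 𝒬.act_inv hg]
      have hag : 𝒢.mul a g = g' := by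
        rw [𝒢.mul_assoc _ _ _ hcomp (by rw [𝒢.src_inv]), 𝒢.inv_mul, hs, 𝒢.mul_unit]
      refine ⟨(𝒬.act c'.1 a, c.2), ⟨((c', a), c), ⟨⟨⟨hc', (c'.2, a), ⟨hc2.trans hra.symm,
        ⟨c', hc', rfl⟩, ⟨c, hc, hact.symm⟩⟩, rfl⟩, hc⟩, hg'.trans hra.symm, ?_⟩, rfl⟩, g, ?_, ?_, hpg⟩
      · exact hsa.trans (hg.symm.trans (hC₁' c hc))
      · exact (𝒬.proj_act _ _ (hg'.trans hra.symm)).trans hsa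
      · rw [𝒬.act_mul _ _ _ (hg'.trans hra.symm) hsa, hag, hpg']

/-- Fubini on Z × Z: proper support of the first kernel bounds the intermediate point, and the
support of ξ bounds the other. -/
theorem Represents.comp {K₁ K₂ : Module.End ℂ 𝓔.Sec} (h₁ : Represents T₁ K₁)
    (h₂ : Represents T₂ K₂) : Represents (𝓔.compKer T₁ T₂) (K₁ * K₂) := by
  intro ξ p ℓ
  have hvd := vertDensity_vol (n := n) (k := d) 𝒬.proj
  obtain ⟨L, hL, hL'⟩ := hT₁.exists_compact_left hproper (isCompact_singleton (x := p))
  have e1 : ∀ᵐ q ∂𝒬.zMeas (𝒬.proj p), ℓ (T₁ q p ((K₂ ξ).1 q)) =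
      ∫ p', ℓ (T₁ q p (T₂ p' q (ξ.1 p'))) ∂𝒬.zMeas (𝒬.proj p) := by
    filter_upwards [ae_fibMeas (lam := vol (a := n + d) (k := d) (N := P)) (m := 𝒬.proj p)
      𝒬.submersion_proj] with q hq
    have := h₂ ξ q (ℓ ∘ₗ T₁ q p)
    rw [hq] at this
    exact this
  have e2 : ∀ᵐ p' ∂𝒬.zMeas (𝒬.proj p), ℓ (𝓔.compKer T₁ T₂ p' p (ξ.1 p')) =
      ∫ q, ℓ (T₁ q p (T₂ p' q (ξ.1 p'))) ∂𝒬.zMeas (𝒬.proj p) := by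
    filter_upwards [ae_fibMeas (lam := vol (a := n + d) (k := d) (N := P)) (m := 𝒬.proj p)
      𝒬.submersion_proj] with p' hp'
    exact apply_compKer hproper hT₁ hT₂ hp' (ℓ ∘ₗ LinearMap.applyₗ (ξ.1 p'))
  change ℓ ((K₁ (K₂ ξ)).1 p) = _
  rw [h₁, integral_congr_ae e1, integral_congr_ae e2]
  refine integral_integral_swap_fibMeas 𝒬.submersion_proj hvd 𝒬.submersion_proj hvd (C := L)
    (C' := closure {p | ξ.1 p ≠ 0}) ?_ hL ξ.2.2 ?_
  · have h3 : ContMDiffOn ((𝓡 (n + d)).prod (𝓡 (n + d))) ((𝓡 (n + d)).prod 𝓘(ℝ, F)) ∞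
        (fun y : P × P => (⟨p, T₁ y.1 p (T₂ y.2 y.1 (ξ.1 y.2))⟩ : TotalSpace F E))
        ((𝒬.proj ⁻¹' {𝒬.proj p}) ×ˢ (𝒬.proj ⁻¹' {𝒬.proj p})) :=
      hT₁.contMDiffOn_comp_apply hT₂ (p' := Prod.snd) (q := Prod.fst) (p := fun _ => p)
        contMDiffOn_fst contMDiffOn_const (fun y hy => (hy.2 : _ = _).trans (hy.1 : _ = _).symm)
        (fun y hy => hy.1) (ξ.2.1.comp_contMDiffOn contMDiffOn_snd)
    exact fun y hy => (contMDiffWithinAt_functional (h3 y hy) ℓ).continuousWithinAt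
  · intro q p' hq _ h
    refine ⟨hL' p rfl q hq fun h0 => h ?_, subset_closure fun h0 => h ?_⟩
    · rw [h0, LinearMap.zero_apply, map_zero]
    · rw [h0, map_zero, map_zero, map_zero]

end Composition

end EquivariantGrading

/-! ### Correlations of functions on a proper `G`-manifold -/

namespace GManifold

variable {n k d : ℕ} {M G P : Type*} [TopologicalSpace M] [ChartedSpace (Eu n) M]
  [IsManifold (𝓡 n) ∞ M] [T2Space M] [SecondCountableTopology M]
  [TopologicalSpace G] [ChartedSpace (Eu (n + k)) G] [IsManifold (𝓡 (n + k)) ∞ G]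
  [T2Space G] [SecondCountableTopology G] {𝒢 : LieGroupoid n k M G}
  [TopologicalSpace P] [ChartedSpace (Eu (n + d)) P] [IsManifold (𝓡 (n + d)) ∞ P]
  [T2Space P] [SecondCountableTopology P] (𝒬 : GManifold 𝒢 d P)

/-- A smooth function on `P ×_M P` which is properly supported and such that its product with the
square root of the volume of `Z × Z` is invariant under the diagonal action of `G`. -/
structure IsInvariantPair (H : P → P → ℂ) : Prop where
  smooth : ContMDiffOn ((𝓡 (n + d)).prod (𝓡 (n + d))) 𝓘(ℝ, ℂ) ∞ (fun x : P × P => H x.1 x.2)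
    {x | 𝒬.proj x.1 = 𝒬.proj x.2}
  compact_left : ∀ L : Set P, IsCompact L → ∃ L' : Set P, IsCompact L' ∧
    ∀ p ∈ L, ∀ q, 𝒬.proj q = 𝒬.proj p → H q p ≠ 0 → q ∈ L'
  compact_right : ∀ L : Set P, IsCompact L → ∃ L' : Set P, IsCompact L' ∧
    ∀ q ∈ L, ∀ p, 𝒬.proj q = 𝒬.proj p → H q p ≠ 0 → p ∈ L'
  invariant : ∀ (q p : P) (g : G), 𝒬.proj q = 𝒢.rng g → 𝒬.proj p = 𝒢.rng g →
    (jac 𝒬 (vol (a := n + d) (N := P)) g q : ℂ) * (jac 𝒬 (vol (a := n + d) (N := P)) g p : ℂ) *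
      H (𝒬.act q g) (𝒬.act p g) = H q p

variable {𝒬}

theorem IsInvariantPair.swap {H : P → P → ℂ} (hH : 𝒬.IsInvariantPair H) :
    𝒬.IsInvariantPair (fun q p => H p q) where
  smooth := hH.smooth.comp (contMDiff_snd.prodMk contMDiff_fst).contMDiffOn fun _ hx => Eq.symm hx
  compact_left L hL := by
    obtain ⟨L', hL', h⟩ := hH.compact_right L hL
    exact ⟨L', hL', fun p hp q hq => h p hp q hq.symm⟩
  compact_right L hL := by
    obtain ⟨L', hL', h⟩ := hH.compact_left L hL
    exact ⟨L', hL', fun p hp q hq => h p hp q hq.symm⟩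
  invariant q p g hq hp := by rw [← hH.invariant p q g hp hq]; ring

variable [MeasurableSpace P] [BorelSpace P]

variable (𝒬) in
theorem isCc_integral_zMeas {u : P → ℂ} (hu : IsCc (a := n + d) u) :
    IsCc (a := n) (fun m => ∫ p, u p ∂𝒬.zMeas m) := by
  constructor
  · rw [← contMDiffOn_univ]
    refine contMDiffOn_integral_fibMeas (I := 𝓡 n) 𝒬.submersion_proj (vertDensity_vol _)
      isSmoothRetract_univ (w := id) contMDiffOn_id (h := fun y => u y.1)
      (hu.1.comp contMDiff_fst).contMDiffOn fun _ _ =>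
      ⟨univ, Filter.univ_mem, tsupport u, hu.2, fun _ _ _ _ h => subset_tsupport _ h⟩
  · refine HasCompactSupport.intro (hu.2.isCompact.image 𝒬.continuous_proj) fun m hm => ?_
    refine integral_eq_zero_of_ae ?_
    filter_upwards [ae_fibMeas (lam := vol (a := n + d) (k := d) (N := P)) (m := m)
      𝒬.submersion_proj] with p hp
    by_contra h
    exact hm ⟨p, subset_tsupport _ h, hp⟩

variable (𝒬) in
/-- The correlation `g ↦ ∫_{Z_{r(g)}} u(q) v(q g)`. -/
def corr (u v : P → ℂ) (g : G) : ℂ := ∫ q, u q * v (𝒬.act q g) ∂𝒬.zMeas (𝒢.rng g)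

theorem contMDiffOn_corr_integrand {u v : P → ℂ} (hu : IsCc (a := n + d) u)
    (hv : IsCc (a := n + d) v) :
    ContMDiffOn ((𝓡 (n + d)).prod (𝓡 (n + k))) 𝓘(ℝ, ℂ) ∞
      (fun y : P × G => u y.1 * v (𝒬.act y.1 y.2)) {y | 𝒬.proj y.1 = 𝒢.rng y.2} :=
  contMDiffOn_cmul (hu.1.comp contMDiff_fst).contMDiffOn (hv.1.comp_contMDiffOn 𝒬.contMDiffOn_act)

variable (hproper : 𝒬.IsProper)

include hproper

/-- Compact support in G is properness: g contributes only if it moves a point of supp u into supp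
v. -/
theorem isCc_corr {u v : P → ℂ} (hu : IsCc (a := n + d) u) (hv : IsCc (a := n + d) v) :
    IsCc (a := n + k) (𝒬.corr u v) := by
  constructor
  · rw [← contMDiffOn_univ]
    refine contMDiffOn_integral_fibMeas (I := 𝓡 (n + k)) 𝒬.submersion_proj (vertDensity_vol _)
      isSmoothRetract_univ 𝒢.submersion_rng.contMDiff.contMDiffOn
      ((contMDiffOn_corr_integrand hu hv).mono fun y hy => hy.2) fun _ _ =>
      ⟨univ, Filter.univ_mem, tsupport u, hu.2, fun _ _ _ _ h =>
        subset_tsupport _ (left_ne_zero_of_mul h)⟩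
  · refine HasCompactSupport.intro
      ((𝒬.isCompact_pairs hproper hu.2.isCompact hv.2.isCompact).image continuous_snd)
      fun g hg => ?_
    refine integral_eq_zero_of_ae ?_
    filter_upwards [ae_fibMeas (lam := vol (a := n + d) (k := d) (N := P)) (m := 𝒢.rng g)
      𝒬.submersion_proj] with p hp
    by_contra h
    exact hg ⟨(p, g), ⟨hp, subset_tsupport _ (left_ne_zero_of_mul h),
      subset_tsupport _ (right_ne_zero_of_mul h)⟩, rfl⟩

section Cutoff

variable [MeasurableSpace G] [BorelSpace G] (h𝒢 : 𝒢.IsFoliationGroupoid)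
  {φ : P → ℂ} (hφ : IsCc (a := n + d) φ)

include h𝒢 hφ

/-- Insert 1 = ∫ φ(qg) dg under the integral and exchange the order. An integral over the fibre of P
thus becomes an integral over the fibre of G. -/
theorem integral_corr_eq (hφ1 : ∀ p, ∫ g, φ (𝒬.act p g) ∂𝒢.haar (𝒬.proj p) = 1)
    {u : P → ℂ} (hu : IsCc (a := n + d) u) (m : M) :
    ∫ p, u p ∂𝒬.zMeas m = ∫ g, 𝒬.corr u φ g ∂𝒢.haar m := by
  have hvd := vertDensity_vol (n := n) (k := d) 𝒬.proj
  have e1 : ∀ᵐ g ∂𝒢.haar m, 𝒬.corr u φ g = ∫ q, u q * φ (𝒬.act q g) ∂𝒬.zMeas m := by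
    filter_upwards [ae_fibMeas (lam := 𝒢.fiberVol) (m := m) 𝒢.submersion_rng] with g hg
    rw [corr, hg]
  have e2 : ∀ᵐ q ∂𝒬.zMeas m, u q = ∫ g, u q * φ (𝒬.act q g) ∂𝒢.haar m := by
    filter_upwards [ae_fibMeas (lam := vol (a := n + d) (k := d) (N := P)) (m := m)
      𝒬.submersion_proj] with q hq
    rw [integral_const_mul, ← hq, hφ1, mul_one]
  rw [integral_congr_ae e1, integral_congr_ae e2]
  refine integral_integral_swap_fibMeas 𝒬.submersion_proj hvd 𝒢.submersion_rng
    (𝒢.vertDensity_fiberVol h𝒢) ((contMDiffOn_corr_integrand hu hφ).continuousOn.mono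
      fun y hy => (hy.1 : _ = _).trans (hy.2 : _ = _).symm) hu.2.isCompact
      ((𝒬.isCompact_pairs hproper hu.2.isCompact hφ.2.isCompact).image continuous_snd) ?_
  intro q g hq hg h
  have h1 := subset_tsupport u (left_ne_zero_of_mul h)
  exact ⟨h1, (q, g), ⟨hq.trans hg.symm, h1, subset_tsupport _ (right_ne_zero_of_mul h)⟩, rfl⟩

end Cutoff

end GManifold

/-! ### Averages of an invariant pair and the inversion symmetry of their correlations. -/

namespace GManifold.IsInvariantPair

variable {n k d : ℕ} {M G P : Type*} [TopologicalSpace M] [ChartedSpace (Eu n) M]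
  [IsManifold (𝓡 n) ∞ M] [T2Space M] [SecondCountableTopology M]
  [TopologicalSpace G] [ChartedSpace (Eu (n + k)) G] [IsManifold (𝓡 (n + k)) ∞ G]
  [T2Space G] [SecondCountableTopology G] {𝒢 : LieGroupoid n k M G}
  [TopologicalSpace P] [ChartedSpace (Eu (n + d)) P] [IsManifold (𝓡 (n + d)) ∞ P]
  [T2Space P] [SecondCountableTopology P] {𝒬 : GManifold 𝒢 d P}
  [MeasurableSpace P] [BorelSpace P] {H : P → P → ℂ} (hH : 𝒬.IsInvariantPair H)
  {φ : P → ℂ} (hφ : IsCc (a := n + d) φ)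

/-- The function `q ↦ ∫_{Z_{π(q)}} φ(p) H(q, p)`. -/
def avg (_ : 𝒬.IsInvariantPair H) (φ : P → ℂ) (q : P) : ℂ := ∫ p, φ p * H q p ∂𝒬.zMeas (𝒬.proj q)

include hH hφ

theorem contMDiffOn_mul : ContMDiffOn ((𝓡 (n + d)).prod (𝓡 (n + d))) 𝓘(ℝ, ℂ) ∞
    (fun y : P × P => φ y.1 * H y.2 y.1) {y | 𝒬.proj y.1 = 𝒬.proj y.2} :=
  contMDiffOn_cmul (hφ.1.comp contMDiff_fst).contMDiffOn hH.swap.smooth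

theorem isCc_avg : IsCc (a := n + d) (hH.avg φ) := by
  constructor
  · rw [← contMDiffOn_univ]
    exact contMDiffOn_integral_fibMeas (I := 𝓡 (n + d)) 𝒬.submersion_proj (vertDensity_vol _)
      isSmoothRetract_univ 𝒬.submersion_proj.contMDiff.contMDiffOn
      ((hH.contMDiffOn_mul hφ).mono fun y hy => hy.2) fun _ _ =>
      ⟨univ, Filter.univ_mem, tsupport φ, hφ.2, fun _ _ _ _ h =>
        subset_tsupport _ (left_ne_zero_of_mul h)⟩
  · obtain ⟨L, hL, h⟩ := hH.compact_left _ hφ.2.isCompact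
    refine HasCompactSupport.intro hL fun q hq => ?_
    refine integral_eq_zero_of_ae ?_
    filter_upwards [ae_fibMeas (lam := vol (a := n + d) (k := d) (N := P)) (m := 𝒬.proj q)
      𝒬.submersion_proj] with p hp
    by_contra h0
    exact hq (h p (subset_tsupport _ (left_ne_zero_of_mul h0)) q hp.symm (right_ne_zero_of_mul h0))

theorem integral_avg (m : M) : ∫ q, hH.avg φ q ∂𝒬.zMeas m =
    ∫ p, φ p * ∫ q, H q p ∂𝒬.zMeas m ∂𝒬.zMeas m := by
  have hvd := vertDensity_vol (n := n) (k := d) 𝒬.proj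
  have e1 : ∀ᵐ q ∂𝒬.zMeas m, hH.avg φ q = ∫ p, φ p * H q p ∂𝒬.zMeas m := by
    filter_upwards [ae_fibMeas (lam := vol (a := n + d) (k := d) (N := P)) (m := m)
      𝒬.submersion_proj] with q hq
    rw [avg, hq]
  obtain ⟨L, hL, hL'⟩ := hH.compact_left _ hφ.2.isCompact
  rw [integral_congr_ae e1]
  simp only [← integral_const_mul]
  refine integral_integral_swap_fibMeas 𝒬.submersion_proj hvd 𝒬.submersion_proj hvd
    (((hH.contMDiffOn_mul hφ).continuousOn).comp continuous_swap.continuousOn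
      fun y hy => (hy.2 : _ = _).trans (hy.1 : _ = _).symm) hL hφ.2.isCompact ?_
  intro q p hq hp h
  have h1 := subset_tsupport φ (left_ne_zero_of_mul h)
  exact ⟨hL' p h1 q (hq.trans hp.symm) (right_ne_zero_of_mul h), h1⟩

/-- Substituting p ↦ pg produces the Jacobian at p. Together with the given one at q, it is exactly
what the invariance of `H` absorbs. -/
theorem avg_act {q : P} {g : G} (hq : 𝒬.proj q = 𝒢.rng g) :
    (jac 𝒬 (vol (a := n + d) (N := P)) g q : ℂ) * hH.avg φ (𝒬.act q g) =
      ∫ p, φ (𝒬.act p g) * H q p ∂𝒬.zMeas (𝒢.rng g) := by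
  have hvd := vertDensity_vol (n := n) (k := d) 𝒬.proj
  have hmaps : MapsTo (fun p => (p, 𝒬.act q g)) (𝒬.proj ⁻¹' {𝒢.src g})
      {y : P × P | 𝒬.proj y.1 = 𝒬.proj y.2} := fun p hp =>
    (hp : _ = _).trans (𝒬.proj_act _ _ hq).symm
  rw [avg, 𝒬.proj_act _ _ hq, integral_translate hvd g (F := fun p => φ p * H (𝒬.act q g) p) (C := tsupport φ)
    ((hH.contMDiffOn_mul hφ).continuousOn.comp (by fun_prop) hmaps) hφ.2.isCompact
    fun p _ h => subset_tsupport _ (left_ne_zero_of_mul h), ← integral_const_mul]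
  refine integral_congr_ae ?_
  filter_upwards [ae_fibMeas (lam := vol (a := n + d) (k := d) (N := P)) (m := 𝒢.rng g)
    𝒬.submersion_proj] with p hp
  rw [← hH.invariant q p g hq hp, Complex.real_smul]
  ring

/-- Substituting q ↦ qg turns φ(qg⁻¹) into φ(q) and puts the Jacobian in front of the average, where
`avg_act` applies. -/
theorem corr_avg_inv_eq_integral (g : G) : 𝒬.corr (hH.avg φ) φ (𝒢.inv g) =
    ∫ q, ∫ p, φ q * H q p * φ (𝒬.act p g) ∂𝒬.zMeas (𝒢.rng g) ∂𝒬.zMeas (𝒢.rng g) := by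
  have hvd := vertDensity_vol (n := n) (k := d) 𝒬.proj
  have hA := hH.isCc_avg hφ
  have hmaps : MapsTo (fun q => (q, 𝒢.inv g)) (𝒬.proj ⁻¹' {𝒢.src g})
      {y : P × G | 𝒬.proj y.1 = 𝒢.rng y.2} := fun q hq =>
    (hq : _ = _).trans (𝒢.rng_inv g).symm
  have hcont : ContinuousOn (fun q => hH.avg φ q * φ (𝒬.act q (𝒢.inv g))) (𝒬.proj ⁻¹' {𝒢.src g}) :=
    ContinuousOn.comp (f := fun q : P => (q, 𝒢.inv g))
      (contMDiffOn_corr_integrand hA hφ).continuousOn (by fun_prop) hmaps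
  have h1 := integral_translate hvd g hcont hA.2.isCompact
    fun p _ h => subset_tsupport _ (left_ne_zero_of_mul h)
  rw [corr, 𝒢.rng_inv]
  refine h1.trans (integral_congr_ae ?_)
  filter_upwards [ae_fibMeas (lam := vol (a := n + d) (k := d) (N := P)) (m := 𝒢.rng g)
    𝒬.submersion_proj] with q hq
  rw [𝒬.act_inv hq, Complex.real_smul, ← mul_assoc, hH.avg_act hφ hq, mul_comm,
    ← integral_const_mul]
  exact integral_congr_ae (Filter.Eventually.of_forall fun p => by ring)

theorem corr_swap_avg_eq_integral (g : G) : 𝒬.corr (hH.swap.avg φ) φ g =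
    ∫ p, ∫ q, φ q * H q p * φ (𝒬.act p g) ∂𝒬.zMeas (𝒢.rng g) ∂𝒬.zMeas (𝒢.rng g) := by
  rw [corr]
  refine integral_congr_ae ?_
  filter_upwards [ae_fibMeas (lam := vol (a := n + d) (k := d) (N := P)) (m := 𝒢.rng g)
    𝒬.submersion_proj] with p hp
  rw [avg, hp, integral_mul_const]

theorem continuousOn_mul_act (g : G) :
    ContinuousOn (fun y : P × P => φ y.1 * H y.1 y.2 * φ (𝒬.act y.2 g))
      ((𝒬.proj ⁻¹' {𝒢.rng g}) ×ˢ (𝒬.proj ⁻¹' {𝒢.rng g})) := by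
  have hc1 : ContinuousOn (fun y : P × P => φ y.1 * H y.1 y.2)
      ((𝒬.proj ⁻¹' {𝒢.rng g}) ×ˢ (𝒬.proj ⁻¹' {𝒢.rng g})) :=
    (hH.swap.contMDiffOn_mul hφ).continuousOn.mono fun y hy =>
      (hy.1 : _ = _).trans (hy.2 : _ = _).symm
  have hc2 : ContinuousOn (fun y : P × P => φ (𝒬.act y.2 g))
      ((𝒬.proj ⁻¹' {𝒢.rng g}) ×ˢ (𝒬.proj ⁻¹' {𝒢.rng g})) :=
    hφ.1.continuous.comp_continuousOn ((𝒬.contMDiffOn_act_right g).continuousOn.comp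
      continuousOn_snd fun y hy => hy.2)
  exact hc1.mul hc2

/-- Both sides are the double integral of φ(q)H(q,p)φ(pg) over the fibre over r(g), in opposite
orders. Thus inverting g has the effect of exchanging the two arguments of `H`. -/
theorem corr_avg_inv (g : G) :
    𝒬.corr (hH.avg φ) φ (𝒢.inv g) = 𝒬.corr (hH.swap.avg φ) φ g := by
  have hvd := vertDensity_vol (n := n) (k := d) 𝒬.proj
  obtain ⟨L, hL, hL'⟩ := hH.compact_right _ hφ.2.isCompact
  rw [hH.corr_avg_inv_eq_integral hφ, hH.corr_swap_avg_eq_integral hφ]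
  refine integral_integral_swap_fibMeas 𝒬.submersion_proj hvd 𝒬.submersion_proj hvd
    (hH.continuousOn_mul_act hφ g) hφ.2.isCompact hL fun q p hq hp h => ?_
  have h0 := left_ne_zero_of_mul h
  have h1 := subset_tsupport φ (left_ne_zero_of_mul h0)
  exact ⟨h1, hL' q h1 p (hq.trans hp.symm) (right_ne_zero_of_mul h0)⟩

end GManifold.IsInvariantPair

/-! ### Push-forward of functions on P to leafwise densities, and the trace of an average. -/

namespace GManifold

variable {n k d : ℕ} {M G P : Type*} [TopologicalSpace M] [ChartedSpace (Eu n) M]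
  [IsManifold (𝓡 n) ∞ M] [T2Space M] [SecondCountableTopology M]
  [TopologicalSpace G] [ChartedSpace (Eu (n + k)) G] [IsManifold (𝓡 (n + k)) ∞ G]
  [T2Space G] [SecondCountableTopology G] {𝒢 : LieGroupoid n k M G}
  [TopologicalSpace P] [ChartedSpace (Eu (n + d)) P] [IsManifold (𝓡 (n + d)) ∞ P]
  [T2Space P] [SecondCountableTopology P] (𝒬 : GManifold 𝒢 d P)
  [MeasurableSpace P] [BorelSpace P]

/-- The leafwise density whose coefficient is the integral over the fibres of `π`. -/
def push (u : P → ℂ) (hu : IsCc (a := n + d) u) : 𝒢.LeafDensities :=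
  𝒢.mkDens contMDiff_id _ (𝒬.isCc_integral_zMeas hu)

theorem push_congr {u v : P → ℂ} (hu : IsCc (a := n + d) u) (hv : IsCc (a := n + d) v)
    (h : ∀ m, ∫ p, u p ∂𝒬.zMeas m = ∫ p, v p ∂𝒬.zMeas m) : 𝒬.push u hu = 𝒬.push v hv := by
  refine Subtype.ext (funext fun m => funext fun w => ?_)
  simp only [push, LieGroupoid.mkDens, LieGroupoid.density, h]

theorem integrable_zMeas {u : P → ℂ} (hu : IsCc (a := n + d) u) (m : M) :
    Integrable u (𝒬.zMeas m) :=
  integrable_fibMeas 𝒬.submersion_proj (vertDensity_vol _) hu.1.continuous.continuousOn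
    hu.2.isCompact fun _ _ h => subset_tsupport _ h

theorem push_add {u v w : P → ℂ} (hu : IsCc (a := n + d) u) (hv : IsCc (a := n + d) v)
    (hw : IsCc (a := n + d) w) (h : ∀ p, w p = u p + v p) :
    𝒬.push w hw = 𝒬.push u hu + 𝒬.push v hv := by
  refine Subtype.ext (funext fun m => funext fun x => ?_)
  have h1 : ∫ p, w p ∂𝒬.zMeas m = ∫ p, u p ∂𝒬.zMeas m + ∫ p, v p ∂𝒬.zMeas m := by
    rw [← integral_add (𝒬.integrable_zMeas hu m) (𝒬.integrable_zMeas hv m)]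
    exact integral_congr_ae (Filter.Eventually.of_forall h)
  rw [Submodule.coe_add, Pi.add_apply, Pi.add_apply]
  simp only [push, LieGroupoid.mkDens, LieGroupoid.density]
  split_ifs
  · rw [h1, add_mul]
  · rw [add_zero]

theorem push_smul {u w : P → ℂ} (hu : IsCc (a := n + d) u) (hw : IsCc (a := n + d) w) (c : ℂ)
    (h : ∀ p, w p = c * u p) : 𝒬.push w hw = c • 𝒬.push u hu := by
  refine Subtype.ext (funext fun m => funext fun x => ?_)
  have h1 : ∫ p, w p ∂𝒬.zMeas m = c * ∫ p, u p ∂𝒬.zMeas m := by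
    rw [← integral_const_mul]
    exact integral_congr_ae (Filter.Eventually.of_forall h)
  rw [Submodule.coe_smul, Pi.smul_apply, Pi.smul_apply, smul_eq_mul]
  simp only [push, LieGroupoid.mkDens, LieGroupoid.density]
  split_ifs
  · rw [h1, mul_assoc]
  · rw [mul_zero]

variable {𝒬}

/-- A trace does not distinguish the two iterated integrals of a function on `P ×_M P`. -/
theorem IsInvariantPair.trace_push_avg [MeasurableSpace G] [BorelSpace G]
    {H : P → P → ℂ} (hH : 𝒬.IsInvariantPair H) {φ : P → ℂ}
    (hφ : IsCc (a := n + d) φ) (hproper : 𝒬.IsProper) (h𝒢 : 𝒢.IsFoliationGroupoid)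
    (hφ1 : ∀ p, ∫ g, φ (𝒬.act p g) ∂𝒢.haar (𝒬.proj p) = 1)
    {ρ : 𝒢.LeafDensities →ₗ[ℂ] ℂ} (hρ : 𝒢.IsTrace (ρ ∘ₗ 𝒢.restrictUnits)) :
    ρ (𝒬.push _ (hH.isCc_avg hφ)) = ρ (𝒬.push _ (hH.swap.isCc_avg hφ)) := by
  refine 𝒢.trace_inv h𝒢 hρ (isCc_corr hproper (hH.isCc_avg hφ) hφ) _ _
    (integral_corr_eq hproper h𝒢 hφ hφ1 (hH.isCc_avg hφ)) fun m => ?_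
  simp only [hH.corr_avg_inv hφ]
  exact integral_corr_eq hproper h𝒢 hφ hφ1 (hH.swap.isCc_avg hφ) m

end GManifold

/-! ### The supertrace -/

namespace EquivariantGrading

variable {n k d : ℕ} {M G P : Type*} [TopologicalSpace M] [ChartedSpace (Eu n) M]
  [IsManifold (𝓡 n) ∞ M] [T2Space M] [SecondCountableTopology M]
  [TopologicalSpace G] [ChartedSpace (Eu (n + k)) G] [IsManifold (𝓡 (n + k)) ∞ G]
  [T2Space G] [SecondCountableTopology G] {𝒢 : LieGroupoid n k M G}
  [TopologicalSpace P] [ChartedSpace (Eu (n + d)) P] [IsManifold (𝓡 (n + d)) ∞ P]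
  [T2Space P] [SecondCountableTopology P] {𝒬 : GManifold 𝒢 d P}
  {F : Type*} [NormedAddCommGroup F] [NormedSpace ℂ F] [FiniteDimensional ℂ F]
  {E : P → Type*} [∀ p, AddCommGroup (E p)] [∀ p, Module ℂ (E p)]
  [TopologicalSpace (TotalSpace F E)] [∀ p, TopologicalSpace (E p)]
  [FiberBundle F E] [VectorBundle ℂ F E] [VectorBundle ℝ F E]
  [ContMDiffVectorBundle ∞ F E (𝓡 (n + d))]
  {𝓔 : EquivariantGrading 𝒬 F E}
  {T T₁ T₂ : ∀ p' p : P, E p' →ₗ[ℂ] E p}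

theorem contMDiffWithinAt_trs {EQ HQ Q : Type*} [NormedAddCommGroup EQ] [NormedSpace ℝ EQ]
    [TopologicalSpace HQ] {I : ModelWithCorners ℝ EQ HQ} [TopologicalSpace Q] [ChartedSpace HQ Q]
    {S : Set Q} {x₀ : Q} {p : Q → P} {L : ∀ x, E (p x) →ₗ[ℂ] E (p x)}
    (hp : ContMDiffWithinAt I (𝓡 (n + d)) ∞ p S x₀)
    (hL : ∀ s : ∀ x, E (p x), ContMDiffWithinAt I ((𝓡 (n + d)).prod 𝓘(ℝ, F)) ∞
      (fun x => (⟨p x, s x⟩ : TotalSpace F E)) S x₀ →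
      ContMDiffWithinAt I ((𝓡 (n + d)).prod 𝓘(ℝ, F)) ∞
        (fun x => (⟨p x, L x (s x)⟩ : TotalSpace F E)) S x₀) :
    ContMDiffWithinAt I 𝓘(ℝ, ℂ) ∞ (fun x => 𝓔.trs (p x) (L x)) S x₀ :=
  contMDiffWithinAt_trace (T := fun x => 𝓔.grading (p x) ∘ₗ L x) hp fun s hs =>
    𝓔.contMDiff_grading.contMDiffAt.comp_contMDiffWithinAt x₀ (hL s hs)

theorem IsKer.contMDiff_trs (hT : 𝓔.IsKer T) :
    ContMDiff (𝓡 (n + d)) 𝓘(ℝ, ℂ) ∞ (fun p => 𝓔.trs p (T p p)) := by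
  rw [← contMDiffOn_univ]
  refine fun x hx => contMDiffWithinAt_trs (p := id) contMDiffWithinAt_id fun s hs => ?_
  exact hT.contMDiffWithinAt_apply hx (p' := id) (p := id) contMDiffWithinAt_id (fun _ _ => rfl) hs

theorem IsKer.isCc_mul_trs (hT : 𝓔.IsKer T) {φ : P → ℂ} (hφ : IsCc (a := n + d) φ) :
    IsCc (a := n + d) (fun p => φ p * 𝓔.trs p (T p p)) := by
  refine ⟨?_, hφ.2.mul_right⟩
  rw [← contMDiffOn_univ]
  exact contMDiffOn_cmul hφ.1.contMDiffOn hT.contMDiff_trs.contMDiffOn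

section Composition

variable (hproper : 𝒬.IsProper) (hT₁ : 𝓔.IsKer T₁) (hT₂ : 𝓔.IsKer T₂)

include hT₁ hT₂ in
theorem contMDiffOn_trs_comp : ContMDiffOn ((𝓡 (n + d)).prod (𝓡 (n + d))) 𝓘(ℝ, ℂ) ∞
    (fun x : P × P => 𝓔.trs x.2 (T₁ x.1 x.2 ∘ₗ T₂ x.2 x.1)) {x | 𝒬.proj x.1 = 𝒬.proj x.2} := by
  refine fun x hx => contMDiffWithinAt_trs (p := Prod.snd) contMDiffWithinAt_snd fun s hs => ?_
  have h1 : ContMDiffWithinAt ((𝓡 (n + d)).prod (𝓡 (n + d))) ((𝓡 (n + d)).prod 𝓘(ℝ, F)) ∞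
      (fun x : P × P => (⟨x.1, T₂ x.2 x.1 (s x)⟩ : TotalSpace F E))
      {x | 𝒬.proj x.1 = 𝒬.proj x.2} x :=
    hT₂.contMDiffWithinAt_apply hx (p' := Prod.snd) (p := Prod.fst) contMDiffWithinAt_fst
      (fun _ h => Eq.symm h) hs
  exact hT₁.contMDiffWithinAt_apply hx (p' := Prod.fst) (p := Prod.snd) contMDiffWithinAt_snd
      (fun _ h => h) h1

theorem trs_zero (p : P) : 𝓔.trs p 0 = 0 := by rw [trs, LinearMap.comp_zero, map_zero]

theorem trs_add (p : P) (L L' : E p →ₗ[ℂ] E p) : 𝓔.trs p (L + L') = 𝓔.trs p L + 𝓔.trs p L' := by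
  rw [trs, LinearMap.comp_add, map_add, trs, trs]

theorem trs_smul (p : P) (c : ℂ) (L : E p →ₗ[ℂ] E p) : 𝓔.trs p (c • L) = c * 𝓔.trs p L := by
  rw [trs, LinearMap.comp_smul, map_smul, trs, smul_eq_mul]

variable [MeasurableSpace P] [BorelSpace P]

include hproper hT₁ hT₂ in
theorem trs_compKer (p : P) : 𝓔.trs p (𝓔.compKer T₁ T₂ p p) =
    ∫ q, 𝓔.trs p (T₁ q p ∘ₗ T₂ p q) ∂𝒬.zMeas (𝒬.proj p) :=
  apply_compKer hproper hT₁ hT₂ rfl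
    (LinearMap.trace ℂ (E p) ∘ₗ LinearMap.mulLeft ℂ (𝓔.grading p : Module.End ℂ (E p)))

variable {K₁ K₂ : Module.End ℂ 𝓔.Sec} (hK₁ : 𝓔.IsModuleEnd K₁) (hK₂ : 𝓔.IsModuleEnd K₂)
  (h₁ : Represents T₁ K₁) (h₂ : Represents T₂ K₂) (h𝒢 : 𝒢.IsFoliationGroupoid)

include hproper hT₁ hT₂ hK₁ hK₂ h₁ h₂ h𝒢 in
-- The identification E_p ≃ E_{pg} conjugates one endomorphism into the other and commutes with the
-- grading, and traces are conjugation invariant. The first kernel contributes the Jacobian at q,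
-- the second the one at p.
theorem isInvariantPair_trs : 𝒬.IsInvariantPair (fun q p => 𝓔.trs p (T₁ q p ∘ₗ T₂ p q)) where
  smooth := contMDiffOn_trs_comp hT₁ hT₂
  compact_left L hL := by
    obtain ⟨L', hL', h⟩ := hT₁.exists_compact_left hproper hL
    exact ⟨L', hL', fun p hp q hq h0 => h p hp q hq fun h1 => h0 (by
      rw [h1, LinearMap.zero_comp, trs_zero])⟩
  compact_right L hL := by
    obtain ⟨L', hL', h⟩ := hT₁.exists_compact_right hproper hL
    exact ⟨L', hL', fun p hp q hq h0 => h p hp q hq fun h1 => h0 (by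
      rw [h1, LinearMap.zero_comp, trs_zero])⟩
  invariant q p g hq hp := by
    rw [trs, trs, ← LinearMap.trace_conj' _ (𝓔.lift p g), ← smul_eq_mul, ← map_smul]
    congr 1
    refine LinearMap.ext fun v => ?_
    obtain ⟨v, rfl⟩ := (𝓔.lift p g).surjective v
    rw [LinearEquiv.conj_apply_apply, LinearEquiv.symm_apply_apply]
    simp only [LinearMap.comp_apply, LinearMap.smul_apply]
    rw [← 𝓔.grading_lift p g _ hp, hT₁.invariant h𝒢 hproper hK₁ h₁ hp hq,
      hT₂.invariant h𝒢 hproper hK₂ h₂ hq hp]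
    simp only [map_smul, smul_smul]

end Composition

variable [MeasurableSpace P] [BorelSpace P]

/-- Composing with the grading operator changes the kernel by the pointwise grading, so uniqueness
of kernels transfers the parity of the operator to its kernel. -/
theorem IsKer.comp_grading (hT : 𝓔.IsKer T) {K : Module.End ℂ 𝓔.Sec} (h : Represents T K) {i : ℕ}
    (hi : 𝓔.HasParity K i) {q p : P} (hq : 𝒬.proj q = 𝒬.proj p) :
    T q p ∘ₗ 𝓔.grading q = (-1 : ℂ) ^ i • (𝓔.grading p ∘ₗ T q p) := by
  refine eq_of_integral_eq (𝓔 := 𝓔) (S := fun q => T q p ∘ₗ 𝓔.grading q)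
    (S' := fun q => (-1 : ℂ) ^ i • (𝓔.grading p ∘ₗ T q p))
    (fun ξ ℓ => hT.continuousOn_section (𝓔.gradingOp ξ) p ℓ)
    (fun ξ ℓ => ?_) (fun ξ ℓ => ?_) hq
  · refine (hT.continuousOn_section ξ p ((-1 : ℂ) ^ i • (ℓ ∘ₗ 𝓔.grading p))).congr fun q _ => ?_
    simp only [LinearMap.smul_apply, LinearMap.comp_apply, map_smul]
  · refine (h (𝓔.gradingOp ξ) p ℓ).symm.trans ?_
    have h1 : K (𝓔.gradingOp ξ) = (-1 : ℂ) ^ i • 𝓔.gradingOp (K ξ) := LinearMap.congr_fun hi ξ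
    have h2 := h ξ p ((-1 : ℂ) ^ i • (ℓ ∘ₗ 𝓔.grading p))
    rw [h1]
    simp only [LinearMap.smul_apply, LinearMap.comp_apply, map_smul] at h2 ⊢
    rw [← h2, ← map_smul ℓ]
    rfl

/-- Cyclicity of the ordinary trace moves the first kernel to the front. Passing it across the
grading then costs the sign. -/
theorem trs_comp_comm (hT₁ : 𝓔.IsKer T₁) {K : Module.End ℂ 𝓔.Sec} (h : Represents T₁ K) {i : ℕ}
    (hi : 𝓔.HasParity K i) {q p : P} (hq : 𝒬.proj q = 𝒬.proj p) :
    𝓔.trs p (T₂ q p ∘ₗ T₁ p q) = (-1 : ℂ) ^ i * 𝓔.trs q (T₁ p q ∘ₗ T₂ q p) := by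
  have hfin := fun p => finiteDimensional_fiber F E p
  have h1 := hT₁.comp_grading h hi hq.symm
  rw [trs, trs, ← LinearMap.comp_assoc, LinearMap.trace_comp_comm', ← LinearMap.comp_assoc, h1,
    LinearMap.smul_comp, map_smul, smul_eq_mul, LinearMap.comp_assoc]

end EquivariantGrading

theorem IsCc.const_mul {a : ℕ} {N : Type*} [TopologicalSpace N] [ChartedSpace (Eu a) N]
    {u : N → ℂ} (hu : IsCc (a := a) u) (c : ℂ) : IsCc (a := a) (fun y => c * u y) := by
  refine ⟨?_, hu.2.mul_left⟩
  rw [← contMDiffOn_univ]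
  exact contMDiffOn_cmul contMDiffOn_const hu.1.contMDiffOn

/-! ### The algebra of smoothing operators and its supertrace -/

namespace EquivariantGrading

variable {n k d : ℕ} {M G P : Type*} [TopologicalSpace M] [ChartedSpace (Eu n) M]
  [IsManifold (𝓡 n) ∞ M] [T2Space M] [SecondCountableTopology M]
  [TopologicalSpace G] [ChartedSpace (Eu (n + k)) G] [IsManifold (𝓡 (n + k)) ∞ G]
  [T2Space G] [SecondCountableTopology G] {𝒢 : LieGroupoid n k M G}
  [TopologicalSpace P] [ChartedSpace (Eu (n + d)) P] [IsManifold (𝓡 (n + d)) ∞ P]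
  [T2Space P] [SecondCountableTopology P] {𝒬 : GManifold 𝒢 d P}
  {F : Type*} [NormedAddCommGroup F] [NormedSpace ℂ F] [FiniteDimensional ℂ F]
  {E : P → Type*} [∀ p, AddCommGroup (E p)] [∀ p, Module ℂ (E p)]
  [TopologicalSpace (TotalSpace F E)] [∀ p, TopologicalSpace (E p)]
  [FiberBundle F E] [VectorBundle ℂ F E] [VectorBundle ℝ F E]
  [ContMDiffVectorBundle ∞ F E (𝓡 (n + d))]
  (𝓔 : EquivariantGrading 𝒬 F E)

section Algebra

variable (h𝒢 : 𝒢.IsFoliationGroupoid) (hproper : 𝒬.IsProper) {K L : Module.End ℂ 𝓔.Sec}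

include h𝒢

theorem isModuleEnd_zero : 𝓔.IsModuleEnd 0 := by
  borelize G
  refine (𝓔.isModuleEnd_iff h𝒢).2 fun u hu ξ => ?_
  have h := 𝓔.actSec_smul h𝒢 hu 0 ξ
  rw [zero_smul, zero_smul] at h
  exact h.symm

variable {𝓔}

theorem IsModuleEnd.add (hK : 𝓔.IsModuleEnd K) (hL : 𝓔.IsModuleEnd L) : 𝓔.IsModuleEnd (K + L) := by
  borelize G
  refine (𝓔.isModuleEnd_iff h𝒢).2 fun u hu ξ => ?_
  rw [LinearMap.add_apply, LinearMap.add_apply, (𝓔.isModuleEnd_iff h𝒢).1 hK,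
    (𝓔.isModuleEnd_iff h𝒢).1 hL, 𝓔.actSec_add]

theorem IsModuleEnd.smul (hK : 𝓔.IsModuleEnd K) (c : ℂ) : 𝓔.IsModuleEnd (c • K) := by
  borelize G
  refine (𝓔.isModuleEnd_iff h𝒢).2 fun u hu ξ => ?_
  rw [LinearMap.smul_apply, LinearMap.smul_apply, (𝓔.isModuleEnd_iff h𝒢).1 hK, 𝓔.actSec_smul]

omit h𝒢 in
theorem IsModuleEnd.mul (hK : 𝓔.IsModuleEnd K) (hL : 𝓔.IsModuleEnd L) : 𝓔.IsModuleEnd (K * L) :=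
  fun b _ _ h => hK b _ _ (hL b _ _ h)

omit h𝒢

variable (𝓔)

/-- The algebra `End^∞_ℬ(ℰ)`. -/
def smoothingAlgebra : NonUnitalSubalgebra ℂ (Module.End ℂ 𝓔.Sec) where
  carrier := 𝓔.smoothingEnd
  zero_mem' := by
    borelize P
    exact mem_smoothingEnd_iff.2 ⟨𝓔.isModuleEnd_zero h𝒢, _, 𝓔.isKer_zero, fun ξ p ℓ => by
      simp only [LinearMap.zero_apply, map_zero, integral_zero]
      exact map_zero ℓ⟩
  add_mem' hK hL := by
    borelize P
    obtain ⟨hK, T, hT, h⟩ := mem_smoothingEnd_iff.1 hK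
    obtain ⟨hL, T', hT', h'⟩ := mem_smoothingEnd_iff.1 hL
    exact mem_smoothingEnd_iff.2 ⟨hK.add h𝒢 hL, _, hT.add hT', h.add hT hT' h'⟩
  mul_mem' hK hL := by
    borelize P
    obtain ⟨hK, T, hT, h⟩ := mem_smoothingEnd_iff.1 hK
    obtain ⟨hL, T', hT', h'⟩ := mem_smoothingEnd_iff.1 hL
    exact mem_smoothingEnd_iff.2 ⟨hK.mul hL, _, isKer_compKer hproper hT hT',
      h.comp hproper hT hT' h'⟩
  smul_mem' c K hK := by
    borelize P
    obtain ⟨hK, T, hT, h⟩ := mem_smoothingEnd_iff.1 hK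
    exact mem_smoothingEnd_iff.2 ⟨hK.smul h𝒢 c, _, hT.smul c, h.smul c⟩

end Algebra

section Tau

variable (h𝒢 : 𝒢.IsFoliationGroupoid) (hproper : 𝒬.IsProper) [MeasurableSpace P] [BorelSpace P]

theorem exists_ker (K : 𝓔.smoothingAlgebra h𝒢 hproper) :
    ∃ T : ∀ p' p : P, E p' →ₗ[ℂ] E p, 𝓔.IsKer T ∧ Represents T K.1 :=
  (mem_smoothingEnd_iff.1 K.2).2

/-- The kernel of a smoothing operator, with respect to the volume of the fibres. -/
def ker (K : 𝓔.smoothingAlgebra h𝒢 hproper) : ∀ p' p : P, E p' →ₗ[ℂ] E p :=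
  (𝓔.exists_ker h𝒢 hproper K).choose

theorem isKer_ker (K : 𝓔.smoothingAlgebra h𝒢 hproper) : 𝓔.IsKer (𝓔.ker h𝒢 hproper K) :=
  (𝓔.exists_ker h𝒢 hproper K).choose_spec.1

theorem represents_ker (K : 𝓔.smoothingAlgebra h𝒢 hproper) :
    Represents (𝓔.ker h𝒢 hproper K) K.1 :=
  (𝓔.exists_ker h𝒢 hproper K).choose_spec.2

/-- By uniqueness, any kernel representing the operator may replace the chosen one on the diagonal.
-/
theorem trs_ker {K : 𝓔.smoothingAlgebra h𝒢 hproper} {T : ∀ p' p : P, E p' →ₗ[ℂ] E p}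
    (hT : 𝓔.IsKer T) (h : Represents T K.1) (p : P) :
    𝓔.trs p (𝓔.ker h𝒢 hproper K p p) = 𝓔.trs p (T p p) := by
  rw [(𝓔.isKer_ker h𝒢 hproper K).eq_of_represents hT (𝓔.represents_ker h𝒢 hproper K) h rfl]

/-- The map `τ`, for a density with coefficient `φ`. -/
def tau {φ : P → ℂ} (hφ : IsCc (a := n + d) φ) :
    𝓔.smoothingAlgebra h𝒢 hproper →ₗ[ℂ] 𝒢.LeafDensities where
  toFun K := 𝒬.push _ ((𝓔.isKer_ker h𝒢 hproper K).isCc_mul_trs hφ)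
  map_add' K L := 𝒬.push_add _ _ _ fun p => by
    have hK := 𝓔.isKer_ker h𝒢 hproper K
    have hL := 𝓔.isKer_ker h𝒢 hproper L
    rw [𝓔.trs_ker h𝒢 hproper (K := K + L) (hK.add hL) ((𝓔.represents_ker h𝒢 hproper K).add hK hL
      (𝓔.represents_ker h𝒢 hproper L)), trs_add, mul_add]
  map_smul' c K := 𝒬.push_smul _ _ c fun p => by
    rw [𝓔.trs_ker h𝒢 hproper (K := c • K) ((𝓔.isKer_ker h𝒢 hproper K).smul c)
      ((𝓔.represents_ker h𝒢 hproper K).smul c), trs_smul, mul_left_comm]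

theorem tau_eq {φ : P → ℂ} (hφ : IsCc (a := n + d) φ) {K : 𝓔.smoothingAlgebra h𝒢 hproper}
    {T : ∀ p' p : P, E p' →ₗ[ℂ] E p} (hT : 𝓔.IsKer T) (h : Represents T K.1) :
    𝓔.tau h𝒢 hproper hφ K = 𝒬.push _ (hT.isCc_mul_trs hφ) :=
  𝒬.push_congr ((𝓔.isKer_ker h𝒢 hproper K).isCc_mul_trs hφ) _ fun m => integral_congr_ae (Filter.Eventually.of_forall fun p => by
    simp only [𝓔.trs_ker h𝒢 hproper hT h])

theorem isTau_tau {φ : P → ℂ} (hφ : IsCc (a := n + d) φ) {Φ : 𝒬.PullbackDensities}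
    (hΦ : Φ.1 = 𝒢.density 𝒬.proj φ) {K : 𝓔.smoothingAlgebra h𝒢 hproper} {κ : 𝓔.Kernel}
    (hκ : 𝓔.IsSmoothKernel κ) (hKκ : 𝓔.HasKernel K.1 κ) :
    𝓔.IsTau Φ κ (𝓔.tau h𝒢 hproper hφ K) := by
  obtain ⟨T, hT, hTκ⟩ := exists_isKer hκ
  rw [𝓔.tau_eq h𝒢 hproper hφ hT ((hasKernel_iff hT hTκ).1 hKκ)]
  intro m w
  have hc := hT.isCc_mul_trs hφ
  -- On the fibre over m the leafwise factor of Φ does not depend on p. Its value on `w` is a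
  -- constant, zero for tuples not tangent to the leaf.
  set W : ℂ := open Classical in if ∀ i, w i ∈ 𝒢.leafTangent m then (vol m w : ℂ) else 0 with hW
  refine (hasFiberIntegral_iff 𝒬.submersion_proj (vertDensity_vol (n := n) (k := d) 𝒬.proj)
    (g := fun p => φ p * 𝓔.trs p (T p p) * W) ?_
    (hc.1.continuous.mul continuous_const).continuousOn
    hc.2.isCompact fun p _ h => subset_tsupport _ (left_ne_zero_of_mul h)).2 ?_
  · intro p hp v hv
    rw [hΦ, LieGroupoid.density, hp, hTκ p p rfl v hv, trs_smul, hW]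
    split_ifs <;> ring
  · rw [integral_mul_const, hW]
    simp only [GManifold.push, LieGroupoid.mkDens, LieGroupoid.density, id]
    split_ifs <;> simp

include h𝒢 hproper in
-- The leafwise volume in Φ at pg is taken on vectors pushed by ds to π(pg) = s(g), so it is exactly
-- `fiberVol` and only the coefficient φ(pg) remains.
theorem integral_eq_one_of_isCutoff [MeasurableSpace G] [BorelSpace G]
    {φ : P → ℂ} (hφ : IsCc (a := n + d) φ) {Φ : 𝒬.PullbackDensities}
    (hΦ : Φ.1 = 𝒢.density 𝒬.proj φ) (h : 𝒬.IsCutoff Φ) (p : P) :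
    ∫ g, φ (𝒬.act p g) ∂𝒢.haar (𝒬.proj p) = 1 := by
  refine ((hasFiberIntegral_iff 𝒢.submersion_rng (𝒢.vertDensity_fiberVol h𝒢)
    (g := fun g => φ (𝒬.act p g)) ?_ ?_ ((𝒬.isCompact_pairs hproper (isCompact_singleton (x := p))
      hφ.2.isCompact).image continuous_snd) ?_).1 (h p)).symm
  · intro g hg v hv
    have h1 : ∀ i, tder (a := n + k) (b := n) 𝒢.src g (v i) ∈
        𝒢.leafTangent (𝒬.proj (𝒬.act p g)) := fun i => by
      rw [𝒬.proj_act p g hg.symm]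
      exact 𝒢.tder_src_mem h𝒢 (hv i)
    rw [hΦ, 𝒢.density_apply h1, 𝒬.proj_act p g hg.symm]
    rfl
  · have h1 : ContinuousOn (fun g : G => (p, g)) (𝒢.rng ⁻¹' {𝒬.proj p}) := by fun_prop
    exact hφ.1.continuous.comp_continuousOn (ContinuousOn.comp (f := fun g : G => (p, g))
      𝒬.contMDiffOn_act.continuousOn h1 fun g hg => Eq.symm hg)
  · exact fun g hg h => ⟨(p, g), ⟨hg.symm, rfl, subset_tsupport _ h⟩, rfl⟩

/-- The functional `ρ ∘ τ` supercommutes with the homogeneous smoothing operators of parity `i`. -/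
theorem trace_tau_mul [MeasurableSpace G] [BorelSpace G]
    {φ : P → ℂ} (hφ : IsCc (a := n + d) φ)
    (hφ1 : ∀ p, ∫ g, φ (𝒬.act p g) ∂𝒢.haar (𝒬.proj p) = 1)
    {ρ : 𝒢.LeafDensities →ₗ[ℂ] ℂ} (hρ : 𝒢.IsTrace (ρ ∘ₗ 𝒢.restrictUnits))
    {K L : 𝓔.smoothingAlgebra h𝒢 hproper} {i : ℕ} (hi : 𝓔.HasParity K.1 i) :
    ρ (𝓔.tau h𝒢 hproper hφ (L * K)) = (-1 : ℂ) ^ i * ρ (𝓔.tau h𝒢 hproper hφ (K * L)) := by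
  obtain ⟨hK, T₁, hT₁, h₁⟩ := mem_smoothingEnd_iff.1 K.2
  obtain ⟨hL, T₂, hT₂, h₂⟩ := mem_smoothingEnd_iff.1 L.2
  -- The pair H(q,p) = tr_s(T₁(q,p)T₂(p,q)) governs both products: its average gives KL, and the
  -- average of the swapped pair gives LK up to sign.
  have hH := isInvariantPair_trs hproper hT₁ hT₂ hK hL h₁ h₂ h𝒢
  have e1 : 𝓔.tau h𝒢 hproper hφ (K * L) = 𝒬.push _ (hH.isCc_avg hφ) := by
    rw [𝓔.tau_eq h𝒢 hproper hφ (K := K * L) (isKer_compKer hproper hT₁ hT₂)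
      (h₁.comp hproper hT₁ hT₂ h₂)]
    refine 𝒬.push_congr _ _ fun m => ?_
    rw [hH.integral_avg hφ]
    refine integral_congr_ae ?_
    filter_upwards [ae_fibMeas (lam := vol (a := n + d) (k := d) (N := P)) (m := m)
      𝒬.submersion_proj] with p hp
    rw [trs_compKer hproper hT₁ hT₂, hp]
  have e2 : 𝓔.tau h𝒢 hproper hφ (L * K) =
      (-1 : ℂ) ^ i • 𝒬.push _ (hH.swap.isCc_avg hφ) := by
    rw [𝓔.tau_eq h𝒢 hproper hφ (K := L * K) (isKer_compKer hproper hT₂ hT₁)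
      (h₂.comp hproper hT₂ hT₁ h₁), ← 𝒬.push_smul (hH.swap.isCc_avg hφ)
      ((hH.swap.isCc_avg hφ).const_mul _) _ fun _ => rfl]
    refine 𝒬.push_congr _ _ fun m => ?_
    rw [integral_const_mul, hH.swap.integral_avg hφ, ← integral_const_mul]
    refine integral_congr_ae ?_
    filter_upwards [ae_fibMeas (lam := vol (a := n + d) (k := d) (N := P)) (m := m)
      𝒬.submersion_proj] with p hp
    rw [trs_compKer hproper hT₂ hT₁, hp, mul_left_comm]
    congr 1
    rw [← integral_const_mul]
    refine integral_congr_ae ?_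
    filter_upwards [ae_fibMeas (lam := vol (a := n + d) (k := d) (N := P)) (m := m)
      𝒬.submersion_proj] with q hq
    exact trs_comp_comm hT₁ h₁ hi (hq.trans hp.symm)
  rw [e1, e2, map_smul, smul_eq_mul, hH.trace_push_avg hφ hproper h𝒢 hφ1 hρ]

/-- The commutation rule needs only one factor homogeneous, with sign (-1)^i or (-1)^j according to
which factor it is. Choosing the factor suitably gives (-1)^(ij): an even factor if there is one,
either factor if both are odd. -/
theorem isSupertrace_tau [MeasurableSpace G] [BorelSpace G]
    {φ : P → ℂ} (hφ : IsCc (a := n + d) φ)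
    (hφ1 : ∀ p, ∫ g, φ (𝒬.act p g) ∂𝒢.haar (𝒬.proj p) = 1)
    {ρ : 𝒢.LeafDensities →ₗ[ℂ] ℂ} (hρ : 𝒢.IsTrace (ρ ∘ₗ 𝒢.restrictUnits)) :
    𝓔.IsSupertrace (𝓔.smoothingAlgebra h𝒢 hproper) (ρ ∘ₗ 𝓔.tau h𝒢 hproper hφ) := by
  intro K L i j hi hj
  have h1 := 𝓔.trace_tau_mul h𝒢 hproper hφ hφ1 hρ (L := L) hi
  have h2 := 𝓔.trace_tau_mul h𝒢 hproper hφ hφ1 hρ (L := K) hj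
  simp only [LinearMap.comp_apply]
  rcases Nat.even_or_odd i with he | ho
  · rw [h1, he.neg_one_pow, (he.mul_right j).neg_one_pow, one_mul, one_mul]
  · rcases Nat.even_or_odd j with he' | ho'
    · rw [he'.neg_one_pow, one_mul] at h2
      rw [(he'.mul_left i).neg_one_pow, h2, one_mul]
    · rw [(ho.mul ho').neg_one_pow, h2, ho'.neg_one_pow]

end Tau

end EquivariantGrading

theorem mainTheorem9 {n k d : ℕ} {M G P : Type*}
    [TopologicalSpace M] [ChartedSpace (Eu n) M] [IsManifold (𝓡 n) ∞ M]
    [T2Space M] [SecondCountableTopology M]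
    [TopologicalSpace G] [ChartedSpace (Eu (n + k)) G] [IsManifold (𝓡 (n + k)) ∞ G]
    [T2Space G] [SecondCountableTopology G]
    [TopologicalSpace P] [ChartedSpace (Eu (n + d)) P] [IsManifold (𝓡 (n + d)) ∞ P]
    [T2Space P] [SecondCountableTopology P]
    (𝒢 : LieGroupoid n k M G) (h𝒢 : 𝒢.IsFoliationGroupoid)
    (𝒬 : GManifold 𝒢 d P) (hfree : 𝒬.IsFree) (hproper : 𝒬.IsProper)
    (hcocompact : 𝒬.IsCocompact)
    {F : Type*} [NormedAddCommGroup F] [NormedSpace ℂ F] [FiniteDimensional ℂ F]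
    {E : P → Type*} [∀ p, AddCommGroup (E p)] [∀ p, Module ℂ (E p)]
    [TopologicalSpace (Bundle.TotalSpace F E)] [∀ p, TopologicalSpace (E p)]
    [FiberBundle F E] [VectorBundle ℂ F E] [VectorBundle ℝ F E]
    [ContMDiffVectorBundle ∞ F E (𝓡 (n + d))]
    (𝓔 : EquivariantGrading 𝒬 F E)
    (Φ : 𝒬.PullbackDensities) (hΦ : 𝒬.IsCutoff Φ)
    (ρ : 𝒢.LeafDensities →ₗ[ℂ] ℂ) (hρ : 𝒢.IsTrace (ρ ∘ₗ 𝒢.restrictUnits)) :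
    ∃ A : NonUnitalSubalgebra ℂ (Module.End ℂ 𝓔.Sec),
      (A : Set (Module.End ℂ 𝓔.Sec)) = 𝓔.smoothingEnd ∧
      ∃ τ : A →ₗ[ℂ] 𝒢.LeafDensities,
        (∀ (K : A) (κ : 𝓔.Kernel), 𝓔.IsSmoothKernel κ → 𝓔.HasKernel K.1 κ →
          𝓔.IsTau Φ κ (τ K)) ∧
        𝓔.IsSupertrace A (ρ ∘ₗ τ) := by
  borelize G
  borelize P
  -- The coefficient of Φ with respect to the leafwise volume is the cutoff function used in all the
  -- averages.
  obtain ⟨φ, hφ, hΦφ⟩ := 𝒢.exists_scalar h𝒢 𝒬.submersion_proj.contMDiff Φ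
  exact ⟨𝓔.smoothingAlgebra h𝒢 hproper, rfl, 𝓔.tau h𝒢 hproper hφ,
    fun K κ hκ hK => 𝓔.isTau_tau h𝒢 hproper hφ hΦφ hκ hK,
    𝓔.isSupertrace_tau h𝒢 hproper hφ
      (EquivariantGrading.integral_eq_one_of_isCutoff h𝒢 hproper hφ hΦφ hΦ) hρ⟩
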